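/- **Setting.** Let $d\ge 0$, $\alpha\in\mathbb R$, $\mathfrak s=(2,1,\dots,1)$, $|n|_{\mathfrak s}=\sum_{i=0}^d\mathfrak s_i n_i$ for $n\in\mathbb N^{d+1}$. Decorated trees are the non-planar rooted trees $\tau=X^k\Xi^l\dot\Xi^m\prod_{i}\mathcal I_{a_i}(\tau_i)$ ($k,a_i\in\mathbb N^{d+1}$, $l,m\in\mathbb N$), multiplied by identifying roots; $\mathcal T$ is their real linear span, modulo $\mathcal I_a(X^k)=0$, so that $\mathcal I_a$ is linear on $\mathcal T$. Let $|\tau|_\Xi$ be the number of noises $\Xi,\dot\Xi$ in $\tau$. For $i\in\{0,1\}$ let $\deg_i(\Xi)=\deg_0(\dot\Xi)=\alpha$, $\deg_1(\dot\Xi)=\alpha+\frac{d+2}2$, $\deg_i(X^k)=|k|_{\mathfrak s}$, $\deg_i(\sigma\tau)=\deg_i\sigma+\deg_i\tau$, $\deg_i(\mathcal I_a(\tau))=\deg_i\tau+2-|a|_{\mathfrak s}$. Let $D_\Xi$ be the derivation of $\mathcal T$ commuting with all $\mathcal I_a$ with $D_\Xi\Xi=\dot\Xi$, $D_\Xi\dot\Xi=D_\Xi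 X_j=0$, and let $\mathcal Q_0$ be the projection that sends trees containing $\dot\Xi$ to $0$ and fixes the others. $\mathcal T^{+,i}$ is the polynomial algebra in the $X_j$ and in symbols $\mathcal I^{+,i}_a(\tau)$, one for each nonzero tree $\mathcal I_a(\tau)$ with $\deg_i(\mathcal I_a(\tau))>0$; $\mathcal I_a^{+,i}(\tau)=0$ for all other trees $\tau$, extended linearly. The maps $\Delta_i:\mathcal T\to\mathcal T\otimes\mathcal T^{+,i}$, $\Delta_i^+:\mathcal T^{+,i}\to\mathcal T^{+,i}\otimes\mathcal T^{+,i}$ and $\hat\Delta_1:\mathcal T\to\mathcal T\otimes\mathcal T^{+,1}$ are multiplicative with $\Delta_iX_j=\Delta_i^+X_j=X_j\otimes1+1\otimes X_j$, $\Delta_i\bullet=\bullet\otimes 1$ for $\bullet\in\{\Xi,\dot\Xi\}$, $\hat\Delta_1\bullet=\bullet\otimes1$ for $\bullet\in\{X_j,\Xi,\dot\Xi\}$ and, for trees $\tau$ with $\mathcal I_a(\tau)\neq 0$ (respectively symbols $\mathcal I_a^{+,i}(\tau)$), $$\Delta_i\mathcal I_a(\tau)=(\mathcal I_a\otimes\mathrm{id})\Delta_i\tau+\sum_{|\ell+m|_{\mathfrak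 s}<\deg_i(\mathcal I_a(\tau))}\tfrac{X^\ell}{\ell!}\otimes\tfrac{X^m}{m!}\mathcal I^{+,i}_{a+\ell+m}(\tau),$$ $$\Delta^+_i\mathcal I^{+,i}_a(\tau)=\sum_{|\ell|_{\mathfrak s}<\deg_i(\mathcal I_a(\tau))}\bigl(\mathcal I^{+,i}_{a+\ell}\otimes\tfrac{(-X)^\ell}{\ell!}\bigr)\Delta_i\tau+1\otimes\mathcal I^{+,i}_a(\tau),$$ $$\hat\Delta_1\mathcal I_a(\tau)=(\mathcal I_a\otimes\mathrm{id})\hat\Delta_1\tau-\sum_{\deg_0(\mathcal I_a(\tau))\le|\ell|_{\mathfrak s}}\tfrac{X^\ell}{\ell!}\otimes\mathcal M(\mathcal I^{+,1}_{a+\ell}\otimes\mathrm{id})\hat\Delta_1\tau,$$ with $\mathcal M$ the multiplication. The antipode $\mathcal A_i^+$ is the algebra endomorphism of $\mathcal T^{+,i}$ with $\mathcal A_i^+X_j=-X_j$ and $\mathcal A^+_i\mathcal I^{+,i}_a(\tau)=-\sum_\ell\mathcal M(\mathcal I^{+,i}_{a+\ell}\otimes\frac{X^\ell}{\ell!}\mathcal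 A_i^+)\Delta_i\tau$. A preparation map is a linear map $R:\mathcal T\to\mathcal T$ that fixes all $X^k$, $\Xi$, $\dot\Xi$ and planted trees $\mathcal I_a(\tau)$; such that for each tree $\tau$, $R\tau-\tau$ is a linear combination of trees $\tau_j$ with $\deg_0\tau_j\ge\deg_0\tau$ and $|\tau_j|_\Xi<|\tau|_\Xi$; with $(R\otimes\mathrm{id})\Delta_i=\Delta_iR$ for $i\in\{0,1\}$; and with $RD_\Xi=D_\Xi R$ on trees without $\dot\Xi$. Let $K:\mathbb R^{d+1}\to\mathbb R$ be integrable with compact support and $\xi,\delta\xi:\mathbb R^{d+1}\to\mathbb R$ smooth. For smooth $f$, $\partial^aK*f$ is the convolution with the distributional derivative. The models $\Pi^i_x=\Pi^{i,\times}_xR$ are linear on $\mathcal T$, given recursively by: $\Pi_x^{i,\times}$ is multiplicative, $\Pi^{i,\times}_x\Xi=\xi$, $\Pi^{i,\times}_x\dot\Xi=\delta\xi$, $\Pi^{i,\times}_xX^k=(\cdot-x)^k$, and for $\mathcal I_a(\tau)\ne0$ $$(\Pi^{i,\times}_x\mathcal I_a(\tau))(y)=(\partial^aK*\Pi^i_x\tau)(y)-\sum_{|k|_{\mathfrak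 s}<\deg_i(\mathcal I_a(\tau))}\tfrac{(y-x)^k}{k!}(\partial^{a+k}K*\Pi_x^i\tau)(x).$$ Let $f^i_x:\mathcal T^{+,i}\to\mathbb R$ be the character with $f_x^i(X_j)=-x_j$, $f^i_x(\mathcal I_a^{+,i}(\tau))=-(\partial^aK*\Pi_x^i\tau)(x)$, and let $\gamma^i_{xy}=(f^i_x\mathcal A_i^+\otimes f^i_y)\Delta_i^+$, $\Gamma^i_{xy}=(\mathrm{id}\otimes\gamma^i_{xy})\Delta_i$, and $$\mathrm d\Gamma^1_{yx}\tau=\mathcal Q_0(\Gamma^1_{yx}\otimes f^1_x)\hat\Delta_1D_\Xi\tau .$$ Finally $\delta$ is the Malliavin derivative: $(\delta\Pi_x\tau)(z)$ is the derivative at $\varepsilon=0$ of $(\Pi_x\tau)(z)$ with $\xi$ replaced by $\xi+\varepsilon\,\delta\xi$. Let $N$ be the largest integer with $\deg_1(\dot\Xi)+2-N>0$. **Assumption on trees.** $T_0$ is a set of nonzero trees without $\dot\Xi$, with span $\mathcal T_0$, such that $\Delta_0\mathcal T_0\subset\mathcal T_0\otimes\mathcal T^{+,0}$ and such that, for every $\tau\in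 T_0$, each way to write $\tau=\mathcal I_a(\sigma)\rho$ and each $|n|_{\mathfrak s}\le N$, all trees $\sigma'$ occurring in $D_\Xi\sigma$ satisfy $\deg_1(\mathcal I_{a+n}(\sigma'))>0$. **Theorem.** Let $T_0$ satisfy this assumption and let $R$ be a preparation map with $R\mathcal Q_0=\mathcal Q_0R$ and $R\mathcal T_0\subset\mathcal T_0$. For $\tau\in\mathcal T_0$ write $D_\Xi\tau=\sum_i\mathcal I_{a_i}(D_\Xi\tau_i')\tau_i+\dot\Xi\,\tau^\circ$, where $\dot\Xi\,\tau^\circ$ collects the trees of $D_\Xi\tau$ with $\dot\Xi$ at the root (so $\tau^\circ=0$ if $\tau$ has no noise at the root). Then for every $\tau\in\mathcal T_0$ there is $r\in\mathbb N$ such that for every $K$ as above with $\int K(z)z^k\,dz=0$ for all $|k|_{\mathfrak s}\le r$, all smooth $\xi,\delta\xi$, all $x,y\in\mathbb R^{d+1}$ and all $n\in\mathbb N^{d+1}$ with $|n|_{\mathfrak s}\le N$, $$\partial^n\bigl(\Pi^{0,\times}_y\mathrm d\Gamma^1_{yx}\tau-\delta\Pi^{0,\times}_x\tau+\Pi^{0,\times}_x(\dot\Xi\,\tau^\circ)\bigr)(y)=0,$$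 $$\partial^n\bigl(\Pi^{0}_y\mathrm d\Gamma^1_{yx}\tau-\delta\Pi^{0}_x\tau+\Pi^{0,\times}_x(\dot\Xi\,(R\tau)^\circ)\bigr)(y)=0.$$ Moreover the derivatives in $\varepsilon$ defining $\delta\Pi_x^{0,\times}\tau$ and $\delta\Pi^0_x\tau$ exist, and the two functions in parentheses are smooth. -/

import Mathlib

open scoped TensorProduct ContDiff Nat

namespace MalliavinTree

noncomputable section

/-! ## Multi-indices -/

/-- Multi-indices `ℕ^{d+1}`; the coordinate `0` is time. -/
abbrev MIdx (d : ℕ) : Type := Fin (d + 1) → ℕ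

/-- The parabolic scaling `𝔰 = (2, 1, …, 1)`. -/
def scal {d : ℕ} (i : Fin (d + 1)) : ℕ := if i = 0 then 2 else 1

/-- `|n|_𝔰 = ∑ 𝔰_i n_i`. -/
def sdeg {d : ℕ} (n : MIdx d) : ℕ := ∑ i, scal i * n i

/-- `n! = ∏ n_i!`. -/
def mfact {d : ℕ} (n : MIdx d) : ℕ := ∏ i, (n i)!

/-- The finite set of all multi-indices `ℓ` with `|ℓ|_𝔰 < c`. -/
def below {d : ℕ} (c : ℝ) : Finset (MIdx d) :=
  (Fintype.piFinset fun _ => Finset.range ⌈c⌉₊).filter fun l => (sdeg l : ℝ) < c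

theorem mem_below {d : ℕ} {c : ℝ} {l : MIdx d} : l ∈ below c ↔ (sdeg l : ℝ) < c := by
  refine ⟨fun h => (Finset.mem_filter.1 h).2, fun h => Finset.mem_filter.2 ⟨?_, h⟩⟩
  refine Fintype.mem_piFinset.2 fun i => Finset.mem_range.2 (Nat.lt_ceil.2 (lt_of_le_of_lt ?_ h))
  have h1 : scal i * l i ≤ sdeg l :=
    Finset.single_le_sum (f := fun i => scal i * l i) (fun _ _ => Nat.zero_le _)
      (Finset.mem_univ i)
  have h2 : 1 ≤ scal i := by unfold scal; split_ifs <;> norm_num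
  exact_mod_cast (by nlinarith : l i ≤ sdeg l)

/-! ## Decorated trees -/

/-- Planar decorated trees: `root k l m` is a single node with decoration `k`, to which `l` noise
edges `Ξ` and `m` noise edges `Ξ̇` are attached; `graft a s t` is the tree `𝓘_a(s) · t`, where the
root of `s` is joined to the root of `t` by an edge decorated by `(𝓘, a)`. -/
inductive PreTree (d : ℕ) : Type
  | root (k : MIdx d) (l m : ℕ) : PreTree d
  | graft (a : MIdx d) (s t : PreTree d) : PreTree d

namespace PreTree

/-- Exchange of two neighbouring branches at some node. -/
inductive Rel {d : ℕ} : PreTree d → PreTree d → Prop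
  | swap (a b : MIdx d) (s u t : PreTree d) :
      Rel (graft a s (graft b u t)) (graft b u (graft a s t))
  | branch (a : MIdx d) {s s' : PreTree d} (t : PreTree d) :
      Rel s s' → Rel (graft a s t) (graft a s' t)
  | rest (a : MIdx d) (s : PreTree d) {t t' : PreTree d} :
      Rel t t' → Rel (graft a s t) (graft a s t')

/-- Product of a planar tree with a single decorated node. -/
def addRoot {d : ℕ} (k : MIdx d) (l m : ℕ) : PreTree d → PreTree d
  | root k' l' m' => root (k + k') (l + l') (m + m')
  | graft a s t => graft a s (addRoot k l m t)

/-- Tree product: identification of the roots. -/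
def mul {d : ℕ} : PreTree d → PreTree d → PreTree d
  | root k l m, u => addRoot k l m u
  | graft a s t, u => graft a s (mul t u)

end PreTree

/-- Non-planar decorated rooted trees: planar trees up to reordering the branches at each node. -/
def DTree (d : ℕ) : Type := Quot (PreTree.Rel (d := d))

namespace DTree

variable {d : ℕ}

/-- The tree underlying a planar tree. -/
def mk (p : PreTree d) : DTree d := Quot.mk _ p

/-- `X^k Ξ^l Ξ̇^m`. -/
def root (k : MIdx d) (l m : ℕ) : DTree d := mk (.root k l m)

/-- `𝓘_a(s) · t`. -/
def graft (a : MIdx d) : DTree d → DTree d → DTree d :=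
  Quot.map₂ (PreTree.graft a) (fun s _ _ h => .rest a s h) (fun _ _ t h => .branch a t h)

theorem graft_mk (a : MIdx d) (s t : PreTree d) :
    graft a (mk s) (mk t) = mk (.graft a s t) := rfl

theorem graft_swap (a b : MIdx d) (s u t : DTree d) :
    graft a s (graft b u t) = graft b u (graft a s t) := by
  obtain ⟨s, rfl⟩ := Quot.exists_rep s
  obtain ⟨u, rfl⟩ := Quot.exists_rep u
  obtain ⟨t, rfl⟩ := Quot.exists_rep t
  exact Quot.sound (.swap a b s u t)

/-- Induction on trees along `τ = X^k Ξ^l Ξ̇^m ∏ 𝓘_{a_i}(τ_i)`. -/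
theorem induct {P : DTree d → Prop} (h0 : ∀ k l m, P (root k l m))
    (h1 : ∀ a s t, P s → P t → P (graft a s t)) (t : DTree d) : P t := by
  obtain ⟨p, rfl⟩ := Quot.exists_rep t
  induction p with
  | root k l m => exact h0 k l m
  | graft a s t hs ht => exact h1 a _ _ hs ht

theorem rel_addRoot (k : MIdx d) (l m : ℕ) {t t' : PreTree d} (h : PreTree.Rel t t') :
    PreTree.Rel (t.addRoot k l m) (t'.addRoot k l m) := by
  induction h with
  | swap a b s u t => exact .swap a b s u _
  | branch a t h _ => exact .branch a _ h
  | rest a s _ ih => exact .rest a s ih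

theorem rel_mul_right (s : PreTree d) {t t' : PreTree d} (h : PreTree.Rel t t') :
    PreTree.Rel (s.mul t) (s.mul t') := by
  induction s with
  | root k l m => exact rel_addRoot k l m h
  | graft a s u _ ih => exact .rest a s ih

theorem rel_mul_left {s s' : PreTree d} (t : PreTree d) (h : PreTree.Rel s s') :
    PreTree.Rel (s.mul t) (s'.mul t) := by
  induction h with
  | swap a b s u v => exact .swap a b s u _
  | branch a _ h _ => exact .branch a _ h
  | rest a s _ ih => exact .rest a s ih

instance : Mul (DTree d) :=
  ⟨Quot.map₂ PreTree.mul (fun s _ _ h => rel_mul_right s h) (fun _ _ t h => rel_mul_left t h)⟩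

instance : One (DTree d) := ⟨root 0 0 0⟩

theorem one_def : (1 : DTree d) = root 0 0 0 := rfl

theorem root_mul_root (k k' : MIdx d) (l l' m m' : ℕ) :
    root k l m * root k' l' m' = root (k + k') (l + l') (m + m') := rfl

theorem graft_mul (a : MIdx d) (s t u : DTree d) : graft a s t * u = graft a s (t * u) := by
  obtain ⟨s, rfl⟩ := Quot.exists_rep s
  obtain ⟨t, rfl⟩ := Quot.exists_rep t
  obtain ⟨u, rfl⟩ := Quot.exists_rep u
  rfl

theorem root_mul_graft (k : MIdx d) (l m : ℕ) (a : MIdx d) (s t : DTree d) :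
    root k l m * graft a s t = graft a s (root k l m * t) := by
  obtain ⟨s, rfl⟩ := Quot.exists_rep s
  obtain ⟨t, rfl⟩ := Quot.exists_rep t
  rfl

theorem mul_graft (u : DTree d) (a : MIdx d) (s t : DTree d) :
    u * graft a s t = graft a s (u * t) := by
  induction u using induct with
  | h0 k l m => exact root_mul_graft k l m a s t
  | h1 b v w _ ih => rw [graft_mul, ih, graft_mul, graft_swap]

instance : CommMonoid (DTree d) where
  mul_assoc s t u := by
    induction s using induct with
    | h0 k l m =>
      induction t using induct with
      | h0 k' l' m' =>
        induction u using induct with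
        | h0 k'' l'' m'' => simp only [root_mul_root, add_assoc]
        | h1 a v w _ ih => rw [mul_graft, ih, mul_graft, mul_graft]
      | h1 a v w _ ih => rw [mul_graft, graft_mul, ih, graft_mul, mul_graft]
    | h1 a v w _ ih => rw [graft_mul, graft_mul, ih, graft_mul]
  one_mul s := by
    induction s using induct with
    | h0 k l m => simp only [one_def, root_mul_root, zero_add]
    | h1 a v w _ ih => rw [mul_graft, ih]
  mul_one s := by
    induction s using induct with
    | h0 k l m => simp only [one_def, root_mul_root, add_zero]
    | h1 a v w _ ih => rw [graft_mul, ih]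
  mul_comm s t := by
    induction s using induct with
    | h0 k l m =>
      induction t using induct with
      | h0 k' l' m' => rw [root_mul_root, root_mul_root, add_comm k, add_comm l, add_comm m]
      | h1 a v w _ ih => rw [mul_graft, ih, graft_mul]
    | h1 a v w _ ih => rw [graft_mul, ih, mul_graft]

/-- The planted tree `𝓘_a(s)`. -/
def planted (a : MIdx d) (s : DTree d) : DTree d := graft a s 1

theorem planted_mul (a : MIdx d) (s t : DTree d) : planted a s * t = graft a s t := by
  rw [planted, graft_mul, one_mul]

section Fold

variable {A : Type*} [CommMonoid A]

/-- Auxiliary to `fold`. -/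
def preFold (vX : Fin (d + 1) → A) (vXi vDXi : A) (pl : MIdx d → DTree d → A → A) :
    PreTree d → A
  | .root k l m => (∏ i, vX i ^ k i) * vXi ^ l * vDXi ^ m
  | .graft a s t => pl a (mk s) (preFold vX vXi vDXi pl s) * preFold vX vXi vDXi pl t

/-- The multiplicative map on trees with given values on `X_i`, `Ξ`, `Ξ̇`, whose value on a planted
tree `𝓘_a(s)` is a given function of `a`, of `s` and of its own value on `s`. -/
def fold (vX : Fin (d + 1) → A) (vXi vDXi : A) (pl : MIdx d → DTree d → A → A) : DTree d → A :=
  Quot.lift (preFold vX vXi vDXi pl) (by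
    intro s t h
    induction h with
    | swap a b s u t => simp only [preFold]; exact mul_left_comm _ _ _
    | branch a t h ih =>
      simp only [preFold, ih]
      rw [show mk _ = mk _ from Quot.sound h]
    | rest a s h ih => simp only [preFold, ih])

variable (vX : Fin (d + 1) → A) (vXi vDXi : A) (pl : MIdx d → DTree d → A → A)

theorem fold_root (k : MIdx d) (l m : ℕ) :
    fold vX vXi vDXi pl (root k l m) = (∏ i, vX i ^ k i) * vXi ^ l * vDXi ^ m := rfl

theorem fold_graft (a : MIdx d) (s t : DTree d) :
    fold vX vXi vDXi pl (graft a s t) =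
      pl a s (fold vX vXi vDXi pl s) * fold vX vXi vDXi pl t := by
  obtain ⟨s, rfl⟩ := Quot.exists_rep s
  obtain ⟨t, rfl⟩ := Quot.exists_rep t
  rfl

theorem fold_one : fold vX vXi vDXi pl 1 = 1 := by simp [one_def, fold_root]

theorem fold_mul (s t : DTree d) :
    fold vX vXi vDXi pl (s * t) = fold vX vXi vDXi pl s * fold vX vXi vDXi pl t := by
  induction s using induct with
  | h0 k l m =>
    induction t using induct with
    | h0 k' l' m' =>
      simp only [root_mul_root, fold_root, Pi.add_apply, pow_add, Finset.prod_mul_distrib]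
      simp only [mul_assoc, mul_left_comm, mul_comm]
    | h1 a v w _ ih => rw [mul_graft, fold_graft, ih, fold_graft, mul_left_comm]
  | h1 a v w _ ih => rw [graft_mul, fold_graft, ih, fold_graft, mul_assoc]

theorem fold_planted (a : MIdx d) (s : DTree d) :
    fold vX vXi vDXi pl (planted a s) = pl a s (fold vX vXi vDXi pl s) := by
  rw [planted, fold_graft, fold_one, mul_one]

end Fold

/-- `|τ|_Ξ`: the number of noises `Ξ` and `Ξ̇` in a tree. -/
def noise (t : DTree d) : ℕ :=
  (fold (A := Multiplicative ℕ) (fun _ => .ofAdd 0) (.ofAdd 1) (.ofAdd 1) (fun _ _ v => v) t).toAdd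

/-- The number of noises `Ξ̇` in a tree. -/
def dots (t : DTree d) : ℕ :=
  (fold (A := Multiplicative ℕ) (fun _ => .ofAdd 0) (.ofAdd 0) (.ofAdd 1) (fun _ _ v => v) t).toAdd

/-- The number of noises `Ξ̇` at the root of a tree. -/
def rootDots (t : DTree d) : ℕ :=
  (fold (A := Multiplicative ℕ) (fun _ => .ofAdd 0) (.ofAdd 0) (.ofAdd 1) (fun _ _ _ => 1) t).toAdd

/-- The number of branches of the form `𝓘_a(X^k)` in a tree. -/
def monomialBranches (t : DTree d) : ℕ :=
  open Classical in
  (fold (A := Multiplicative ℕ) (fun _ => 1) 1 1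
    (fun _ s v => if ∃ k, s = root k 0 0 then v * .ofAdd 1 else v) t).toAdd

/-- The degree `deg_i`, `i ∈ {0, 1}`: `deg_i(Ξ) = α`, `deg_0(Ξ̇) = α`, `deg_1(Ξ̇) = α + (d+2)/2`,
`deg_i(X^k) = |k|_𝔰`, `deg_i(στ) = deg_i(σ) + deg_i(τ)`, `deg_i(𝓘_a(τ)) = deg_i(τ) + 2 - |a|_𝔰`. -/
def deg (α : ℝ) (i : Fin 2) (t : DTree d) : ℝ :=
  (fold (A := Multiplicative ℝ) (fun j => .ofAdd (scal j : ℝ)) (.ofAdd α)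
    (.ofAdd (α + (i : ℕ) * (((d : ℝ) + 2) / 2)))
    (fun a _ v => .ofAdd (v.toAdd + 2 - sdeg a)) t).toAdd

theorem noise_graft (a : MIdx d) (s t : DTree d) :
    noise (graft a s t) = noise s + noise t := by
  simp [noise, fold_graft]

theorem monomialBranches_mul (s t : DTree d) :
    monomialBranches (s * t) = monomialBranches s + monomialBranches t := by
  simp [monomialBranches, fold_mul]

theorem deg_mul (α : ℝ) (i : Fin 2) (s t : DTree d) :
    deg α i (s * t) = deg α i s + deg α i t := by simp [deg, fold_mul]

theorem deg_planted (α : ℝ) (i : Fin 2) (a : MIdx d) (s : DTree d) :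
    deg α i (planted a s) = deg α i s + 2 - sdeg a := by simp [deg, fold_planted]

end DTree

/-- The decorated trees without a branch `𝓘_a(X^k)`; all other trees are identified with `0`. -/
def admissible (d : ℕ) : Submonoid (DTree d) where
  carrier := {t | t.monomialBranches = 0}
  one_mem' := by simp [DTree.monomialBranches, DTree.fold_one]
  mul_mem' := by
    intro s t hs ht
    simp only [Set.mem_ofPred_eq] at hs ht ⊢
    rw [DTree.monomialBranches_mul, hs, ht]

/-- The basis `T` of the space of trees. -/
abbrev T (d : ℕ) : Type := admissible d

/-- The algebra `𝒯`: the linear span of `T` with the tree product, in which `𝓘_a(X^k) = 0`. -/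
abbrev TSpace (d : ℕ) : Type := MonoidAlgebra ℝ (T d)

section Space

variable {d : ℕ}

/-- The linear map on `𝒯` with given values on trees. -/
def linExt {V : Type*} [AddCommGroup V] [Module ℝ V] (f : T d → V) : TSpace d →ₗ[ℝ] V :=
  Finsupp.linearCombination ℝ f ∘ₗ (MonoidAlgebra.coeffLinearEquiv ℝ).toLinearMap

theorem linExt_single {V : Type*} [AddCommGroup V] [Module ℝ V] (f : T d → V) (t : T d) :
    linExt f (MonoidAlgebra.single t 1) = f t := by
  simp [linExt]

open Classical in
/-- A decorated tree as an element of `𝒯`; it is `0` if the tree has a branch `𝓘_a(X^k)`. -/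
def ofTree (t : DTree d) : TSpace d :=
  if h : t ∈ admissible d then MonoidAlgebra.single ⟨t, h⟩ 1 else 0

theorem ofTree_coe (t : T d) : ofTree (t : DTree d) = MonoidAlgebra.single t 1 := by
  simp [ofTree]

/-- `X^k`. -/
def X (k : MIdx d) : TSpace d := ofTree (.root k 0 0)

/-- The noise `Ξ`. -/
def Xi : TSpace d := ofTree (.root 0 1 0)

/-- The noise `Ξ̇`. -/
def dXi : TSpace d := ofTree (.root 0 0 1)

/-- The linear operator `𝓘_a` on `𝒯`, with `𝓘_a(X^k) = 0`. -/
def I (a : MIdx d) : TSpace d →ₗ[ℝ] TSpace d := linExt fun t => ofTree (.planted a t)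

/-- The tree `t` with each `Ξ` replaced by `Ξ + ε Ξ̇`, where `ε² = 0`. -/
def dual (t : DTree d) : DualNumber (TSpace d) :=
  DTree.fold (A := DualNumber (TSpace d)) (fun j => .inl (X (Pi.single j 1)))
    (.inl Xi + .inr dXi) (.inl dXi) (fun a _ v => .inl (I a v.fst) + .inr (I a v.snd)) t

/-- The abstract Malliavin derivative `D_Ξ`, extended by `D_Ξ Ξ̇ = 0` to a derivation of `𝒯`: the
part of first order in `ε` when each `Ξ` is replaced by `Ξ + ε Ξ̇`. See `malliavinD_X`,
`malliavinD_Xi`, `malliavinD_planted`, `malliavinD_mul` for its inductive definition. -/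
def malliavinD : TSpace d →ₗ[ℝ] TSpace d := linExt fun t => (dual (t : DTree d)).snd

theorem ofTree_mul (s t : DTree d) : ofTree (s * t) = ofTree s * ofTree t := by
  have h : s * t ∈ admissible d ↔ s ∈ admissible d ∧ t ∈ admissible d := by
    change (s * t).monomialBranches = 0 ↔ s.monomialBranches = 0 ∧ t.monomialBranches = 0
    rw [DTree.monomialBranches_mul]
    omega
  by_cases hs : s ∈ admissible d <;> by_cases ht : t ∈ admissible d <;>
    simp [ofTree, h, hs, ht]

theorem graft_mem {a : MIdx d} {s t : DTree d} (h : DTree.graft a s t ∈ admissible d) :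
    s ∈ admissible d ∧ t ∈ admissible d := by
  classical
  have h' : (DTree.graft a s t).monomialBranches = 0 := h
  change s.monomialBranches = 0 ∧ t.monomialBranches = 0
  simp only [DTree.monomialBranches, DTree.fold_graft] at h' ⊢
  split_ifs at h' <;> simp at h' <;> simp [h']

theorem root_mem (k : MIdx d) (l m : ℕ) : DTree.root k l m ∈ admissible d := by
  change (DTree.root k l m).monomialBranches = 0
  simp [DTree.monomialBranches, DTree.fold_root]

theorem I_ofTree (a : MIdx d) (s : DTree d) : I a (ofTree s) = ofTree (DTree.planted a s) := by
  by_cases h : s ∈ admissible d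
  · have := linExt_single (fun t : T d => ofTree (DTree.planted a t)) ⟨s, h⟩
    rwa [← ofTree_coe] at this
  · have h' : DTree.planted a s ∉ admissible d := fun h' => h (graft_mem h').1
    simp [ofTree, h, h']

/-- `𝓘_a(X^k) = 0`. -/
theorem I_X (a k : MIdx d) : I a (X k) = 0 := by
  have h : DTree.planted a (DTree.root k 0 0) ∉ admissible d := by
    intro h
    classical
    have h' : (DTree.planted a (DTree.root k 0 0)).monomialBranches = 0 := h
    rw [DTree.monomialBranches, DTree.fold_planted, if_pos ⟨k, rfl⟩] at h'
    simp at h'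
  rw [X, I_ofTree, ofTree, dif_neg h]

theorem ofTree_root (k : MIdx d) (l m : ℕ) :
    ofTree (DTree.root k l m) = (∏ j, X (Pi.single j 1) ^ k j) * Xi ^ l * dXi ^ m := by
  have hp : ∀ (t : DTree d) (n : ℕ), ofTree (t ^ n) = ofTree t ^ n := by
    intro t n
    induction n with
    | zero =>
      have : (1 : DTree d) ∈ admissible d := one_mem _
      rw [pow_zero, pow_zero, ofTree, dif_pos this]
      rfl
    | succ n ih => rw [pow_succ, ofTree_mul, ih, pow_succ]
  have hx : ∀ (S : Finset (Fin (d + 1))), ofTree (∏ j ∈ S, (DTree.root (Pi.single j 1) 0 0) ^ k j)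
      = ∏ j ∈ S, X (Pi.single j 1) ^ k j := by
    intro S
    classical
    induction S using Finset.induction_on with
    | empty => simpa using hp 1 0
    | insert j S hj ih => rw [Finset.prod_insert hj, ofTree_mul, ih, hp, Finset.prod_insert hj]; rfl
  have hr : ∀ (k : MIdx d) (l m n : ℕ),
      (DTree.root k l m) ^ n = DTree.root (n • k) (n * l) (n * m) := by
    intro k l m n
    induction n with
    | zero => simp [DTree.one_def]
    | succ n ih => rw [pow_succ, ih, DTree.root_mul_root, succ_nsmul, Nat.succ_mul, Nat.succ_mul]
  have hs : ∀ (S : Finset (Fin (d + 1))),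
      (∏ j ∈ S, (DTree.root (Pi.single j 1) 0 0) ^ k j) =
        DTree.root (∑ j ∈ S, k j • (Pi.single j 1 : MIdx d)) 0 0 := by
    intro S
    classical
    induction S using Finset.induction_on with
    | empty => simp [DTree.one_def]
    | insert j S hj ih =>
      rw [Finset.prod_insert hj, ih, hr, DTree.root_mul_root, Finset.sum_insert hj]
      simp
  have hk : ∑ j, k j • (Pi.single j 1 : MIdx d) = k := by
    funext i
    simp [Finset.sum_apply, Pi.single_apply]
  have : DTree.root k l m = (∏ j, (DTree.root (Pi.single j 1) 0 0) ^ k j) *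
      (DTree.root 0 1 0) ^ l * (DTree.root 0 0 1) ^ m := by
    rw [hs, hk, hr, hr, DTree.root_mul_root, DTree.root_mul_root]
    simp
  rw [this, ofTree_mul, ofTree_mul, hp, hp, hx]
  rfl

theorem dual_graft (a : MIdx d) (s t : DTree d) :
    dual (DTree.graft a s t) =
      (.inl (I a (dual s).fst) + .inr (I a (dual s).snd)) * dual t := DTree.fold_graft ..

theorem dual_planted (a : MIdx d) (s : DTree d) :
    dual (DTree.planted a s) = .inl (I a (dual s).fst) + .inr (I a (dual s).snd) :=
  DTree.fold_planted ..

theorem fst_dual (t : DTree d) : (dual t).fst = ofTree t := by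
  induction t using DTree.induct with
  | h0 k l m =>
    have h : ∀ v : DualNumber (TSpace d),
        v.fst = TrivSqZeroExt.fstHom ℝ (TSpace d) (TSpace d) v := fun _ => rfl
    have hx : ∀ r : TSpace d, TrivSqZeroExt.fstHom ℝ (TSpace d) (TSpace d) (.inl r) = r :=
      fun _ => rfl
    have hy : ∀ r : TSpace d, TrivSqZeroExt.fstHom ℝ (TSpace d) (TSpace d) (.inr r) = 0 :=
      fun _ => rfl
    rw [dual, DTree.fold_root, ofTree_root, h]
    simp only [map_mul, map_prod, map_pow, map_add, hx, hy, add_zero]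
  | h1 a s t hs ht =>
    rw [dual_graft, TrivSqZeroExt.fst_mul, TrivSqZeroExt.fst_add, TrivSqZeroExt.fst_inl,
      TrivSqZeroExt.fst_inr, add_zero, hs, ht, I_ofTree, ← ofTree_mul, DTree.planted_mul]

theorem snd_dual (t : T d) : (dual (t : DTree d)).snd = malliavinD (ofTree (t : DTree d)) := by
  rw [ofTree_coe]
  exact (linExt_single (fun t : T d => (dual (t : DTree d)).snd) t).symm

/-- The Leibniz rule `D_Ξ(σ τ) = D_Ξ(σ) τ + σ D_Ξ(τ)`. -/
theorem malliavinD_mul (σ τ : TSpace d) :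
    malliavinD (σ * τ) = malliavinD σ * τ + σ * malliavinD τ := by
  induction σ using MonoidAlgebra.induction_linear with
  | zero => simp
  | add σ σ' h h' => rw [add_mul, map_add, h, h', map_add]; ring
  | single s r =>
    induction τ using MonoidAlgebra.induction_linear with
    | zero => simp
    | add τ τ' h h' => rw [mul_add, map_add, h, h', map_add]; ring
    | single t r' =>
      have e : ∀ (u : T d) (c : ℝ),
          (MonoidAlgebra.single u c : TSpace d) = c • ofTree (u : DTree d) := by
        intro u c; rw [ofTree_coe]; simp
      have key : malliavinD (ofTree ((s * t : T d) : DTree d)) =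
          malliavinD (ofTree (s : DTree d)) * ofTree (t : DTree d) +
            ofTree (s : DTree d) * malliavinD (ofTree (t : DTree d)) := by
        rw [← snd_dual, ← snd_dual, ← snd_dual, ← fst_dual, ← fst_dual, Submonoid.coe_mul, dual,
          DTree.fold_mul, TrivSqZeroExt.snd_mul]
        rw [smul_eq_mul, op_smul_eq_mul, add_comm]
        rfl
      rw [MonoidAlgebra.single_mul_single, e, e, e, map_smul, map_smul, map_smul, key]
      simp only [smul_add, smul_mul_smul_comm]

/-- `D_Ξ(𝓘_a(τ)) = 𝓘_a(D_Ξ τ)` for a tree `τ` with `𝓘_a(τ) ≠ 0`. -/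
theorem malliavinD_planted (a : MIdx d) (s : DTree d) (h : DTree.planted a s ∈ admissible d) :
    malliavinD (I a (ofTree s)) = I a (malliavinD (ofTree s)) := by
  have h1 := snd_dual ⟨_, h⟩
  have h2 := snd_dual ⟨_, (graft_mem h).1⟩
  rw [I_ofTree, ← h1, ← h2, dual_planted, TrivSqZeroExt.snd_add, TrivSqZeroExt.snd_inl,
    TrivSqZeroExt.snd_inr, zero_add]

/-- `D_Ξ X^k = 0`. -/
theorem malliavinD_X (k : MIdx d) : malliavinD (X k) = 0 := by
  have h1 := snd_dual ⟨_, root_mem k 0 0⟩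
  have h : (dual (DTree.root k 0 0)) =
      TrivSqZeroExt.inlHom (TSpace d) (TSpace d) (∏ j, X (Pi.single j 1) ^ k j) := by
    rw [dual, DTree.fold_root, pow_zero, pow_zero, mul_one, mul_one, map_prod]
    simp only [map_pow]
    rfl
  rw [X, ← h1, h]
  rfl

/-- `D_Ξ Ξ = Ξ̇`. -/
theorem malliavinD_Xi : malliavinD (Xi (d := d)) = dXi := by
  have h1 := snd_dual ⟨_, root_mem (0 : MIdx d) 1 0⟩
  rw [Xi, ← h1, dual, DTree.fold_root]
  simp only [Pi.zero_apply, pow_zero, Finset.prod_const_one, pow_one, one_mul, mul_one,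
    TrivSqZeroExt.snd_add, TrivSqZeroExt.snd_inl, TrivSqZeroExt.snd_inr, zero_add]

/-- The projection `𝒬₀`, which sends trees containing `Ξ̇` to zero. -/
def Q0 : TSpace d →ₗ[ℝ] TSpace d :=
  linExt fun t => if (t : DTree d).dots = 0 then ofTree t else 0

/-- The projection that keeps the trees with `Ξ̇` at the root and sends the others to zero. -/
def QRoot : TSpace d →ₗ[ℝ] TSpace d :=
  linExt fun t => if (t : DTree d).rootDots = 0 then 0 else ofTree t

/-- The linear span of a set of trees. -/
def treeSpan (S : Set (T d)) : Submodule ℝ (TSpace d) := MonoidAlgebra.supported ℝ ℝ S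

/-! ## The algebras `𝒯^{+,i}`, co-actions, coproducts, antipodes -/

variable (α : ℝ) (i : Fin 2)

/-- The generators `𝓘^{+,i}_a(τ)`: nonzero planted trees `𝓘_a(τ)` with `deg_i(𝓘_a(τ)) > 0`. -/
def PlusGen (d : ℕ) (α : ℝ) (i : Fin 2) : Type :=
  {p : MIdx d × DTree d // DTree.planted p.1 p.2 ∈ admissible d ∧
    0 < (DTree.planted p.1 p.2).deg α i}

/-- `𝒯^{+,i}`: polynomials in the `X_j` and the `𝓘^{+,i}_a(τ)`. -/
abbrev TPlus (d : ℕ) (α : ℝ) (i : Fin 2) : Type :=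
  MvPolynomial (Fin (d + 1) ⊕ PlusGen d α i) ℝ

/-- `X_j` in `𝒯^{+,i}`. -/
def plusX (j : Fin (d + 1)) : TPlus d α i := MvPolynomial.X (Sum.inl j)

/-- `X^k` in `𝒯^{+,i}`. -/
def plusXpow (k : MIdx d) : TPlus d α i := ∏ j, plusX α i j ^ k j

open Classical in
/-- `𝓘^{+,i}_a(t)` for a tree `t`; it is zero if `deg_i(𝓘_a(t)) ≤ 0` or `𝓘_a(t) = 0`. -/
def plusITree (a : MIdx d) (t : DTree d) : TPlus d α i :=
  if h : DTree.planted a t ∈ admissible d ∧ 0 < (DTree.planted a t).deg α i then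
    MvPolynomial.X (Sum.inr ⟨(a, t), h⟩) else 0

/-- The linear operator `𝓘^{+,i}_a : 𝒯 → 𝒯^{+,i}`. -/
def plusI (a : MIdx d) : TSpace d →ₗ[ℝ] TPlus d α i := linExt fun t => plusITree α i a t

/-- The co-action `Δ_i` on trees. -/
def coactTree (t : DTree d) : TSpace d ⊗[ℝ] TPlus d α i :=
  DTree.fold (fun j => X (Pi.single j 1) ⊗ₜ 1 + 1 ⊗ₜ plusX α i j) (Xi ⊗ₜ 1) (dXi ⊗ₜ 1)
    (fun a s v => TensorProduct.map (I a) LinearMap.id v +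
      ∑ l ∈ below ((DTree.planted a s).deg α i),
        ∑ m ∈ below ((DTree.planted a s).deg α i - sdeg l),
          ((mfact l : ℝ)⁻¹ • X l) ⊗ₜ
            ((mfact m : ℝ)⁻¹ • (plusXpow α i m * plusITree α i (a + l + m) s))) t

/-- The co-action `Δ_i`. -/
def coact : TSpace d →ₗ[ℝ] TSpace d ⊗[ℝ] TPlus d α i := linExt fun t => coactTree α i t

/-- The coproduct `Δ_i^+` of `𝒯^{+,i}`. -/
def coprodPlus : TPlus d α i →ₐ[ℝ] TPlus d α i ⊗[ℝ] TPlus d α i :=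
  MvPolynomial.aeval (Sum.elim (fun j => plusX α i j ⊗ₜ 1 + 1 ⊗ₜ plusX α i j) fun p =>
    (∑ l ∈ below ((DTree.planted p.1.1 p.1.2).deg α i),
      TensorProduct.map (plusI α i (p.1.1 + l))
        (LinearMap.mulLeft ℝ (((-1) ^ (∑ j, l j) * (mfact l : ℝ)⁻¹) • plusXpow α i l))
        (coactTree α i p.1.2)) + 1 ⊗ₜ plusITree α i p.1.1 p.1.2)

/-- `-∑_ℓ 𝓜 (𝓘^{+,i}_{a+ℓ} ⊗ X^ℓ/ℓ! ·) v` for `v` in `𝒯 ⊗ 𝒯^{+,i}`, if `𝓘^{+,i}_a(s) ≠ 0`. For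
`v = (id ⊗ 𝒜_i^+) Δ_i s` the summands with `|ℓ|_𝔰 ≥ deg_i(𝓘_a(s))` vanish. -/
def antipodeStep (a : MIdx d) (s : DTree d) (v : TSpace d ⊗[ℝ] TPlus d α i) : TPlus d α i :=
  open Classical in
  if DTree.planted a s ∈ admissible d ∧ 0 < (DTree.planted a s).deg α i then
    -∑ l ∈ below ((DTree.planted a s).deg α i),
      LinearMap.mul' ℝ (TPlus d α i)
        (TensorProduct.map (plusI α i (a + l))
          (LinearMap.mulLeft ℝ ((mfact l : ℝ)⁻¹ • plusXpow α i l)) v)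
  else 0

/-- `(id ⊗ 𝒜_i^+) Δ_i` on trees, by recursion on the tree; see `antipodeCoact_eq`. -/
def antipodeCoact (t : DTree d) : TSpace d ⊗[ℝ] TPlus d α i :=
  DTree.fold (fun j => X (Pi.single j 1) ⊗ₜ 1 - 1 ⊗ₜ plusX α i j) (Xi ⊗ₜ 1) (dXi ⊗ₜ 1)
    (fun a s v => TensorProduct.map (I a) LinearMap.id v +
      ∑ l ∈ below ((DTree.planted a s).deg α i),
        ∑ m ∈ below ((DTree.planted a s).deg α i - sdeg l),
          ((mfact l : ℝ)⁻¹ • X l) ⊗ₜ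
            ((mfact m : ℝ)⁻¹ • ((-1) ^ (∑ j, m j) * plusXpow α i m *
              antipodeStep α i (a + l + m) s v))) t

/-- The antipode `𝒜_i^+`. -/
def antipodePlus : TPlus d α i →ₐ[ℝ] TPlus d α i :=
  MvPolynomial.aeval (Sum.elim (fun j => -plusX α i j) fun p =>
    antipodeStep α i p.1.1 p.1.2 (antipodeCoact α i p.1.2))

theorem antipodePlus_plusITree (a : MIdx d) (s : DTree d) :
    antipodePlus α i (plusITree α i a s) = antipodeStep α i a s (antipodeCoact α i s) := by
  by_cases h : DTree.planted a s ∈ admissible d ∧ 0 < (DTree.planted a s).deg α i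
  · simp only [plusITree, h, antipodePlus, and_self, dite_true, MvPolynomial.aeval_X]
    rfl
  · simp [plusITree, h, antipodeStep]

theorem antipodePlus_plusXpow (m : MIdx d) :
    antipodePlus α i (plusXpow α i m) = (-1) ^ (∑ j, m j) * plusXpow α i m := by
  simp only [plusXpow, map_prod, map_pow]
  have : ∀ j : Fin (d + 1), antipodePlus α i (plusX α i j) = -1 * plusX α i j := by
    intro j; simp [antipodePlus, plusX]
  simp only [this, mul_pow, Finset.prod_mul_distrib, Finset.prod_pow_eq_pow_sum]

theorem antipodeCoact_eq (t : DTree d) :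
    antipodeCoact α i t =
      TensorProduct.map LinearMap.id (antipodePlus α i).toLinearMap (coactTree α i t) := by
  have hm : ∀ v : TSpace d ⊗[ℝ] TPlus d α i, TensorProduct.map (LinearMap.id (R := ℝ) (M := TSpace d))
      (antipodePlus α i).toLinearMap v =
      Algebra.TensorProduct.map (AlgHom.id ℝ (TSpace d)) (antipodePlus α i) v := fun v => rfl
  induction t using DTree.induct with
  | h0 k l m =>
    rw [hm]
    simp only [antipodeCoact, coactTree, DTree.fold_root, map_mul, map_prod, map_pow, map_add,
      Algebra.TensorProduct.map_tmul, AlgHom.id_apply, map_one]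
    have : ∀ j : Fin (d + 1), antipodePlus α i (plusX α i j) = -plusX α i j := by
      intro j; simp [antipodePlus, plusX]
    simp only [this, TensorProduct.tmul_neg, sub_eq_add_neg]
  | h1 a s t hs ht =>
    rw [hm] at ht ⊢
    simp only [antipodeCoact, coactTree, DTree.fold_graft, map_mul] at ht ⊢
    rw [← ht]
    congr 1
    simp only [map_add, map_sum, Algebra.TensorProduct.map_tmul, AlgHom.id_apply, map_smul, map_mul,
      antipodePlus_plusITree, antipodePlus_plusXpow]
    congr 1
    change TensorProduct.map (I a) LinearMap.id (antipodeCoact α i s) = _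
    rw [hs, ← hm]
    change (TensorProduct.map _ _ ∘ₗ TensorProduct.map _ _) _ =
      (TensorProduct.map _ _ ∘ₗ TensorProduct.map _ _) _
    rw [← TensorProduct.map_comp, ← TensorProduct.map_comp]
    rfl

/-- The map `Δ̂₁` on trees. The summands with `|ℓ|_𝔰 ≥ deg_1(𝓘_a(s))`, which are left out,
vanish. -/
def hatTree (t : DTree d) : TSpace d ⊗[ℝ] TPlus d α 1 :=
  DTree.fold (fun j => X (Pi.single j 1) ⊗ₜ 1) (Xi ⊗ₜ 1) (dXi ⊗ₜ 1)
    (fun a s v => TensorProduct.map (I a) LinearMap.id v -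
      ∑ l ∈ (below ((DTree.planted a s).deg α 1)).filter
          fun l => (DTree.planted a s).deg α 0 ≤ sdeg l,
        ((mfact l : ℝ)⁻¹ • X l) ⊗ₜ
          LinearMap.mul' ℝ (TPlus d α 1)
            (TensorProduct.map (plusI α 1 (a + l)) LinearMap.id v)) t

/-- The map `Δ̂₁`. -/
def hat : TSpace d →ₗ[ℝ] TSpace d ⊗[ℝ] TPlus d α 1 := linExt fun t => hatTree α t

/-! ## Preparation maps -/

/-- Preparation maps. -/
structure IsPreparationMap (R : TSpace d →ₗ[ℝ] TSpace d) : Prop where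
  fixes_monomial : ∀ k, R (X k) = X k
  fixes_Xi : R Xi = Xi
  fixes_dXi : R dXi = dXi
  fixes_planted : ∀ a τ, R (I a τ) = I a τ
  triangular : ∀ t : T d, R (ofTree t) - ofTree t ∈
    treeSpan {s : T d | DTree.deg α 0 (t : DTree d) ≤ DTree.deg α 0 (s : DTree d) ∧
      (s : DTree d).noise < (t : DTree d).noise}
  coact_comm : ∀ j : Fin 2, TensorProduct.map R LinearMap.id ∘ₗ coact α j = coact α j ∘ₗ R
  malliavinD_comm : ∀ τ ∈ treeSpan {t : T d | (t : DTree d).dots = 0},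
    R (malliavinD τ) = malliavinD (R τ)

/-! ## Models -/

/-- Space-time `ℝ^{d+1}`. -/
abbrev Pt (d : ℕ) : Type := Fin (d + 1) → ℝ

/-- `z^k`. -/
def mpow (z : Pt d) (k : MIdx d) : ℝ := ∏ j, z j ^ k j

/-- The partial derivative `∂_j f`. -/
def pderiv (j : Fin (d + 1)) (f : Pt d → ℝ) : Pt d → ℝ :=
  fun y => lineDeriv ℝ f y (Pi.single j 1)

/-- The iterated partial derivative `∂^n f`. -/
def mderiv (n : MIdx d) (f : Pt d → ℝ) : Pt d → ℝ :=
  (List.finRange (d + 1)).foldr (fun j g => (pderiv j)^[n j] g) f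

/-- `∂^a K * f` for a smooth function `f`, where `∂^a K` is the distributional derivative. -/
def conv (K : Pt d → ℝ) (a : MIdx d) (f : Pt d → ℝ) : Pt d → ℝ :=
  fun y => ∫ z, K z * mderiv a f (y - z)

/-- `(∂^a K * f)(y) - ∑_{|k|_𝔰 < c} (y-x)^k / k! (∂^{a+k} K * f)(x)`. -/
def recenter (K : Pt d → ℝ) (a : MIdx d) (c : ℝ) (x : Pt d) (f : Pt d → ℝ) : Pt d → ℝ :=
  fun y => conv K a f y -
    ∑ k ∈ below c, mpow (y - x) k / (mfact k : ℝ) * conv K (a + k) f x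

variable (R : TSpace d →ₗ[ℝ] TSpace d) (K ξ δξ : Pt d → ℝ) (x : Pt d)

/-- The values of `Π_x^{i,×}` on the trees with at most `n` noises, by recursion on `n`. On a
planted tree `𝓘_a(s)`, the function `Π_x^i s = Π_x^{i,×} R s` is computed as
`Π_x^{i,×} s + Π_x^{i,×}(R s - s)`, in which the trees of `R s - s` have fewer noises than `s`. -/
def modelStage : ℕ → DTree d → Pt d → ℝ
  | 0 => DTree.fold (fun j y => y j - x j) ξ δξ
      (fun a s v => recenter K a ((DTree.planted a s).deg α i) x v)
  | n + 1 => DTree.fold (fun j y => y j - x j) ξ δξ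
      (fun a s v => recenter K a ((DTree.planted a s).deg α i) x
        (v + linExt (fun t : T d => modelStage n t) (R (ofTree s) - ofTree s)))

/-- `Π_x^{i,×}`; see `modelTimes_X`, `modelTimes_Xi`, `modelTimes_dXi`, `modelTimes_mul` and
`modelTimes_planted` for its defining recursion. -/
def modelTimes : TSpace d →ₗ[ℝ] Pt d → ℝ :=
  linExt fun t => modelStage α i R K ξ δξ x (t : DTree d).noise t

/-- The renormalised model `Π_x^i = Π_x^{i,×} R`. -/
def model : TSpace d →ₗ[ℝ] Pt d → ℝ := modelTimes α i R K ξ δξ x ∘ₗ R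

theorem linExt_congr {V : Type*} [AddCommGroup V] [Module ℝ V] {f g : T d → V} {S : Set (T d)}
    {τ : TSpace d} (hτ : τ ∈ treeSpan S) (h : ∀ t ∈ S, f t = g t) :
    linExt f τ = linExt g τ := by
  simp only [linExt, LinearMap.comp_apply, Finsupp.linearCombination_apply]
  refine Finsupp.sum_congr fun t ht => ?_
  rw [h t (hτ ht)]

variable {α R}

theorem modelStage_zero_graft (a : MIdx d) (s t : DTree d) :
    modelStage α i R K ξ δξ x 0 (DTree.graft a s t) =
      recenter K a ((DTree.planted a s).deg α i) x (modelStage α i R K ξ δξ x 0 s) *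
        modelStage α i R K ξ δξ x 0 t := by
  simp only [modelStage, DTree.fold_graft]

theorem modelStage_succ_graft (n : ℕ) (a : MIdx d) (s t : DTree d) :
    modelStage α i R K ξ δξ x (n + 1) (DTree.graft a s t) =
      recenter K a ((DTree.planted a s).deg α i) x (modelStage α i R K ξ δξ x (n + 1) s +
        linExt (fun t : T d => modelStage α i R K ξ δξ x n t) (R (ofTree s) - ofTree s)) *
        modelStage α i R K ξ δξ x (n + 1) t := by
  simp only [modelStage, DTree.fold_graft]

theorem modelStage_succ (hR : IsPreparationMap α R) (n : ℕ) :
    ∀ t : DTree d, t ∈ admissible d → t.noise ≤ n →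
      modelStage α i R K ξ δξ x (n + 1) t = modelStage α i R K ξ δξ x n t := by
  induction n with
  | zero =>
    intro t
    induction t using DTree.induct with
    | h0 k l m => intro _ _; rfl
    | h1 a s t hs ht =>
      intro h hn
      obtain ⟨h1, h2⟩ := graft_mem h
      rw [DTree.noise_graft] at hn
      have : linExt (fun t : T d => modelStage α i R K ξ δξ x 0 t) (R (ofTree s) - ofTree s)
          = linExt (fun _ : T d => (0 : Pt d → ℝ)) (R (ofTree s) - ofTree s) := by
        refine linExt_congr (hR.triangular ⟨s, h1⟩) fun u hu => ?_
        have h3 : (u : DTree d).noise < s.noise := hu.2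
        omega
      rw [modelStage_succ_graft, modelStage_zero_graft, hs h1 (by omega), ht h2 (by omega), this]
      congr 2
      simp [linExt, Finsupp.linearCombination_apply]
  | succ n ih =>
    intro t
    induction t using DTree.induct with
    | h0 k l m => intro _ _; rfl
    | h1 a s t hs ht =>
      intro h hn
      obtain ⟨h1, h2⟩ := graft_mem h
      rw [DTree.noise_graft] at hn
      have : linExt (fun t : T d => modelStage α i R K ξ δξ x (n + 1) t) (R (ofTree s) - ofTree s)
          = linExt (fun t : T d => modelStage α i R K ξ δξ x n t) (R (ofTree s) - ofTree s) := by
        refine linExt_congr (hR.triangular ⟨s, h1⟩) fun u hu => ih _ u.2 ?_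
        have h3 : (u : DTree d).noise < s.noise := hu.2
        omega
      rw [modelStage_succ_graft, this, hs h1 (by omega), ht h2 (by omega), modelStage_succ_graft]

theorem modelStage_eq (hR : IsPreparationMap α R) {t : DTree d} (ht : t ∈ admissible d) {n : ℕ}
    (hn : t.noise ≤ n) :
    modelStage α i R K ξ δξ x n t = modelTimes α i R K ξ δξ x (ofTree t) := by
  have h : modelTimes α i R K ξ δξ x (ofTree t) = modelStage α i R K ξ δξ x t.noise t := by
    have := linExt_single (fun t : T d => modelStage α i R K ξ δξ x (t : DTree d).noise t) ⟨t, ht⟩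
    rwa [← ofTree_coe] at this
  rw [h]
  induction n, hn using Nat.le_induction with
  | base => rfl
  | succ n hn ih => rw [modelStage_succ i K ξ δξ x hR n t ht hn, ih]

theorem modelStage_mul (n : ℕ) (s t : DTree d) :
    modelStage α i R K ξ δξ x n (s * t) =
      modelStage α i R K ξ δξ x n s * modelStage α i R K ξ δξ x n t := by
  cases n <;> simp only [modelStage, DTree.fold_mul]

theorem modelTimes_mul_tree (hR : IsPreparationMap α R) {s t : DTree d} (hs : s ∈ admissible d)
    (ht : t ∈ admissible d) :
    modelTimes α i R K ξ δξ x (ofTree (s * t)) =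
      modelTimes α i R K ξ δξ x (ofTree s) * modelTimes α i R K ξ δξ x (ofTree t) := by
  have hn : (s * t).noise = s.noise + t.noise := by simp [DTree.noise, DTree.fold_mul]
  rw [← modelStage_eq i K ξ δξ x hR (mul_mem hs ht) le_rfl,
    ← modelStage_eq i K ξ δξ x hR hs (n := (s * t).noise) (by omega),
    ← modelStage_eq i K ξ δξ x hR ht (n := (s * t).noise) (by omega), modelStage_mul]

/-- `Π_x^{i,×} X^k = (· - x)^k`. -/
theorem modelTimes_X (k : MIdx d) :
    modelTimes α i R K ξ δξ x (X k) = fun y => mpow (y - x) k := by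
  have := linExt_single (fun t : T d => modelStage α i R K ξ δξ x (t : DTree d).noise t)
    ⟨_, root_mem k 0 0⟩
  rw [← ofTree_coe] at this
  refine this.trans ?_
  funext y
  cases (DTree.root k 0 0).noise <;> simp [modelStage, DTree.fold_root, mpow]

/-- `Π_x^{i,×} Ξ = ξ`. -/
theorem modelTimes_Xi : modelTimes α i R K ξ δξ x Xi = ξ := by
  have := linExt_single (fun t : T d => modelStage α i R K ξ δξ x (t : DTree d).noise t)
    ⟨_, root_mem 0 1 0⟩
  rw [← ofTree_coe] at this
  refine this.trans ?_
  cases (DTree.root (0 : MIdx d) 1 0).noise <;> simp [modelStage, DTree.fold_root]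

/-- `Π_x^{i,×} Ξ̇ = δξ`. -/
theorem modelTimes_dXi : modelTimes α i R K ξ δξ x dXi = δξ := by
  have := linExt_single (fun t : T d => modelStage α i R K ξ δξ x (t : DTree d).noise t)
    ⟨_, root_mem 0 0 1⟩
  rw [← ofTree_coe] at this
  refine this.trans ?_
  cases (DTree.root (0 : MIdx d) 0 1).noise <;> simp [modelStage, DTree.fold_root]

/-- `Π_x^{i,×}(σ τ) = (Π_x^{i,×} σ) (Π_x^{i,×} τ)`. -/
theorem modelTimes_mul (hR : IsPreparationMap α R) (σ τ : TSpace d) :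
    modelTimes α i R K ξ δξ x (σ * τ) =
      modelTimes α i R K ξ δξ x σ * modelTimes α i R K ξ δξ x τ := by
  induction σ using MonoidAlgebra.induction_linear with
  | zero => simp
  | add σ σ' h h' => rw [add_mul, map_add, h, h', map_add, add_mul]
  | single s r =>
    induction τ using MonoidAlgebra.induction_linear with
    | zero => simp
    | add τ τ' h h' => rw [mul_add, map_add, h, h', map_add, mul_add]
    | single t r' =>
      have e : ∀ (u : T d) (c : ℝ), (MonoidAlgebra.single u c : TSpace d) = c • ofTree u := by
        intro u c; rw [ofTree_coe]; simp
      rw [MonoidAlgebra.single_mul_single, e, e, e, map_smul, map_smul, map_smul]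
      have := modelTimes_mul_tree i K ξ δξ x hR s.2 t.2
      rw [Submonoid.coe_mul, this, smul_mul_smul_comm]

/-- `(Π_x^{i,×} 𝓘_a(s))(y) = (∂^a K * Π_x^i s)(y) - ∑ (y-x)^k / k! (∂^{a+k} K * Π_x^i s)(x)`, the sum
being over `|k|_𝔰 < deg_i(𝓘_a(s))`, for each tree `s` with `𝓘_a(s) ≠ 0`. -/
theorem modelTimes_planted (hR : IsPreparationMap α R) (a : MIdx d) (s : DTree d)
    (hs : DTree.planted a s ∈ admissible d) :
    modelTimes α i R K ξ δξ x (I a (ofTree s)) =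
      recenter K a ((DTree.planted a s).deg α i) x (model α i R K ξ δξ x (ofTree s)) := by
  have hs1 := (graft_mem hs).1
  have hn : (DTree.planted a s).noise = s.noise := by
    rw [DTree.noise, DTree.fold_planted]; rfl
  rw [I_ofTree, ← modelStage_eq i K ξ δξ x hR hs (n := s.noise + 1) (by omega), modelStage,
    DTree.fold_planted]
  congr 1
  have h1 := modelStage_eq i K ξ δξ x hR hs1 (n := s.noise + 1) (by omega)
  rw [modelStage] at h1
  rw [h1]
  have h2 : linExt (fun t : T d => modelStage α i R K ξ δξ x s.noise t) (R (ofTree s) - ofTree s)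
      = modelTimes α i R K ξ δξ x (R (ofTree s) - ofTree s) := by
    refine linExt_congr (hR.triangular ⟨s, hs1⟩) fun u hu => ?_
    have h3 := hu.2
    simp only at h3
    have e := modelStage_eq i K ξ δξ x hR u.2 h3.le
    rw [e]
    have := linExt_single (fun t : T d => modelStage α i R K ξ δξ x (t : DTree d).noise t) u
    rw [← ofTree_coe] at this
    exact this
  rw [h2, map_sub, add_sub_cancel]
  rfl

variable (α R)

/-- The character `f_x^i` of `𝒯^{+,i}`. -/
def fChar : TPlus d α i →ₐ[ℝ] ℝ :=
  MvPolynomial.aeval (Sum.elim (fun j => -x j) fun p =>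
    -conv K p.1.1 (model α i R K ξ δξ x (ofTree p.1.2)) x)

/-- The character `γ_{xy}^i = (f_x^i 𝒜_i^+ ⊗ f_y^i) Δ_i^+`. -/
def gammaChar (x y : Pt d) : TPlus d α i →ₐ[ℝ] ℝ :=
  (Algebra.TensorProduct.lmul' ℝ (S := ℝ)).comp
    ((Algebra.TensorProduct.map ((fChar α i R K ξ δξ x).comp (antipodePlus α i))
      (fChar α i R K ξ δξ y)).comp (coprodPlus α i))

/-- `id ⊗ f` followed by `𝒯 ⊗ ℝ = 𝒯`. -/
def evalRight {α : ℝ} {i : Fin 2} (f : TPlus d α i →ₐ[ℝ] ℝ) :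
    TSpace d ⊗[ℝ] TPlus d α i →ₗ[ℝ] TSpace d :=
  (TensorProduct.rid ℝ (TSpace d)).toLinearMap ∘ₗ TensorProduct.map LinearMap.id f.toLinearMap

/-- The re-expansion map `Γ_{xy}^i = (id ⊗ γ_{xy}^i) Δ_i`. -/
def Gamma (x y : Pt d) : TSpace d →ₗ[ℝ] TSpace d :=
  evalRight (gammaChar α i R K ξ δξ x y) ∘ₗ coact α i

/-- The recentering map `dΓ_{yx}^1 = 𝒬₀ (Γ_{yx}^1 ⊗ f_x^1) Δ̂₁ D_Ξ`. -/
def dGamma (y x : Pt d) : TSpace d →ₗ[ℝ] TSpace d :=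
  Q0 ∘ₗ Gamma α 1 R K ξ δξ y x ∘ₗ evalRight (fChar α 1 R K ξ δξ x) ∘ₗ hat α ∘ₗ malliavinD

/-- The Malliavin derivative `δF` of a functional `F` of the noise, with values in functions: the
directional derivative at `ξ` in the direction `δξ`. -/
def malliavin (F : (Pt d → ℝ) → Pt d → ℝ) (ξ δξ : Pt d → ℝ) : Pt d → ℝ :=
  fun z => deriv (fun ε : ℝ => F (ξ + ε • δξ) z) 0

/-- The functional `F` has a directional derivative at `ξ` in the direction `δξ`. -/
def HasMalliavin (F : (Pt d → ℝ) → Pt d → ℝ) (ξ δξ : Pt d → ℝ) : Prop :=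
  ∀ z, DifferentiableAt ℝ (fun ε : ℝ => F (ξ + ε • δξ) z) 0

/-! ## The assumption on trees -/

/-- `deg_1(Ξ̇) + 2`. -/
def dXiDeg (d : ℕ) (α : ℝ) : ℝ := α + ((d : ℝ) + 2) / 2 + 2

/-- `N`, the greatest integer with `deg_1(Ξ̇) + 2 - N > 0`. -/
def orderN (d : ℕ) (α : ℝ) : ℤ := ⌈dXiDeg d α⌉ - 1

theorem orderN_isGreatest (d : ℕ) (α : ℝ) :
    IsGreatest {N : ℤ | 0 < dXiDeg d α - N} (orderN d α) := by
  refine ⟨?_, fun M hM => ?_⟩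
  · have := Int.ceil_lt_add_one (dXiDeg d α)
    simp only [Set.mem_ofPred_eq, orderN]
    push_cast
    linarith
  · have h : (M : ℝ) < dXiDeg d α := by simpa using hM
    have := Int.lt_ceil.2 h
    simp only [orderN]
    omega

/-- The set `T₀` of trees without `Ξ̇` spans a space `𝒯₀` with `Δ₀ : 𝒯₀ → 𝒯₀ ⊗ 𝒯^{+,0}`, and each term
`𝓘_a(D_Ξ σ) ρ` of `D_Ξ τ`, where `τ = 𝓘_a(σ) ρ ∈ T₀`, has `deg_1(𝓘_{a+n}(D_Ξ σ)) > 0` for every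
`|n|_𝔰 ≤ N`, that is, this holds for all trees of the linear combination `D_Ξ σ`. -/
structure SatisfiesAssumption (T₀ : Set (T d)) : Prop where
  no_dot : ∀ τ ∈ T₀, (τ : DTree d).dots = 0
  coact_mem : ∀ τ ∈ T₀, coact α 0 (ofTree τ) ∈
    LinearMap.range (TensorProduct.map (treeSpan T₀).subtype
      (LinearMap.id (R := ℝ) (M := TPlus d α 0)))
  deg_pos : ∀ τ ∈ T₀, ∀ (a : MIdx d) (σ ρ : DTree d), (τ : DTree d) = DTree.graft a σ ρ →
    ∀ n : MIdx d, (sdeg n : ℤ) ≤ orderN d α →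
      ∀ σ' ∈ (malliavinD (ofTree σ)).coeff.support,
        0 < (DTree.planted (a + n) (σ' : DTree d)).deg α 1

/-- `F` is smooth and its derivatives `∂^n F` with `|n|_𝔰 ≤ N` vanish at `y`. -/
def VanishesToOrder (N : ℤ) (F : Pt d → ℝ) (y : Pt d) : Prop :=
  ContDiff ℝ ∞ F ∧ ∀ n : MIdx d, (sdeg n : ℤ) ≤ N → mderiv n F y = 0

end Space

end

end MalliavinTree

open MalliavinTree

/-! Every character `f` of `𝒯^{+,i}` acts on `𝒯` by the algebra endomorphism `act f`, that is `(id ⊗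
f)Δ_i`. Such a map commutes with each `𝓘_a` up to an explicit Taylor jet (`act_I`, `tay`). All
algebra is done with these endomorphisms: composition (`act_charConv`) and inverses
(`act_act_antipode`, `act_antipode_act`) follow by induction on trees, without coassociativity of
`Δ_i^+`.

Three facts about the models carry the proof. (1) `Π_x^{i,×} act (f_x^i 𝒜_i^+)` depends neither on
`i` nor on `x` (`bold_eq`): its jets cancel the recentering, leaving the recursion `𝓘_a(s) ↦ ∂^a K *
(value at R s)`. (2) `act f_x^1` after `(id ⊗ f_x^1)Δ̂₁` is `act f_x^0` (`act_hatAct`): `Δ̂₁`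
subtracts the Taylor terms of order between `deg_0` and `deg_1`, and by (1) the remaining
coefficients agree. (3) The model at `ξ + ε δξ` is a polynomial in `ε`, whose coefficient of first
order is `Π_x^{0,×} D_Ξ τ` (`isPolyDer_model`), so `δΠ_x^{0,×} τ = Π_x^{0,×} D_Ξ τ`.

Put `L = act (f_y^1 𝒜_1^+) ∘ act f_x^0` (`transl`). By (2), `dΓ_{yx}^1 τ = 𝒬₀ L D_Ξ τ`
(`dGamma_eq`), and by (1), `Π_y^{1,×} L = Π_x^{0,×}` (`modelAlg_transl`). Since `L` acts like a
translation, the part of `L D_Ξ τ` that still contains `Ξ̇` is `D_Ξ L τ`, and `τ ↦ Ξ̇ τ°` commutes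
with `L` (`IsTranslation.malliavinD_apply`, `IsTranslation.QRoot_malliavinD`). On trees without `Ξ̇`
the models for `i = 0, 1` agree. Hence the function in the first identity is `-Π_y^{1,×}` of the
part of `D_Ξ L τ` with no `Ξ̇` at the root. Because `L τ ∈ 𝒯₀`, that part is a combination of
products `𝓘_a(D_Ξ σ) ρ` in which `deg_1(𝓘_{a+n}(D_Ξ σ)) > 0` for `|n|_𝔰 ≤ N`, and the recentering at
`y` makes each first factor vanish to order `N` there (`modelAlg_branchD`). The second identity is
the first one for `R τ`, since `R` commutes with `L`, `𝒬₀` and `D_Ξ`.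

The moment condition on `K` enters because `𝓘_a(X^k) = 0` in `𝒯` forces `∂^a K * (· - x)^k = 0`. For
each element of `𝒯` only finitely many `k` matter; the filter `cancel` hides the bookkeeping of `r`,
and `eventually_evalRight` gives uniformity over characters, which themselves depend on `K` and on
the noise. -/

namespace MalliavinTree

noncomputable section

section

/-! ## Trees and their spans -/

/-- Every tree is built from `X_j`, `Ξ`, `Ξ̇` by products and planting. -/
theorem DTree.generate {d : ℕ} {P : DTree d → Prop} (one : P 1)
    (hX : ∀ j, P (root (Pi.single j 1) 0 0)) (hXi : P (root 0 1 0)) (hdXi : P (root 0 0 1))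
    (mul : ∀ s t, P s → P t → P (s * t)) (planted : ∀ a s, P s → P (planted a s))
    (t : DTree d) : P t := by
  induction t using DTree.induct with
  | h1 a s t hs ht => exact planted_mul a s t ▸ mul _ _ (planted a s hs) ht
  | h0 k l m =>
    have hp : ∀ (t : DTree d) (n : ℕ), P t → P (t ^ n) := by
      intro t n h
      induction n with
      | zero => simpa using one
      | succ n ih => rw [pow_succ]; exact mul _ _ ih h
    have e : ∀ (l : ℕ), (root 0 1 0 : DTree d) ^ l = root 0 l 0 := by
      intro l
      induction l with
      | zero => rfl
      | succ n ih => rw [pow_succ, ih, root_mul_root]; simp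
    have e' : ∀ (l : ℕ), (root 0 0 1 : DTree d) ^ l = root 0 0 l := by
      intro l
      induction l with
      | zero => rfl
      | succ n ih => rw [pow_succ, ih, root_mul_root]; simp
    -- Monomials are stripped of one variable at a time; `S` is a finite set carrying the support of
    -- `k`.
    have ek : ∀ (S : Finset (Fin (d + 1))) (k : MIdx d), (∀ j ∉ S, k j = 0) → P (root k 0 0) := by
      intro S
      classical
      induction S using Finset.induction_on with
      | empty =>
        intro k h
        have : k = 0 := funext fun j => h j (by simp)
        subst this; exact one
      | insert j S hj ih =>
        intro k h
        have h1 : root k 0 0 = root (k j • (Pi.single j 1 : MIdx d)) 0 0 *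
            root (Function.update k j 0) 0 0 := by
          rw [root_mul_root]
          congr 1
          funext i
          by_cases hi : i = j
          · subst hi; simp
          · simp [hi]
        have h2 : ∀ n : ℕ, root (n • (Pi.single j 1 : MIdx d)) 0 0 =
            (root (Pi.single j 1) 0 0 : DTree d) ^ n := by
          intro n
          induction n with
          | zero => simp [one_def]
          | succ n ih => rw [pow_succ, ← ih, root_mul_root, succ_nsmul]
        rw [h1, h2]
        refine mul _ _ (hp _ _ (hX j)) (ih _ fun i hi => ?_)
        by_cases hij : i = j
        · subst hij; simp
        · simp only [Function.update_of_ne hij]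
          exact h i (by simp [hij, hi])
    have : root k l m = root k 0 0 * (root 0 l 0 * root 0 0 m) := by
      rw [root_mul_root, root_mul_root]; simp
    rw [this, ← e, ← e']
    exact mul _ _ (ek Finset.univ k (by simp)) (mul _ _ (hp _ _ hXi) (hp _ _ hdXi))

variable {d : ℕ}

theorem DTree.dots_mul (s t : DTree d) : (s * t).dots = s.dots + t.dots := by
  simp [DTree.dots, DTree.fold_mul]

theorem DTree.dots_planted (a : MIdx d) (s : DTree d) : (DTree.planted a s).dots = s.dots := by
  simp [DTree.dots, DTree.fold_planted]

theorem DTree.dots_root (k : MIdx d) (l m : ℕ) : (DTree.root k l m).dots = m := by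
  simp [DTree.dots, DTree.fold_root, toAdd_pow]

theorem DTree.rootDots_mul (s t : DTree d) : (s * t).rootDots = s.rootDots + t.rootDots := by
  simp [DTree.rootDots, DTree.fold_mul]

theorem DTree.rootDots_planted (a : MIdx d) (s : DTree d) : (DTree.planted a s).rootDots = 0 := by
  simp [DTree.rootDots, DTree.fold_planted]

theorem DTree.rootDots_root (k : MIdx d) (l m : ℕ) : (DTree.root k l m).rootDots = m := by
  simp [DTree.rootDots, DTree.fold_root, toAdd_pow]

theorem DTree.rootDots_le_dots (t : DTree d) : t.rootDots ≤ t.dots := by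
  induction t using DTree.generate with
  | one => simp [DTree.one_def, rootDots_root, dots_root]
  | hX j => simp [rootDots_root, dots_root]
  | hXi => simp [rootDots_root, dots_root]
  | hdXi => simp [rootDots_root, dots_root]
  | mul s t hs ht => rw [rootDots_mul, dots_mul]; omega
  | planted a s hs => rw [rootDots_planted]; omega

theorem DTree.noise_mul (s t : DTree d) : (s * t).noise = s.noise + t.noise := by
  simp [DTree.noise, DTree.fold_mul]

theorem DTree.noise_planted (a : MIdx d) (s : DTree d) : (DTree.planted a s).noise = s.noise := by
  simp [DTree.noise, DTree.fold_planted]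

theorem DTree.deg_root (α : ℝ) (i : Fin 2) (k : MIdx d) (l m : ℕ) :
    (DTree.root k l m).deg α i =
      sdeg k + l * α + m * (α + (i : ℕ) * (((d : ℝ) + 2) / 2)) := by
  simp [DTree.deg, DTree.fold_root, toAdd_pow, toAdd_prod, sdeg, mul_comm]
  ring

theorem sdeg_add (k l : MIdx d) : sdeg (k + l) = sdeg k + sdeg l := by
  simp [sdeg, mul_add, Finset.sum_add_distrib]

theorem mul_mem_admissible {s t : DTree d} :
    s * t ∈ admissible d ↔ s ∈ admissible d ∧ t ∈ admissible d := by
  change (s * t).monomialBranches = 0 ↔ s.monomialBranches = 0 ∧ t.monomialBranches = 0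
  rw [DTree.monomialBranches_mul]
  omega

theorem planted_mem_admissible {a : MIdx d} {s : DTree d} :
    DTree.planted a s ∈ admissible d ↔ s ∈ admissible d ∧ ∀ k, s ≠ DTree.root k 0 0 := by
  classical
  change (DTree.planted a s).monomialBranches = 0 ↔ s.monomialBranches = 0 ∧ _
  rw [DTree.monomialBranches, DTree.fold_planted]
  by_cases h : ∃ k, s = DTree.root k 0 0
  · simp only [h, if_true]
    simp
    obtain ⟨k, h⟩ := h
    exact fun _ => ⟨k, h⟩
  · simp only [h, if_false]
    push Not at h
    simp [h]
    rfl

theorem ofTree_of_not_mem {t : DTree d} (h : t ∉ admissible d) : ofTree t = 0 := by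
  simp [ofTree, h]

theorem ofTree_one : ofTree (1 : DTree d) = 1 := by
  have : (1 : DTree d) ∈ admissible d := one_mem _
  rw [ofTree, dif_pos this]
  rfl

theorem ofTree_of_mem {t : DTree d} (h : t ∈ admissible d) :
    ofTree t = MonoidAlgebra.single ⟨t, h⟩ 1 := by
  simp [ofTree, h]

theorem ofTree_mem_treeSpan {S : Set (T d)} {t : DTree d}
    (h : ∀ ht : t ∈ admissible d, (⟨t, ht⟩ : T d) ∈ S) : ofTree t ∈ treeSpan S := by
  by_cases ht : t ∈ admissible d
  · rw [ofTree_of_mem ht, treeSpan, MonoidAlgebra.supported_eq_span_single]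
    exact Submodule.subset_span ⟨_, h ht, rfl⟩
  · rw [ofTree_of_not_mem ht]; exact zero_mem _

theorem treeSpan_le {S : Set (T d)} {M : Submodule ℝ (TSpace d)} :
    treeSpan S ≤ M ↔ ∀ u ∈ S, ofTree (u : DTree d) ∈ M := by
  rw [treeSpan, MonoidAlgebra.supported_eq_span_single, Submodule.span_le]
  simp only [ofTree_coe, Set.subset_def, Set.forall_mem_image]
  rfl

theorem treeSpan_induction {S : Set (T d)} {M : Submodule ℝ (TSpace d)} {σ : TSpace d}
    (hσ : σ ∈ treeSpan S) (h : ∀ u ∈ S, ofTree (u : DTree d) ∈ M) : σ ∈ M :=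
  treeSpan_le.2 h hσ

theorem treeSpan_mono {S S' : Set (T d)} (h : S ⊆ S') : treeSpan S ≤ treeSpan S' :=
  MonoidAlgebra.supported_mono h

theorem treeSpan_mul {S S' S'' : Set (T d)} (h : ∀ s ∈ S, ∀ t ∈ S', s * t ∈ S'')
    {σ τ : TSpace d} (hσ : σ ∈ treeSpan S) (hτ : τ ∈ treeSpan S') : σ * τ ∈ treeSpan S'' := by
  have h1 : ∀ s ∈ S, ofTree (s : DTree d) * τ ∈ treeSpan S'' := by
    intro s hs
    have : τ ∈ (treeSpan S'').comap (LinearMap.mulLeft ℝ (ofTree (s : DTree d))) := by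
      refine treeSpan_induction hτ fun t ht => ?_
      rw [Submodule.mem_comap, LinearMap.mulLeft_apply, ← ofTree_mul]
      exact ofTree_mem_treeSpan fun _ => h s hs t ht
    rwa [Submodule.mem_comap, LinearMap.mulLeft_apply] at this
  have : σ ∈ (treeSpan S'').comap (LinearMap.mulRight ℝ τ) := by
    refine treeSpan_induction hσ fun t ht => ?_
    rw [Submodule.mem_comap, LinearMap.mulRight_apply]
    exact h1 t ht
  rwa [Submodule.mem_comap, LinearMap.mulRight_apply] at this

theorem treeSpan_I {S S' : Set (T d)} (a : MIdx d)
    (h : ∀ s ∈ S, ∀ h : DTree.planted a (s : DTree d) ∈ admissible d, (⟨_, h⟩ : T d) ∈ S')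
    {σ : TSpace d} (hσ : σ ∈ treeSpan S) : I a σ ∈ treeSpan S' := by
  refine treeSpan_induction (M := (treeSpan S').comap (I a)) hσ fun s hs => ?_
  rw [Submodule.mem_comap, I_ofTree]
  exact ofTree_mem_treeSpan fun hu => h s hs hu

theorem treeSpan_univ : treeSpan (Set.univ : Set (T d)) = ⊤ := by
  rw [treeSpan, eq_top_iff]
  exact fun σ _ => Set.subset_univ _

/-- Linear statements are phrased below as membership in a submodule, usually a `LinearMap.eqLocus`
or a `comap`, so that it suffices to check them on single trees. -/
theorem mem_of_ofTree_mem {M : Submodule ℝ (TSpace d)}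
    (h : ∀ t : DTree d, t ∈ admissible d → ofTree t ∈ M) (σ : TSpace d) : σ ∈ M :=
  treeSpan_induction (S := Set.univ) (by rw [treeSpan_univ]; trivial) fun u _ => h u u.2

theorem linearMap_ext_ofTree {V : Type*} [AddCommGroup V] [Module ℝ V] {f g : TSpace d →ₗ[ℝ] V}
    (h : ∀ t : DTree d, t ∈ admissible d → f (ofTree t) = g (ofTree t)) : f = g :=
  LinearMap.ext fun σ => mem_of_ofTree_mem (M := LinearMap.eqLocus f g) h σ

theorem linExt_ofTree {V : Type*} [AddCommGroup V] [Module ℝ V] (f : T d → V) {t : DTree d}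
    (h : t ∈ admissible d) : linExt f (ofTree t) = f ⟨t, h⟩ := by
  rw [ofTree_of_mem h, linExt_single]

theorem X_zero : X (0 : MIdx d) = 1 := ofTree_one

theorem X_eq_prod (k : MIdx d) : X k = ∏ j, X (Pi.single j 1) ^ k j := by
  rw [X, ofTree_root]; simp

/-! ### Linear maps given by folds -/

/-- The algebra morphism on `𝒯` extending a multiplicative map on trees. -/
def algExt {A : Type*} [CommRing A] [Algebra ℝ A] (f : DTree d → A) (h1 : f 1 = 1)
    (hm : ∀ s t, f (s * t) = f s * f t) : TSpace d →ₐ[ℝ] A :=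
  MonoidAlgebra.lift ℝ A (T d) ⟨⟨fun t => f t, h1⟩, fun s t => hm s t⟩

theorem algExt_toLinearMap {A : Type*} [CommRing A] [Algebra ℝ A] (f : DTree d → A) (h1 : f 1 = 1)
    (hm : ∀ s t, f (s * t) = f s * f t) :
    (algExt f h1 hm).toLinearMap = linExt fun t : T d => f t := by
  refine linearMap_ext_ofTree fun t ht => ?_
  rw [linExt_ofTree _ ht]
  change algExt f h1 hm (ofTree t) = _
  rw [ofTree_of_mem ht, algExt]
  simp

variable (α : ℝ) (i : Fin 2)

theorem coactTree_one : coactTree α i (1 : DTree d) = 1 := DTree.fold_one ..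

theorem coactTree_mul (s t : DTree d) :
    coactTree α i (s * t) = coactTree α i s * coactTree α i t := DTree.fold_mul ..

theorem hatTree_one : hatTree α (1 : DTree d) = 1 := DTree.fold_one ..

theorem hatTree_mul (s t : DTree d) :
    hatTree α (s * t) = hatTree α s * hatTree α t := DTree.fold_mul ..

variable {α i}

/-! ### Endomorphisms of `𝒯` obtained by evaluating the co-actions at characters. -/

/-- `id ⊗ f` followed by `𝒯 ⊗ ℝ = 𝒯`, as an algebra morphism. -/
def evalRightAlg (f : TPlus d α i →ₐ[ℝ] ℝ) : TSpace d ⊗[ℝ] TPlus d α i →ₐ[ℝ] TSpace d :=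
  (Algebra.TensorProduct.rid ℝ ℝ (TSpace d)).toAlgHom.comp
    (Algebra.TensorProduct.map (AlgHom.id ℝ (TSpace d)) f)

theorem evalRightAlg_tmul (f : TPlus d α i →ₐ[ℝ] ℝ) (σ : TSpace d) (q : TPlus d α i) :
    evalRightAlg f (σ ⊗ₜ q) = f q • σ := by
  simp [evalRightAlg]

theorem evalRight_tmul (f : TPlus d α i →ₐ[ℝ] ℝ) (σ : TSpace d) (q : TPlus d α i) :
    evalRight f (σ ⊗ₜ q) = f q • σ := by
  simp [evalRight]

theorem evalRight_eq (f : TPlus d α i →ₐ[ℝ] ℝ) :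
    evalRight f = (evalRightAlg f).toLinearMap := by
  refine TensorProduct.ext' fun σ q => ?_
  rw [evalRight_tmul]
  exact (evalRightAlg_tmul f σ q).symm

/-- The algebra endomorphism `(id ⊗ f) Δ_i` of `𝒯`. -/
def act (f : TPlus d α i →ₐ[ℝ] ℝ) : TSpace d →ₐ[ℝ] TSpace d :=
  algExt (fun t => evalRightAlg f (coactTree α i t)) (by rw [coactTree_one, map_one])
    (fun s t => by rw [coactTree_mul, map_mul])

theorem act_toLinearMap (f : TPlus d α i →ₐ[ℝ] ℝ) :
    (act f).toLinearMap = evalRight f ∘ₗ coact α i := by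
  rw [act, algExt_toLinearMap]
  refine linearMap_ext_ofTree fun t ht => ?_
  rw [linExt_ofTree _ ht, LinearMap.comp_apply, coact, linExt_ofTree _ ht, evalRight_eq]
  rfl

theorem act_apply (f : TPlus d α i →ₐ[ℝ] ℝ) (σ : TSpace d) :
    act f σ = evalRight f (coact α i σ) := DFunLike.congr_fun (act_toLinearMap f) σ

theorem act_ofTree (f : TPlus d α i →ₐ[ℝ] ℝ) {t : DTree d} (ht : t ∈ admissible d) :
    act f (ofTree t) = evalRight f (coactTree α i t) := by
  rw [act_apply, coact, linExt_ofTree _ ht]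

/-- The algebra endomorphism `(id ⊗ f) Δ̂₁` of `𝒯`. -/
def hatAct (f : TPlus d α 1 →ₐ[ℝ] ℝ) : TSpace d →ₐ[ℝ] TSpace d :=
  algExt (fun t => evalRightAlg f (hatTree α t)) (by rw [hatTree_one, map_one])
    (fun s t => by rw [hatTree_mul, map_mul])

theorem hatAct_toLinearMap (f : TPlus d α 1 →ₐ[ℝ] ℝ) :
    (hatAct f).toLinearMap = evalRight f ∘ₗ hat α := by
  rw [hatAct, algExt_toLinearMap]
  refine linearMap_ext_ofTree fun t ht => ?_
  rw [linExt_ofTree _ ht, LinearMap.comp_apply, hat, linExt_ofTree _ ht, evalRight_eq]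
  rfl

theorem hatAct_apply (f : TPlus d α 1 →ₐ[ℝ] ℝ) (σ : TSpace d) :
    hatAct f σ = evalRight f (hat α σ) := DFunLike.congr_fun (hatAct_toLinearMap f) σ

theorem hatAct_ofTree (f : TPlus d α 1 →ₐ[ℝ] ℝ) {t : DTree d} (ht : t ∈ admissible d) :
    hatAct f (ofTree t) = evalRight f (hatTree α t) := by
  rw [hatAct_apply, hat, linExt_ofTree _ ht]

/-! ### `D_Ξ`, `𝒬₀` -/

/-- The relation `𝓘_a(X^k) = 0` does no harm: an admissible tree killed by `𝓘_a` is a monomial, and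
`D_Ξ` kills it too. -/
theorem malliavinD_I (a : MIdx d) (σ : TSpace d) : malliavinD (I a σ) = I a (malliavinD σ) := by
  refine mem_of_ofTree_mem (M := LinearMap.eqLocus (malliavinD ∘ₗ I a) (I a ∘ₗ malliavinD))
    (fun t ht => ?_) σ
  change malliavinD (I a (ofTree t)) = I a (malliavinD (ofTree t))
  by_cases h : DTree.planted a t ∈ admissible d
  · exact malliavinD_planted a t h
  · rw [planted_mem_admissible] at h
    push Not at h
    obtain ⟨k, rfl⟩ := h ht
    have h1 := I_X a k
    have h2 := malliavinD_X k
    rw [X] at h1 h2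
    rw [h1, h2, map_zero, map_zero]

theorem malliavinD_one : malliavinD (1 : TSpace d) = 0 := by
  rw [← X_zero]; exact malliavinD_X 0

theorem malliavinD_dXi : malliavinD (dXi : TSpace d) = 0 := by
  have h1 := snd_dual ⟨_, root_mem (0 : MIdx d) 0 1⟩
  rw [dXi, ← h1, dual, DTree.fold_root]
  simp

theorem Q0_ofTree {t : DTree d} (ht : t ∈ admissible d) :
    Q0 (ofTree t) = if t.dots = 0 then ofTree t else 0 := linExt_ofTree _ ht

theorem QRoot_ofTree {t : DTree d} (ht : t ∈ admissible d) :
    QRoot (ofTree t) = if t.rootDots = 0 then 0 else ofTree t := linExt_ofTree _ ht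

/-- The trees without `Ξ̇`. -/
abbrev dotless (d : ℕ) : Set (T d) := {t : T d | (t : DTree d).dots = 0}

theorem Q0_of_dotless {σ : TSpace d} (h : σ ∈ treeSpan (dotless d)) : Q0 σ = σ :=
  treeSpan_induction (M := LinearMap.eqLocus Q0 LinearMap.id) h fun u hu => by
    change Q0 (ofTree _) = _
    rw [Q0_ofTree u.2]
    exact if_pos hu

theorem Q0_mem_dotless (σ : TSpace d) : Q0 σ ∈ treeSpan (dotless d) :=
  mem_of_ofTree_mem (M := (treeSpan (dotless d)).comap Q0) (fun t ht => by
    rw [Submodule.mem_comap, Q0_ofTree ht]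
    split_ifs with h
    · exact ofTree_mem_treeSpan fun _ => h
    · exact zero_mem _) σ

theorem Q0_mul (σ τ : TSpace d) : Q0 (σ * τ) = Q0 σ * Q0 τ := by
  refine mem_of_ofTree_mem (M := LinearMap.eqLocus (Q0 ∘ₗ LinearMap.mulRight ℝ τ)
    (LinearMap.mulRight ℝ (Q0 τ) ∘ₗ Q0)) (fun s hs => ?_) σ
  change Q0 (ofTree s * τ) = Q0 (ofTree s) * Q0 τ
  refine mem_of_ofTree_mem (M := LinearMap.eqLocus (Q0 ∘ₗ LinearMap.mulLeft ℝ (ofTree s))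
    (LinearMap.mulLeft ℝ (Q0 (ofTree s)) ∘ₗ Q0)) (fun t ht => ?_) τ
  change Q0 (ofTree s * ofTree t) = Q0 (ofTree s) * Q0 (ofTree t)
  rw [← ofTree_mul, Q0_ofTree hs, Q0_ofTree ht, Q0_ofTree (mul_mem_admissible.2 ⟨hs, ht⟩),
    DTree.dots_mul, ofTree_mul]
  by_cases h : s.dots = 0 <;> by_cases h' : t.dots = 0 <;> simp [h, h']

theorem Q0_I (a : MIdx d) (σ : TSpace d) : Q0 (I a σ) = I a (Q0 σ) := by
  refine mem_of_ofTree_mem (M := LinearMap.eqLocus (Q0 ∘ₗ I a) (I a ∘ₗ Q0)) (fun s hs => ?_) σ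
  change Q0 (I a (ofTree s)) = I a (Q0 (ofTree s))
  rw [I_ofTree, Q0_ofTree hs, apply_ite (I a), map_zero, I_ofTree]
  by_cases h : DTree.planted a s ∈ admissible d
  · rw [Q0_ofTree h, DTree.dots_planted]
  · simp [ofTree_of_not_mem h]

theorem X_mem_dotless (k : MIdx d) : X k ∈ treeSpan (dotless d) :=
  ofTree_mem_treeSpan fun _ => DTree.dots_root k 0 0

theorem QRoot_I (a : MIdx d) (σ : TSpace d) : QRoot (I a σ) = 0 := by
  refine mem_of_ofTree_mem (M := LinearMap.ker (QRoot ∘ₗ I a)) (fun s hs => ?_) σ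
  change QRoot (I a (ofTree s)) = 0
  rw [I_ofTree]
  by_cases h : DTree.planted a s ∈ admissible d
  · rw [QRoot_ofTree h, DTree.rootDots_planted, if_pos rfl]
  · simp [ofTree_of_not_mem h]

theorem QRoot_mul_of_dotless (σ : TSpace d) {τ : TSpace d} (hτ : τ ∈ treeSpan (dotless d)) :
    QRoot (σ * τ) = QRoot σ * τ := by
  refine mem_of_ofTree_mem (M := LinearMap.eqLocus (QRoot ∘ₗ LinearMap.mulRight ℝ τ)
    (LinearMap.mulRight ℝ τ ∘ₗ QRoot)) (fun s hs => ?_) σ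
  change QRoot (ofTree s * τ) = QRoot (ofTree s) * τ
  refine treeSpan_induction (M := LinearMap.eqLocus (QRoot ∘ₗ LinearMap.mulLeft ℝ (ofTree s))
    (LinearMap.mulLeft ℝ (QRoot (ofTree s)))) hτ fun t ht => ?_
  change QRoot (ofTree s * ofTree (t : DTree d)) = QRoot (ofTree s) * ofTree (t : DTree d)
  have h : (t : DTree d).rootDots = 0 := Nat.le_zero.1 (ht ▸ DTree.rootDots_le_dots _)
  rw [← ofTree_mul, QRoot_ofTree (mul_mem_admissible.2 ⟨hs, t.2⟩), QRoot_ofTree hs,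
    DTree.rootDots_mul, h, add_zero]
  split_ifs <;> simp [ofTree_mul]

theorem QRoot_dXi : QRoot (dXi : TSpace d) = dXi := by
  rw [dXi, QRoot_ofTree (root_mem _ _ _), DTree.rootDots_root, if_neg one_ne_zero]

theorem Q0_dXi : Q0 (dXi : TSpace d) = 0 := by
  rw [dXi, Q0_ofTree (root_mem _ _ _), DTree.dots_root, if_neg one_ne_zero]

end

section

/-! ## Multi-index calculus -/

variable {d : ℕ}

/-- `v^k` for a tuple `v` in a commutative ring. -/
def mp {A : Type*} [CommRing A] (v : Fin (d + 1) → A) (k : MIdx d) : A := ∏ j, v j ^ k j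

theorem mp_map {A B : Type*} [CommRing A] [CommRing B] {F : Type*} [FunLike F A B]
    [RingHomClass F A B] (Φ : F) (v : Fin (d + 1) → A) (k : MIdx d) :
    Φ (mp v k) = mp (fun j => Φ (v j)) k := by
  simp [mp, map_prod]

theorem X_eq_mp (k : MIdx d) : X k = mp (fun j => X (Pi.single j 1)) k := X_eq_prod k

theorem mfact_ne_zero (k : MIdx d) : (mfact k : ℝ) ≠ 0 := by
  rw [mfact]
  exact_mod_cast Finset.prod_ne_zero_iff.2 fun j _ => Nat.factorial_ne_zero _

/-- The multinomial formula `∑_{l ≤ k} v^l / l! w^{k-l} / (k-l)! = (v + w)^k / k!`. -/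
theorem mp_add {A : Type*} [CommRing A] [Algebra ℝ A] (v w : Fin (d + 1) → A) (k : MIdx d) :
    ∑ l ∈ Fintype.piFinset fun j => Finset.range (k j + 1),
      ((mfact l : ℝ)⁻¹ * (mfact (k - l) : ℝ)⁻¹) • (mp v l * mp w (k - l)) =
      (mfact k : ℝ)⁻¹ • mp (fun j => v j + w j) k := by
  have h1 : ∀ j, ((k j)! : ℝ)⁻¹ • (v j + w j) ^ k j =
      ∑ l ∈ Finset.range (k j + 1), ((l ! : ℝ)⁻¹ * ((k j - l)! : ℝ)⁻¹) •
        (v j ^ l * w j ^ (k j - l)) := by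
    intro j
    rw [add_pow, Finset.smul_sum]
    refine Finset.sum_congr rfl fun l hl => ?_
    have hl' : l ≤ k j := Nat.lt_succ_iff.1 (Finset.mem_range.1 hl)
    rw [show ((k j).choose l : A) = algebraMap ℝ A ((k j).choose l : ℝ) by simp, mul_comm,
      ← Algebra.smul_def, smul_smul]
    congr 1
    rw [Nat.cast_choose ℝ hl']
    have := Nat.cast_ne_zero (R := ℝ).2 (Nat.factorial_ne_zero (k j))
    field_simp
  have h2 : (mfact k : ℝ)⁻¹ • mp (fun j => v j + w j) k =
      ∏ j, ((k j)! : ℝ)⁻¹ • (v j + w j) ^ k j := by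
    rw [Finset.prod_smul, mfact, mp]
    simp
  rw [h2]
  simp only [h1, Finset.prod_univ_sum]
  refine Finset.sum_congr rfl fun l _ => ?_
  rw [Finset.prod_smul, Finset.prod_mul_distrib, Finset.prod_mul_distrib]
  simp [mfact, mp]

/-- Re-index by the total: `|m|_𝔰 < c - |k|_𝔰` says exactly that `|k + m|_𝔰 < c`, and the first
index then runs over all multi-indices below the total. -/
theorem sum_below_below {A : Type*} [AddCommMonoid A] (c : ℝ) (Φ : MIdx d → MIdx d → A) :
    ∑ k ∈ below c, ∑ m ∈ below (c - sdeg k), Φ k m =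
      ∑ k ∈ below c, ∑ l ∈ Fintype.piFinset fun j => Finset.range (k j + 1), Φ l (k - l) := by
  rw [Finset.sum_sigma', Finset.sum_sigma']
  refine Finset.sum_bij' (fun p _ => ⟨p.1 + p.2, p.1⟩) (fun p _ => ⟨p.2, p.1 - p.2⟩) ?_ ?_ ?_ ?_ ?_
  · rintro ⟨k, m⟩ h
    simp only [Finset.mem_sigma, mem_below, Fintype.mem_piFinset, Finset.mem_range, sdeg_add,
      Pi.add_apply, Nat.cast_add] at h ⊢
    exact ⟨by linarith, fun j => by omega⟩
  · rintro ⟨k, l⟩ h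
    simp only [Finset.mem_sigma, mem_below, Fintype.mem_piFinset, Finset.mem_range] at h ⊢
    have hk : l + (k - l) = k := by
      funext j
      have := h.2 j
      simp only [Pi.add_apply, Pi.sub_apply]
      omega
    have h1 : (sdeg k : ℝ) = sdeg l + sdeg (k - l) := by
      rw [← Nat.cast_add, ← sdeg_add, hk]
    have h2 : (0 : ℝ) ≤ sdeg (k - l) := Nat.cast_nonneg _
    constructor <;> linarith
  · rintro ⟨k, m⟩ h
    simp
  · rintro ⟨k, l⟩ h
    simp only [Finset.mem_sigma, mem_below, Fintype.mem_piFinset, Finset.mem_range] at h ⊢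
    have hk : l + (k - l) = k := by
      funext j
      have := h.2 j
      simp only [Pi.add_apply, Pi.sub_apply]
      omega
    rw [hk]
  · rintro ⟨k, m⟩ h
    simp

/-- The multinomial formula survives truncation by total degree when the coefficients depend on `k +
m` only. It turns the double sums over `ℓ, m` in `Δ_i` into single Taylor jets. -/
theorem sum_below_mp_add {A : Type*} [CommRing A] [Algebra ℝ A] (v w : Fin (d + 1) → A) (c : ℝ)
    (Φ : MIdx d → ℝ) :
    ∑ k ∈ below c, ∑ m ∈ below (c - sdeg k),
      ((mfact k : ℝ)⁻¹ * ((mfact m : ℝ)⁻¹ * Φ (k + m))) • (mp v k * mp w m) =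
      ∑ k ∈ below c, ((mfact k : ℝ)⁻¹ * Φ k) • mp (fun j => v j + w j) k := by
  rw [sum_below_below]
  refine Finset.sum_congr rfl fun k _ => ?_
  rw [mul_comm, mul_smul, ← mp_add, Finset.smul_sum]
  refine Finset.sum_congr rfl fun l hl => ?_
  have hk : l + (k - l) = k := by
    funext j
    have := Finset.mem_range.1 (Fintype.mem_piFinset.1 hl j)
    simp only [Pi.add_apply, Pi.sub_apply]
    omega
  rw [hk, smul_smul]
  congr 1
  ring

/-! ## Polynomials and degrees in `𝒯` -/

theorem one_mem_treeSpan {S : Set (T d)} (h : ∀ h, (⟨1, h⟩ : T d) ∈ S) :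
    (1 : TSpace d) ∈ treeSpan S := by
  rw [← ofTree_one]; exact ofTree_mem_treeSpan h

/-- The span of the `X^k`. -/
def polys (d : ℕ) : Subalgebra ℝ (TSpace d) :=
  (treeSpan {u : T d | ∃ k, (u : DTree d) = DTree.root k 0 0}).toSubalgebra
    (one_mem_treeSpan fun _ => ⟨0, rfl⟩) fun _ _ h h' => treeSpan_mul (by
      rintro s ⟨k, hk⟩ t ⟨l, hl⟩
      refine ⟨k + l, ?_⟩
      rw [Submonoid.coe_mul, hk, hl, DTree.root_mul_root]) h h'

theorem mem_polys {σ : TSpace d} :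
    σ ∈ polys d ↔ σ ∈ treeSpan {u : T d | ∃ k, (u : DTree d) = DTree.root k 0 0} := Iff.rfl

theorem X_mem_polys (k : MIdx d) : X k ∈ polys d := ofTree_mem_treeSpan fun _ => ⟨k, rfl⟩

theorem mp_mem_polys {v : Fin (d + 1) → TSpace d} (h : ∀ j, v j ∈ polys d) (k : MIdx d) :
    mp v k ∈ polys d := prod_mem fun j _ => pow_mem (h j) _

theorem polys_le {M : Submodule ℝ (TSpace d)} (h : ∀ k, X k ∈ M) {σ : TSpace d}
    (hσ : σ ∈ polys d) : σ ∈ M := by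
  refine treeSpan_induction (mem_polys.1 hσ) ?_
  rintro u ⟨k, hk⟩
  rw [hk]; exact h k

theorem I_of_mem_polys (a : MIdx d) {σ : TSpace d} (hσ : σ ∈ polys d) : I a σ = 0 :=
  polys_le (M := LinearMap.ker (I a)) (fun k => I_X a k) hσ

/-- The tuple `X_j + e_j`. -/
def shiftX (e : Fin (d + 1) → ℝ) : Fin (d + 1) → TSpace d :=
  fun j => X (Pi.single j 1) + algebraMap ℝ _ (e j)

theorem shiftX_mem_polys (e : Fin (d + 1) → ℝ) (j : Fin (d + 1)) : shiftX e j ∈ polys d :=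
  add_mem (X_mem_polys _) (algebraMap_mem _ _)

variable (α : ℝ) (i : Fin 2)

/-- The span of the trees `u` with `deg_i(u) ≤ m`. -/
def degLE (d : ℕ) (α : ℝ) (i : Fin 2) (m : ℝ) : Submodule ℝ (TSpace d) :=
  treeSpan {u : T d | (u : DTree d).deg α i ≤ m}

theorem degLE_mono {m m' : ℝ} (h : m ≤ m') : degLE d α i m ≤ degLE d α i m' :=
  treeSpan_mono fun _ hu => le_trans hu h

theorem ofTree_mem_degLE {t : DTree d} {m : ℝ} (h : t.deg α i ≤ m) :
    ofTree t ∈ degLE d α i m := ofTree_mem_treeSpan fun _ => h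

theorem degLE_mul {m m' : ℝ} {σ τ : TSpace d} (hσ : σ ∈ degLE d α i m)
    (hτ : τ ∈ degLE d α i m') : σ * τ ∈ degLE d α i (m + m') :=
  treeSpan_mul (fun s hs t ht => by
    simp only [Set.mem_ofPred_eq, Submonoid.coe_mul, DTree.deg_mul] at hs ht ⊢
    linarith) hσ hτ

theorem degLE_I (a : MIdx d) {m : ℝ} {σ : TSpace d} (hσ : σ ∈ degLE d α i m) :
    I a σ ∈ degLE d α i (m + 2 - sdeg a) :=
  treeSpan_I a (fun s hs _ => by
    simp only [Set.mem_ofPred_eq, DTree.deg_planted] at hs ⊢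
    linarith) hσ

theorem X_mem_degLE (k : MIdx d) : X k ∈ degLE d α i (sdeg k) :=
  ofTree_mem_degLE _ _ (by rw [DTree.deg_root]; simp)

theorem sdeg_single (j : Fin (d + 1)) : sdeg (Pi.single j 1 : MIdx d) = scal j := by
  simp [sdeg, Pi.single_apply]

theorem shiftX_mem_degLE (e : Fin (d + 1) → ℝ) (j : Fin (d + 1)) :
    shiftX e j ∈ degLE d α i (scal j) := by
  refine add_mem ?_ ?_
  · have := X_mem_degLE α i (Pi.single j 1 : MIdx d)
    rwa [sdeg_single] at this
  · rw [Algebra.algebraMap_eq_smul_one]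
    refine Submodule.smul_mem _ _ (degLE_mono α i (Nat.cast_nonneg _) ?_)
    have := X_mem_degLE α i (0 : MIdx d)
    rw [X_zero] at this
    simpa [sdeg] using this

theorem mp_mem_degLE {v : Fin (d + 1) → TSpace d} (h : ∀ j, v j ∈ degLE d α i (scal j))
    (k : MIdx d) : mp v k ∈ degLE d α i (sdeg k) := by
  have h1 : (1 : TSpace d) ∈ degLE d α i 0 := by
    have := X_mem_degLE α i (0 : MIdx d)
    rw [X_zero] at this
    simpa [sdeg] using this
  have hp : ∀ j (n : ℕ), v j ^ n ∈ degLE d α i (scal j * n) := by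
    intro j n
    induction n with
    | zero => simpa using h1
    | succ n ih =>
      rw [pow_succ]
      have := degLE_mul α i ih (h j)
      push_cast
      rwa [mul_add, mul_one]
  have hs : ∀ S : Finset (Fin (d + 1)), ∏ j ∈ S, v j ^ k j ∈
      degLE d α i (∑ j ∈ S, (scal j * k j : ℝ)) := by
    intro S
    classical
    induction S using Finset.induction_on with
    | empty => simpa using h1
    | insert j S hj ih =>
      rw [Finset.prod_insert hj, Finset.sum_insert hj]
      exact degLE_mul α i (hp j _) ih
  have := hs Finset.univ
  rw [mp, sdeg]
  push_cast
  exact this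

/-! ## Taylor jets -/

theorem plusI_ofTree (a : MIdx d) (t : DTree d) : plusI α i a (ofTree t) = plusITree α i a t := by
  by_cases ht : t ∈ admissible d
  · exact linExt_ofTree _ ht
  · have : ¬ (DTree.planted a t ∈ admissible d ∧ 0 < (DTree.planted a t).deg α i) :=
      fun h => ht (planted_mem_admissible.1 h.1).1
    rw [ofTree_of_not_mem ht, map_zero, plusITree, dif_neg this]

theorem plusI_X (a k : MIdx d) : plusI α i a (X k) = 0 := by
  rw [X, plusI_ofTree, plusITree, dif_neg]
  rintro ⟨h, -⟩
  exact (planted_mem_admissible.1 h).2 k rfl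

theorem plusI_of_mem_polys (a : MIdx d) {σ : TSpace d} (hσ : σ ∈ polys d) : plusI α i a σ = 0 :=
  polys_le (M := LinearMap.ker (plusI α i a)) (fun k => plusI_X α i a k) hσ

theorem plusI_of_degLE {a : MIdx d} {m : ℝ} {σ : TSpace d} (hσ : σ ∈ degLE d α i m)
    (h : m + 2 - sdeg a ≤ 0) : plusI α i a σ = 0 := by
  refine treeSpan_induction (M := LinearMap.ker (plusI α i a)) hσ fun u hu => ?_
  rw [LinearMap.mem_ker, plusI_ofTree, plusITree, dif_neg]
  rintro ⟨-, h'⟩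
  rw [DTree.deg_planted] at h'
  simp only [Set.mem_ofPred_eq] at hu
  linarith

variable {α i} {A : Type*} [CommRing A] [Algebra ℝ A]

/-- The jet `∑_{|k|_𝔰 < c} v^k / k! f(𝓘^{+,i}_{a+k}(σ))`. -/
def tay (f : TPlus d α i →ₐ[ℝ] ℝ) (v : Fin (d + 1) → A) (a : MIdx d) (c : ℝ) :
    TSpace d →ₗ[ℝ] A :=
  ∑ k ∈ below c, ((mfact k : ℝ)⁻¹ • (f.toLinearMap ∘ₗ plusI α i (a + k))).smulRight (mp v k)

theorem tay_apply (f : TPlus d α i →ₐ[ℝ] ℝ) (v : Fin (d + 1) → A) (a : MIdx d) (c : ℝ)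
    (σ : TSpace d) : tay f v a c σ =
      ∑ k ∈ below c, ((mfact k : ℝ)⁻¹ * f (plusI α i (a + k) σ)) • mp v k := by
  simp [tay]

theorem map_tay {B : Type*} [CommRing B] [Algebra ℝ B] (Φ : A →ₐ[ℝ] B) (f : TPlus d α i →ₐ[ℝ] ℝ)
    (v : Fin (d + 1) → A) (a : MIdx d) (c : ℝ) (σ : TSpace d) :
    Φ (tay f v a c σ) = tay f (fun j => Φ (v j)) a c σ := by
  simp [tay_apply, map_sum, mp_map]

/-- Terms beyond the degree of the planted trees vanish because `𝓘^{+,i}_{a+k}` does. So the cutoff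
may be any large enough `c`, and one cutoff serves a whole linear combination of trees of different
degrees. -/
theorem tay_congr (f : TPlus d α i →ₐ[ℝ] ℝ) (v : Fin (d + 1) → A) (a : MIdx d) {c c' m : ℝ}
    {σ : TSpace d} (hσ : σ ∈ degLE d α i m) (h : m + 2 - sdeg a ≤ c) (h' : m + 2 - sdeg a ≤ c') :
    tay f v a c σ = tay f v a c' σ := by
  wlog hc : c ≤ c' generalizing c c'
  · exact (this h' h (le_of_not_ge hc)).symm
  rw [tay_apply, tay_apply]
  refine Finset.sum_subset (fun k hk => ?_) fun k _ hk => ?_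
  · rw [mem_below] at hk ⊢; exact hk.trans_le hc
  · rw [mem_below, not_lt] at hk
    rw [plusI_of_degLE α i hσ, map_zero, mul_zero, zero_smul]
    rw [sdeg_add, Nat.cast_add]
    linarith

theorem tay_mem_polys (f : TPlus d α i →ₐ[ℝ] ℝ) {v : Fin (d + 1) → TSpace d}
    (h : ∀ j, v j ∈ polys d) (a : MIdx d) (c : ℝ) (σ : TSpace d) : tay f v a c σ ∈ polys d := by
  rw [tay_apply]
  exact sum_mem fun k _ => Subalgebra.smul_mem _ (mp_mem_polys h k) _

theorem tay_mem_degLE (f : TPlus d α i →ₐ[ℝ] ℝ) (e : Fin (d + 1) → ℝ) (a : MIdx d) (c : ℝ)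
    (σ : TSpace d) : tay f (shiftX e) a c σ ∈ degLE d α i c := by
  rw [tay_apply]
  exact sum_mem fun k hk => Submodule.smul_mem _ _
    (degLE_mono α i (mem_below.1 hk).le (mp_mem_degLE α i (shiftX_mem_degLE α i e) k))

/-- Shift of the base point of a jet. -/
theorem tay_shift (f : TPlus d α i →ₐ[ℝ] ℝ) (v : Fin (d + 1) → A) (w : Fin (d + 1) → ℝ)
    (a : MIdx d) (c : ℝ) (σ : TSpace d) :
    ∑ k ∈ below c, ((mfact k : ℝ)⁻¹ * tay f w (a + k) (c - sdeg k) σ) • mp v k =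
      tay f (fun j => v j + algebraMap ℝ A (w j)) a c σ := by
  rw [tay_apply, ← sum_below_mp_add]
  refine Finset.sum_congr rfl fun k _ => ?_
  rw [tay_apply, Finset.mul_sum, Finset.sum_smul]
  refine Finset.sum_congr rfl fun m _ => ?_
  rw [← mp_map, mul_comm (mp v k), ← Algebra.smul_def, smul_smul, add_assoc, smul_eq_mul]
  congr 1
  ring

/-! ## The action of characters -/

theorem act_mem_polys_X (f : TPlus d α i →ₐ[ℝ] ℝ) (j : Fin (d + 1)) :
    act f (X (Pi.single j 1)) = shiftX (fun j => f (plusX α i j)) j := by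
  rw [X, act_ofTree f (root_mem _ _ _), coactTree, DTree.fold_root, evalRight_eq]
  simp only [pow_zero, mul_one, AlgHom.toLinearMap_apply, map_prod, map_pow, map_add,
    evalRightAlg_tmul, map_one, one_smul]
  rw [Finset.prod_eq_single j (fun k _ hk => by simp [hk]) (by simp)]
  simp [shiftX, Algebra.algebraMap_eq_smul_one]

theorem act_X (f : TPlus d α i →ₐ[ℝ] ℝ) (k : MIdx d) :
    act f (X k) = mp (shiftX fun j => f (plusX α i j)) k := by
  rw [X_eq_mp, mp_map]
  simp only [act_mem_polys_X]

theorem act_Xi (f : TPlus d α i →ₐ[ℝ] ℝ) : act f Xi = Xi := by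
  rw [Xi, act_ofTree f (root_mem _ _ _), coactTree, DTree.fold_root]
  simp [evalRight_tmul, Xi]

theorem act_dXi (f : TPlus d α i →ₐ[ℝ] ℝ) : act f dXi = dXi := by
  rw [dXi, act_ofTree f (root_mem _ _ _), coactTree, DTree.fold_root]
  simp [evalRight_tmul, dXi]

theorem act_mem_polys (f : TPlus d α i →ₐ[ℝ] ℝ) {σ : TSpace d} (hσ : σ ∈ polys d) :
    act f σ ∈ polys d :=
  polys_le (M := (polys d).toSubmodule.comap (act f).toLinearMap) (fun k => by
    rw [Submodule.mem_comap, AlgHom.toLinearMap_apply, act_X]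
    exact mp_mem_polys (shiftX_mem_polys _) k) hσ

theorem evalRight_map_id (f : TPlus d α i →ₐ[ℝ] ℝ) (Φ : TSpace d →ₗ[ℝ] TSpace d)
    (z : TSpace d ⊗[ℝ] TPlus d α i) :
    evalRight f (TensorProduct.map Φ LinearMap.id z) = Φ (evalRight f z) := by
  induction z with
  | zero => simp
  | add x y hx hy => simp only [map_add, hx, hy]
  | tmul σ q => rw [TensorProduct.map_tmul, evalRight_tmul, evalRight_tmul, map_smul]; rfl

theorem map_plusXpow (f : TPlus d α i →ₐ[ℝ] ℝ) (k : MIdx d) :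
    f (plusXpow α i k) = mp (fun j => f (plusX α i j)) k := by
  rw [← mp_map]; rfl

/-- The double sum in `Δ_i 𝓘_a(s)` is a jet based at `f(X)` re-expanded in powers of `X`;
`tay_shift` collapses it to one jet in the variables `X_j + f(X_j)`. -/
theorem act_planted (f : TPlus d α i →ₐ[ℝ] ℝ) (a : MIdx d) {s : DTree d}
    (h : DTree.planted a s ∈ admissible d) :
    act f (I a (ofTree s)) = I a (act f (ofTree s)) +
      tay f (shiftX fun j => f (plusX α i j)) a ((DTree.planted a s).deg α i) (ofTree s) := by
  have hs := (planted_mem_admissible.1 h).1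
  rw [I_ofTree, act_ofTree f h, act_ofTree f hs, coactTree, DTree.fold_planted, map_add,
    evalRight_map_id]
  congr 1
  refine Eq.trans ?_ (tay_shift f _ _ a _ _)
  rw [map_sum]
  refine Finset.sum_congr rfl fun k _ => ?_
  rw [map_sum, tay_apply, Finset.mul_sum, Finset.sum_smul]
  refine Finset.sum_congr rfl fun m _ => ?_
  rw [evalRight_tmul, map_smul, map_mul, map_plusXpow, ← X_eq_mp, plusI_ofTree, smul_smul]
  simp only [smul_eq_mul]
  congr 1
  ring

/-- The jet added to `𝓘_a(s)` is cut off below the degree of `𝓘_a(s)`, so no tree of higher degree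
is created. This keeps cutoffs valid after characters have acted. -/
theorem act_mem_degLE (f : TPlus d α i →ₐ[ℝ] ℝ) {m : ℝ} {σ : TSpace d}
    (hσ : σ ∈ degLE d α i m) : act f σ ∈ degLE d α i m := by
  have key : ∀ t : DTree d, t ∈ admissible d → act f (ofTree t) ∈ degLE d α i (t.deg α i) := by
    intro t
    induction t using DTree.generate with
    | one =>
      intro _
      rw [ofTree_one, map_one, ← ofTree_one]
      exact ofTree_mem_degLE α i le_rfl
    | hX j =>
      intro _
      have := act_mem_polys_X f j
      rw [X] at this
      rw [this, DTree.deg_root, sdeg_single]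
      simpa using shiftX_mem_degLE α i _ j
    | hXi =>
      intro _
      have := act_Xi f
      rw [Xi] at this
      rw [this]
      exact ofTree_mem_degLE α i le_rfl
    | hdXi =>
      intro _
      have := act_dXi f
      rw [dXi] at this
      rw [this]
      exact ofTree_mem_degLE α i le_rfl
    | mul s t hs ht =>
      intro h
      rw [mul_mem_admissible] at h
      rw [ofTree_mul, map_mul, DTree.deg_mul]
      exact degLE_mul α i (hs h.1) (ht h.2)
    | planted a s hs =>
      intro h
      rw [← I_ofTree, act_planted f a h]
      refine add_mem ?_ (tay_mem_degLE f _ _ _ _)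
      rw [DTree.deg_planted]
      exact degLE_I α i a (hs (planted_mem_admissible.1 h).1)
  refine treeSpan_induction (M := (degLE d α i m).comap (act f).toLinearMap) hσ fun u hu => ?_
  rw [Submodule.mem_comap]
  exact degLE_mono α i hu (key u u.2)

/-- The formula for planted trees becomes linear in `σ` thanks to the common cutoff. Monomials, for
which `𝓘_a` vanishes, need a separate word: the action sends polynomials to polynomials, so every
term is zero. -/
theorem act_I (f : TPlus d α i →ₐ[ℝ] ℝ) (a : MIdx d) {m c : ℝ} {σ : TSpace d}
    (hσ : σ ∈ degLE d α i m) (hc : m + 2 - sdeg a ≤ c) :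
    act f (I a σ) = I a (act f σ) + tay f (shiftX fun j => f (plusX α i j)) a c σ := by
  refine treeSpan_induction (M := LinearMap.eqLocus ((act f).toLinearMap ∘ₗ I a)
    (I a ∘ₗ (act f).toLinearMap + tay f (shiftX fun j => f (plusX α i j)) a c)) hσ fun u hu => ?_
  change act f (I a (ofTree (u : DTree d))) = I a (act f (ofTree (u : DTree d))) +
    tay f (shiftX fun j => f (plusX α i j)) a c (ofTree (u : DTree d))
  simp only [Set.mem_ofPred_eq] at hu
  by_cases h : DTree.planted a (u : DTree d) ∈ admissible d
  · rw [act_planted f a h]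
    congr 1
    refine tay_congr f _ a (ofTree_mem_degLE α i le_rfl) ?_ ?_
    · rw [DTree.deg_planted]
    · linarith
  · rw [planted_mem_admissible] at h
    push Not at h
    obtain ⟨k, hk⟩ := h u.2
    rw [hk]
    change act f (I a (X k)) = I a (act f (X k)) + tay f (shiftX fun j => f (plusX α i j)) a c (X k)
    rw [I_X, I_of_mem_polys a (act_mem_polys f (X_mem_polys k)), map_zero, zero_add, tay_apply]
    simp only [plusI_X, map_zero, mul_zero, zero_smul, Finset.sum_const_zero]

/-! ### Antipode and convolution of characters -/

theorem map_mul'_evalRight (f : TPlus d α i →ₐ[ℝ] ℝ) (Φ : TSpace d →ₗ[ℝ] TPlus d α i)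
    (q : TPlus d α i) (z : TSpace d ⊗[ℝ] TPlus d α i) :
    f (LinearMap.mul' ℝ (TPlus d α i) (TensorProduct.map Φ (LinearMap.mulLeft ℝ q) z)) =
      f q * f (Φ (evalRight f z)) := by
  induction z with
  | zero => simp
  | add x y hx hy => simp only [map_add, hx, hy, mul_add]
  | tmul σ r =>
    rw [TensorProduct.map_tmul, LinearMap.mul'_apply, evalRight_tmul, LinearMap.mulLeft_apply,
      map_mul, map_mul, map_smul, map_smul, smul_eq_mul]
    ring

theorem evalRight_map_antipode (f : TPlus d α i →ₐ[ℝ] ℝ) (z : TSpace d ⊗[ℝ] TPlus d α i) :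
    evalRight f (TensorProduct.map LinearMap.id (antipodePlus α i).toLinearMap z) =
      evalRight (f.comp (antipodePlus α i)) z := by
  induction z with
  | zero => simp
  | add x y hx hy => simp only [map_add, hx, hy]
  | tmul σ q => rw [TensorProduct.map_tmul, evalRight_tmul, evalRight_tmul]; rfl

theorem antipode_plusX (f : TPlus d α i →ₐ[ℝ] ℝ) (j : Fin (d + 1)) :
    f.comp (antipodePlus α i) (plusX α i j) = -f (plusX α i j) := by
  rw [AlgHom.comp_apply, antipodePlus, plusX, MvPolynomial.aeval_X, Sum.elim_inl, map_neg]
  rfl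

/-- For a linear functional of `𝒯` given by a formula for the trees with positive degree. -/
theorem map_plusI_eq (g : TPlus d α i →ₐ[ℝ] ℝ) (b : MIdx d) {m : ℝ} {σ : TSpace d}
    (hσ : σ ∈ degLE d α i m) (L : TSpace d →ₗ[ℝ] ℝ)
    (hX : ∀ k, L (X k) = 0)
    (hneg : ∀ u : DTree d, u.deg α i ≤ m → (DTree.planted b u).deg α i ≤ 0 → L (ofTree u) = 0)
    (hpos : ∀ u : DTree d, u.deg α i ≤ m → DTree.planted b u ∈ admissible d →
      0 < (DTree.planted b u).deg α i → g (plusITree α i b u) = L (ofTree u)) :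
    g (plusI α i b σ) = L σ := by
  refine treeSpan_induction (M := LinearMap.eqLocus (g.toLinearMap ∘ₗ plusI α i b) L) hσ
    fun u hu => ?_
  change g (plusI α i b (ofTree (u : DTree d))) = L (ofTree (u : DTree d))
  by_cases h : DTree.planted b (u : DTree d) ∈ admissible d
  · by_cases h' : 0 < (DTree.planted b (u : DTree d)).deg α i
    · rw [plusI_ofTree]; exact hpos u hu h h'
    · rw [plusI_ofTree, plusITree, dif_neg (fun h => h' h.2), map_zero, hneg u hu (not_lt.1 h')]
  · rw [planted_mem_admissible] at h
    push Not at h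
    obtain ⟨k, hk⟩ := h u.2
    rw [hk]
    change g (plusI α i b (X k)) = L (X k)
    rw [plusI_X, map_zero, hX]

/-- For planted trees of positive degree this is the recursive definition of `𝒜_i^+` evaluated at
`f`. In the other cases both sides vanish, since the action neither raises degrees nor leaves the
polynomials. -/
theorem antipode_plusI (f : TPlus d α i →ₐ[ℝ] ℝ) (b : MIdx d) {m c : ℝ} {σ : TSpace d}
    (hσ : σ ∈ degLE d α i m) (hc : m + 2 - sdeg b ≤ c) :
    f.comp (antipodePlus α i) (plusI α i b σ) =
      -tay f (fun j => f (plusX α i j)) b c (act (f.comp (antipodePlus α i)) σ) := by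
  refine map_plusI_eq (f.comp (antipodePlus α i)) b hσ
    (-(tay f (fun j => f (plusX α i j)) b c ∘ₗ (act (f.comp (antipodePlus α i))).toLinearMap))
    (fun k => ?_) (fun u _ h => ?_) (fun u hu h h' => ?_)
  · simp only [LinearMap.neg_apply, LinearMap.comp_apply, AlgHom.toLinearMap_apply, tay_apply,
      plusI_of_mem_polys α i _ (act_mem_polys _ (X_mem_polys k))]
    simp
  · simp only [LinearMap.neg_apply, LinearMap.comp_apply, AlgHom.toLinearMap_apply, tay_apply]
    rw [neg_eq_zero]
    refine Finset.sum_eq_zero fun k _ => ?_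
    rw [plusI_of_degLE α i (act_mem_degLE _ (ofTree_mem_degLE α i le_rfl)), map_zero, mul_zero,
      zero_smul]
    rw [DTree.deg_planted] at h
    rw [sdeg_add, Nat.cast_add]
    have := Nat.cast_nonneg (α := ℝ) (sdeg k)
    linarith
  · have hu' := (planted_mem_admissible.1 h).1
    rw [AlgHom.comp_apply, antipodePlus_plusITree, antipodeStep, if_pos ⟨h, h'⟩, antipodeCoact_eq]
    rw [LinearMap.neg_apply, LinearMap.comp_apply, AlgHom.toLinearMap_apply,
      tay_congr f _ b (c' := (DTree.planted b u).deg α i)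
        (act_mem_degLE _ (ofTree_mem_degLE α i le_rfl)) (by linarith) (by rw [DTree.deg_planted]),
      tay_apply, map_neg, map_sum, act_ofTree _ hu']
    congr 1
    refine Finset.sum_congr rfl fun k _ => ?_
    rw [map_mul'_evalRight, evalRight_map_antipode, map_smul, map_plusXpow]
    simp only [smul_eq_mul]
    ring

/-- Each coefficient of the jet of `f 𝒜_i^+` is itself minus a jet of `f` based at `f(X)`; resumming
moves the base point. This is the cancellation behind both inverse relations and behind `bold_I`. -/
theorem tay_antipode (f : TPlus d α i →ₐ[ℝ] ℝ) (v : Fin (d + 1) → A) (a : MIdx d) {m c : ℝ}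
    {σ : TSpace d} (hσ : σ ∈ degLE d α i m) (hc : m + 2 - sdeg a ≤ c) :
    tay (f.comp (antipodePlus α i)) v a c σ =
      -tay f (fun j => v j + algebraMap ℝ A (f (plusX α i j))) a c
        (act (f.comp (antipodePlus α i)) σ) := by
  rw [← tay_shift, tay_apply, ← Finset.sum_neg_distrib]
  refine Finset.sum_congr rfl fun k _ => ?_
  rw [antipode_plusI f (a + k) (c := c - sdeg k) hσ, mul_neg, neg_smul]
  rw [sdeg_add, Nat.cast_add]
  linarith

theorem act_shiftX (f : TPlus d α i →ₐ[ℝ] ℝ) (e : Fin (d + 1) → ℝ) (j : Fin (d + 1)) :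
    act f (shiftX e j) = shiftX (fun j => f (plusX α i j) + e j) j := by
  rw [shiftX, map_add, act_mem_polys_X, AlgHom.commutes, shiftX, shiftX, map_add, add_assoc]

/-- Two algebra endomorphisms agree if they agree on `X_j`, `Ξ`, `Ξ̇` and if agreement passes to
planted trees. -/
theorem eq_of_generate {A : Type*} [CommRing A] [Algebra ℝ A] (Φ Ψ : TSpace d →ₐ[ℝ] A)
    (hX : ∀ j, Φ (X (Pi.single j 1)) = Ψ (X (Pi.single j 1))) (hXi : Φ Xi = Ψ Xi)
    (hdXi : Φ dXi = Ψ dXi)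
    (hI : ∀ a (s : DTree d), DTree.planted a s ∈ admissible d → Φ (ofTree s) = Ψ (ofTree s) →
      Φ (I a (ofTree s)) = Ψ (I a (ofTree s))) : Φ = Ψ := by
  have key : ∀ t : DTree d, t ∈ admissible d → Φ (ofTree t) = Ψ (ofTree t) := by
    intro t
    induction t using DTree.generate with
    | one => intro _; rw [ofTree_one, map_one, map_one]
    | hX j => exact fun _ => hX j
    | hXi => exact fun _ => hXi
    | hdXi => exact fun _ => hdXi
    | mul s t hs ht =>
      intro h
      rw [mul_mem_admissible] at h
      rw [ofTree_mul, map_mul, map_mul, hs h.1, ht h.2]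
    | planted a s hs =>
      intro h
      rw [← I_ofTree]
      exact hI a s h (hs (planted_mem_admissible.1 h).1)
  exact AlgHom.ext fun σ =>
    mem_of_ofTree_mem (M := LinearMap.eqLocus Φ.toLinearMap Ψ.toLinearMap) key σ

/-- On a planted tree two jets appear, one from each action. By `tay_antipode` they are opposite,
once `X_j` has been shifted forth and back. -/
theorem act_act_antipode (f : TPlus d α i →ₐ[ℝ] ℝ) (σ : TSpace d) :
    act f (act (f.comp (antipodePlus α i)) σ) = σ := by
  suffices (act f).comp (act (f.comp (antipodePlus α i))) = AlgHom.id ℝ _ from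
    DFunLike.congr_fun this σ
  refine eq_of_generate _ _ (fun j => ?_) ?_ ?_ fun a s h ih => ?_
  · rw [AlgHom.comp_apply, act_mem_polys_X, act_shiftX]
    simp [antipode_plusX, shiftX]
  · simp [act_Xi]
  · simp [act_dXi]
  · simp only [AlgHom.comp_apply, AlgHom.id_apply] at ih ⊢
    have hd : ofTree s ∈ degLE d α i (s.deg α i) := ofTree_mem_degLE α i le_rfl
    rw [act_I _ a hd le_rfl, map_add, act_I f a (act_mem_degLE _ hd) le_rfl, ih, map_tay,
      tay_antipode f _ a hd le_rfl, add_assoc, add_eq_left, add_neg_eq_zero]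
    congr 2
    funext j
    rw [act_shiftX]
    simp [antipode_plusX, shiftX]

theorem act_antipode_act (f : TPlus d α i →ₐ[ℝ] ℝ) (σ : TSpace d) :
    act (f.comp (antipodePlus α i)) (act f σ) = σ := by
  suffices (act (f.comp (antipodePlus α i))).comp (act f) = AlgHom.id ℝ _ from
    DFunLike.congr_fun this σ
  refine eq_of_generate _ _ (fun j => ?_) ?_ ?_ fun a s h ih => ?_
  · rw [AlgHom.comp_apply, act_mem_polys_X, act_shiftX]
    simp [antipode_plusX, shiftX]
  · simp [act_Xi]
  · simp [act_dXi]
  · simp only [AlgHom.comp_apply, AlgHom.id_apply] at ih ⊢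
    have hd : ofTree s ∈ degLE d α i (s.deg α i) := ofTree_mem_degLE α i le_rfl
    rw [act_I _ a hd le_rfl, map_add, act_I _ a (act_mem_degLE _ hd) le_rfl, ih, map_tay,
      tay_antipode f _ a (act_mem_degLE _ hd) le_rfl, ih, add_assoc, add_eq_left, neg_add_eq_zero]
    congr 2
    funext j
    rw [act_shiftX]
    simp [antipode_plusX, shiftX, add_assoc]

/-- The convolution `(g ⊗ h) Δ_i^+` of two characters. -/
def charConv (g h : TPlus d α i →ₐ[ℝ] ℝ) : TPlus d α i →ₐ[ℝ] ℝ :=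
  (Algebra.TensorProduct.lmul' ℝ (S := ℝ)).comp
    ((Algebra.TensorProduct.map g h).comp (coprodPlus α i))

theorem charConv_plusX (g h : TPlus d α i →ₐ[ℝ] ℝ) (j : Fin (d + 1)) :
    charConv g h (plusX α i j) = g (plusX α i j) + h (plusX α i j) := by
  have : coprodPlus α i (plusX α i j) = plusX α i j ⊗ₜ 1 + 1 ⊗ₜ plusX α i j := by
    rw [coprodPlus, plusX, MvPolynomial.aeval_X, Sum.elim_inl]
    rfl
  simp [charConv, this]

theorem charConv_eval (g h : TPlus d α i →ₐ[ℝ] ℝ) (Φ : TSpace d →ₗ[ℝ] TPlus d α i)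
    (q : TPlus d α i) (z : TSpace d ⊗[ℝ] TPlus d α i) :
    Algebra.TensorProduct.lmul' ℝ (S := ℝ) (Algebra.TensorProduct.map g h
      (TensorProduct.map Φ (LinearMap.mulLeft ℝ q) z)) = h q * g (Φ (evalRight h z)) := by
  induction z with
  | zero => simp
  | add x y hx hy => simp only [map_add, hx, hy, mul_add]
  | tmul σ r =>
    rw [TensorProduct.map_tmul, Algebra.TensorProduct.map_tmul, Algebra.TensorProduct.lmul'_apply_tmul,
      evalRight_tmul, LinearMap.mulLeft_apply, map_mul, map_smul, map_smul, smul_eq_mul]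
    ring

theorem mp_neg (e : Fin (d + 1) → ℝ) (k : MIdx d) :
    mp (fun j => -e j) k = (-1) ^ (∑ j, k j) * mp e k := by
  simp only [mp, neg_pow (e _), Finset.prod_mul_distrib, Finset.prod_pow_eq_pow_sum]

/-- The factors `(-X)^ℓ/ℓ!` of `Δ_i^+` become a jet of `g` based at `-h(X)`, which is what undoes
the translation by `h` in `act_charConv`. -/
theorem charConv_plusI (g h : TPlus d α i →ₐ[ℝ] ℝ) (b : MIdx d) {m c : ℝ} {σ : TSpace d}
    (hσ : σ ∈ degLE d α i m) (hc : m + 2 - sdeg b ≤ c) :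
    charConv g h (plusI α i b σ) =
      tay g (fun j => -h (plusX α i j)) b c (act h σ) + h (plusI α i b σ) := by
  refine map_plusI_eq (charConv g h) b hσ
    (tay g (fun j => -h (plusX α i j)) b c ∘ₗ (act h).toLinearMap + h.toLinearMap ∘ₗ plusI α i b)
    (fun k => ?_) (fun u _ h' => ?_) (fun u hu h₁ h₂ => ?_)
  · simp only [LinearMap.add_apply, LinearMap.comp_apply, AlgHom.toLinearMap_apply, tay_apply,
      plusI_of_mem_polys α i _ (act_mem_polys _ (X_mem_polys k)), plusI_X]
    simp
  · rw [DTree.deg_planted] at h'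
    simp only [LinearMap.add_apply, LinearMap.comp_apply, AlgHom.toLinearMap_apply, tay_apply]
    rw [plusI_of_degLE α i (ofTree_mem_degLE α i (le_refl (u.deg α i))) h', map_zero, add_zero]
    refine Finset.sum_eq_zero fun k _ => ?_
    rw [plusI_of_degLE α i (act_mem_degLE _ (ofTree_mem_degLE α i le_rfl)), map_zero, mul_zero,
      zero_smul]
    rw [sdeg_add, Nat.cast_add]
    have := Nat.cast_nonneg (α := ℝ) (sdeg k)
    linarith
  · have hu' := (planted_mem_admissible.1 h₁).1
    rw [LinearMap.add_apply, LinearMap.comp_apply, LinearMap.comp_apply, AlgHom.toLinearMap_apply,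
      AlgHom.toLinearMap_apply, tay_congr g _ b (c' := (DTree.planted b u).deg α i)
        (act_mem_degLE _ (ofTree_mem_degLE α i le_rfl)) (by linarith) (by rw [DTree.deg_planted]),
      tay_apply, plusI_ofTree, act_ofTree _ hu']
    have : coprodPlus α i (plusITree α i b u) = (∑ l ∈ below ((DTree.planted b u).deg α i),
      TensorProduct.map (plusI α i (b + l))
        (LinearMap.mulLeft ℝ (((-1) ^ (∑ j, l j) * (mfact l : ℝ)⁻¹) • plusXpow α i l))
        (coactTree α i u)) + 1 ⊗ₜ plusITree α i b u := by
      conv_lhs => rw [plusITree, dif_pos ⟨h₁, h₂⟩]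
      rw [coprodPlus, MvPolynomial.aeval_X]
      rfl
    rw [charConv, AlgHom.comp_apply, AlgHom.comp_apply, this, map_add, map_add, map_sum, map_sum]
    congr 1
    · refine Finset.sum_congr rfl fun k _ => ?_
      rw [charConv_eval, map_smul, map_plusXpow, mp_neg]
      simp only [smul_eq_mul]
      ring
    · simp

/-- The jet of the convolution splits into a jet of `g` and one of `h`. The shift by `-h(X)` brings
the first to the variables `X_j + g(X_j)`, as produced by `act g`; the second is the image under
`act g` of the jet produced by `act h`. -/
theorem act_charConv (g h : TPlus d α i →ₐ[ℝ] ℝ) (σ : TSpace d) :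
    act (charConv g h) σ = act g (act h σ) := by
  suffices act (charConv g h) = (act g).comp (act h) from DFunLike.congr_fun this σ
  refine eq_of_generate _ _ (fun j => ?_) ?_ ?_ fun a s hs ih => ?_
  · rw [AlgHom.comp_apply, act_mem_polys_X, act_mem_polys_X, act_shiftX]
    simp [charConv_plusX, shiftX]
  · simp [act_Xi]
  · simp [act_dXi]
  · rw [AlgHom.comp_apply] at ih ⊢
    have hd : ofTree s ∈ degLE d α i (s.deg α i) := ofTree_mem_degLE α i le_rfl
    rw [act_I _ a hd le_rfl, ih, act_I h a hd le_rfl, map_add, act_I g a (act_mem_degLE _ hd) le_rfl,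
      map_tay, add_assoc]
    congr 1
    set c := s.deg α i + 2 - sdeg a
    have h1 : tay (charConv g h) (shiftX fun j => charConv g h (plusX α i j)) a c (ofTree s) =
        (∑ k ∈ below c, ((mfact k : ℝ)⁻¹ * tay g (fun j => -h (plusX α i j)) (a + k) (c - sdeg k)
          (act h (ofTree s))) • mp (shiftX fun j => charConv g h (plusX α i j)) k) +
        tay h (shiftX fun j => charConv g h (plusX α i j)) a c (ofTree s) := by
      rw [tay_apply, tay_apply, ← Finset.sum_add_distrib]
      refine Finset.sum_congr rfl fun k _ => ?_
      rw [charConv_plusI g h (a + k) (c := c - sdeg k) hd, mul_add, add_smul]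
      rw [sdeg_add, Nat.cast_add]
      simp only [c]
      linarith
    rw [h1, tay_shift]
    congr 2
    · congr 1
      funext j
      simp [shiftX, charConv_plusX, add_assoc]
    · congr 1
      funext j
      rw [act_shiftX]
      simp [shiftX, charConv_plusX]

end

section

variable {d : ℕ} {α : ℝ} {i : Fin 2}

/-! ## The action of characters through `Δ̂₁` -/

theorem hatAct_X_single (f : TPlus d α 1 →ₐ[ℝ] ℝ) (j : Fin (d + 1)) :
    hatAct f (X (Pi.single j 1)) = X (Pi.single j 1) := by
  conv_lhs => rw [X, hatAct_ofTree f (root_mem _ _ _), hatTree, DTree.fold_root, evalRight_eq]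
  simp only [pow_zero, mul_one, AlgHom.toLinearMap_apply, map_prod, map_pow,
    evalRightAlg_tmul, map_one, one_smul]
  rw [Finset.prod_eq_single j (fun k _ hk => by simp [hk]) (by simp)]
  simp

theorem hatAct_X (f : TPlus d α 1 →ₐ[ℝ] ℝ) (k : MIdx d) : hatAct f (X k) = X k := by
  rw [X_eq_mp, mp_map]
  simp only [hatAct_X_single]

theorem hatAct_Xi (f : TPlus d α 1 →ₐ[ℝ] ℝ) : hatAct f Xi = Xi := by
  rw [Xi, hatAct_ofTree f (root_mem _ _ _), hatTree, DTree.fold_root]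
  simp [evalRight_tmul, Xi]

theorem hatAct_dXi (f : TPlus d α 1 →ₐ[ℝ] ℝ) : hatAct f dXi = dXi := by
  rw [dXi, hatAct_ofTree f (root_mem _ _ _), hatTree, DTree.fold_root]
  simp [evalRight_tmul, dXi]

/-- The polynomial part of `(id ⊗ f) Δ̂₁ 𝓘_a(s)`. -/
def hatPoly (f : TPlus d α 1 →ₐ[ℝ] ℝ) (a : MIdx d) (s : DTree d) (σ : TSpace d) : TSpace d :=
  ∑ l ∈ (below ((DTree.planted a s).deg α 1)).filter
    fun l => (DTree.planted a s).deg α 0 ≤ sdeg l,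
      ((mfact l : ℝ)⁻¹ * f (plusI α 1 (a + l) σ)) • X l

theorem hatAct_planted (f : TPlus d α 1 →ₐ[ℝ] ℝ) (a : MIdx d) {s : DTree d}
    (h : DTree.planted a s ∈ admissible d) :
    hatAct f (I a (ofTree s)) = I a (hatAct f (ofTree s)) - hatPoly f a s (hatAct f (ofTree s)) := by
  have hs := (planted_mem_admissible.1 h).1
  rw [I_ofTree, hatAct_ofTree f h, hatAct_ofTree f hs, hatTree, DTree.fold_planted, map_sub,
    evalRight_map_id, map_sum]
  congr 1
  refine Finset.sum_congr rfl fun k _ => ?_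
  have := map_mul'_evalRight f (plusI α 1 (a + k)) 1 (hatTree α s)
  rw [LinearMap.mulLeft_one, map_one, one_mul] at this
  rw [evalRight_tmul, ← hatTree, this, smul_smul, mul_comm]

/-- The span of the trees `u` with `m₀ ≤ deg_1(u) ≤ m₁`. -/
def degBetween (d : ℕ) (α m₀ m₁ : ℝ) : Submodule ℝ (TSpace d) :=
  treeSpan {u : T d | m₀ ≤ (u : DTree d).deg α 1 ∧ (u : DTree d).deg α 1 ≤ m₁}

theorem degBetween_le_degLE {m₀ m₁ : ℝ} : degBetween d α m₀ m₁ ≤ degLE d α 1 m₁ :=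
  treeSpan_mono fun _ hu => hu.2

theorem DTree.deg_zero_le_deg_one (t : DTree d) : t.deg α 0 ≤ t.deg α 1 := by
  have hd : (0 : ℝ) ≤ ((d : ℝ) + 2) / 2 := by positivity
  induction t using DTree.generate with
  | one => simp [DTree.one_def, DTree.deg_root]
  | hX j => simp [DTree.deg_root]
  | hXi => simp [DTree.deg_root]
  | hdXi => simp [DTree.deg_root]; linarith
  | mul s t hs ht => rw [deg_mul, deg_mul]; linarith
  | planted a s hs => rw [deg_planted, deg_planted]; linarith

theorem DTree.deg_eq_of_dotless {t : DTree d} : t.dots = 0 → t.deg α 0 = t.deg α 1 := by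
  induction t using DTree.generate with
  | one => simp [DTree.one_def, DTree.deg_root]
  | hX j => simp [DTree.deg_root]
  | hXi => simp [DTree.deg_root]
  | hdXi => simp [DTree.dots_root]
  | mul s t hs ht =>
    rw [dots_mul, deg_mul, deg_mul]
    intro h
    rw [hs (by omega), ht (by omega)]
  | planted a s hs =>
    rw [dots_planted, deg_planted, deg_planted]
    intro h
    rw [hs h]

/-- The monomials subtracted by `Δ̂₁` have order between `deg_0` and `deg_1` of the planted tree.
The lower bound is the important one: for `|k|_𝔰 < deg_0(𝓘_a(s))` it makes `deg_1(𝓘_{a+k}(u))`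
positive for every tree `u` arising from `s`, so that `𝓘^{+,1}_{a+k}` discards nothing there. -/
theorem hatAct_mem_degBetween (f : TPlus d α 1 →ₐ[ℝ] ℝ) (t : DTree d) (ht : t ∈ admissible d) :
    hatAct f (ofTree t) ∈ degBetween d α (t.deg α 0) (t.deg α 1) := by
  have self : ∀ t : DTree d, ofTree t ∈ degBetween d α (t.deg α 0) (t.deg α 1) := fun t =>
    ofTree_mem_treeSpan fun _ => ⟨t.deg_zero_le_deg_one, le_rfl⟩
  induction t using DTree.generate with
  | one => rw [ofTree_one, map_one, ← ofTree_one]; exact self 1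
  | hX j =>
    have := hatAct_X_single f j
    rw [X] at this
    rw [this]; exact self _
  | hXi =>
    have := hatAct_Xi f
    rw [Xi] at this
    rw [this]; exact self _
  | hdXi =>
    have := hatAct_dXi f
    rw [dXi] at this
    rw [this]; exact self _
  | mul s t hs ht' =>
    rw [mul_mem_admissible] at ht
    rw [ofTree_mul, map_mul, DTree.deg_mul, DTree.deg_mul]
    refine treeSpan_mul (fun u hu v hv => ?_) (hs ht.1) (ht' ht.2)
    simp only [Set.mem_ofPred_eq, Submonoid.coe_mul, DTree.deg_mul] at hu hv ⊢
    constructor <;> linarith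
  | planted a s hs =>
    rw [← I_ofTree, hatAct_planted f a ht]
    refine sub_mem (treeSpan_I a (fun u hu _ => ?_) (hs (planted_mem_admissible.1 ht).1))
      (sum_mem fun k hk => Submodule.smul_mem _ _ ?_)
    · simp only [Set.mem_ofPred_eq, DTree.deg_planted] at hu ⊢
      constructor <;> linarith
    · rw [Finset.mem_filter, mem_below] at hk
      exact ofTree_mem_treeSpan fun _ => by
        simp only [Set.mem_ofPred_eq, DTree.deg_root]
        norm_num
        exact ⟨hk.2, hk.1.le⟩

/-- Without `Ξ̇` the two degrees coincide, and the range of the subtracted sum is empty. -/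
theorem hatAct_of_dotless (f : TPlus d α 1 →ₐ[ℝ] ℝ) {σ : TSpace d}
    (hσ : σ ∈ treeSpan (dotless d)) : hatAct f σ = σ := by
  have key : ∀ t : DTree d, t.dots = 0 → t ∈ admissible d → hatAct f (ofTree t) = ofTree t := by
    intro t
    induction t using DTree.generate with
    | one => intro _ _; rw [ofTree_one, map_one]
    | hX j => intro _ _; exact hatAct_X_single f j
    | hXi => intro _ _; exact hatAct_Xi f
    | hdXi => intro h; simp [DTree.dots_root] at h
    | mul s t hs ht =>
      intro h h'
      rw [DTree.dots_mul] at h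
      rw [mul_mem_admissible] at h'
      rw [ofTree_mul, map_mul, hs (by omega) h'.1, ht (by omega) h'.2]
    | planted a s hs =>
      intro h h'
      rw [← I_ofTree, hatAct_planted f a h', hs (by rwa [DTree.dots_planted] at h)
        (planted_mem_admissible.1 h').1, hatPoly, Finset.filter_false_of_mem, Finset.sum_empty,
        sub_zero]
      intro k hk
      rw [mem_below] at hk
      rw [DTree.deg_eq_of_dotless h]
      exact not_le.2 hk
  exact treeSpan_induction (M := LinearMap.eqLocus (hatAct f).toLinearMap LinearMap.id) hσ
    fun u hu => key u hu u.2

/-! ## The action of characters and `Ξ̇` -/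

theorem dotless_mul {σ τ : TSpace d} (hσ : σ ∈ treeSpan (dotless d))
    (hτ : τ ∈ treeSpan (dotless d)) : σ * τ ∈ treeSpan (dotless d) :=
  treeSpan_mul (fun s hs t ht => by
    simp only [Set.mem_ofPred_eq, Submonoid.coe_mul, DTree.dots_mul] at hs ht ⊢
    omega) hσ hτ

theorem dotless_I (a : MIdx d) {σ : TSpace d} (hσ : σ ∈ treeSpan (dotless d)) :
    I a σ ∈ treeSpan (dotless d) :=
  treeSpan_I a (fun s hs _ => by
    simp only [Set.mem_ofPred_eq, DTree.dots_planted] at hs ⊢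
    exact hs) hσ

theorem polys_dotless {σ : TSpace d} (hσ : σ ∈ polys d) : σ ∈ treeSpan (dotless d) :=
  polys_le X_mem_dotless hσ

theorem malliavinD_of_mem_polys {σ : TSpace d} (hσ : σ ∈ polys d) : malliavinD σ = 0 :=
  polys_le (M := LinearMap.ker malliavinD) malliavinD_X hσ

/-- An algebra endomorphism of `𝒯` that commutes with the `𝓘_a` up to polynomials, and acts on
polynomials, `Ξ` and `Ξ̇` like a translation. -/
structure IsTranslation (L : TSpace d →ₐ[ℝ] TSpace d) : Prop where
  X_mem : ∀ j, L (X (Pi.single j 1)) ∈ polys d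
  Xi_eq : L Xi = Xi
  dXi_eq : L dXi = dXi
  I_sub_mem : ∀ a (σ : TSpace d), L (I a σ) - I a (L σ) ∈ polys d

theorem isTranslation_act (f : TPlus d α i →ₐ[ℝ] ℝ) : IsTranslation (act f) where
  X_mem j := by rw [act_mem_polys_X]; exact shiftX_mem_polys _ j
  Xi_eq := act_Xi f
  dXi_eq := act_dXi f
  I_sub_mem a σ := by
    refine mem_of_ofTree_mem (M := (polys d).toSubmodule.comap ((act f).toLinearMap ∘ₗ I a -
      I a ∘ₗ (act f).toLinearMap)) (fun t ht => ?_) σ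
    change act f (I a (ofTree t)) - I a (act f (ofTree t)) ∈ polys d
    rw [act_I f a (ofTree_mem_degLE α i (le_refl (t.deg α i))) le_rfl, add_sub_cancel_left]
    exact tay_mem_polys f (shiftX_mem_polys _) _ _ _

theorem IsTranslation.comp {L L' : TSpace d →ₐ[ℝ] TSpace d} (h : IsTranslation L)
    (h' : IsTranslation L') : IsTranslation (L.comp L') := by
  have hp : ∀ σ ∈ polys d, L σ ∈ polys d := fun σ hσ =>
    polys_le (M := (polys d).toSubmodule.comap L.toLinearMap) (fun k => by
      change L (X k) ∈ polys d
      rw [X_eq_mp, mp_map]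
      exact mp_mem_polys h.X_mem k) hσ
  refine ⟨fun j => hp _ (h'.X_mem j), by simp [h.Xi_eq, h'.Xi_eq], by simp [h.dXi_eq, h'.dXi_eq],
    fun a σ => ?_⟩
  have := add_mem (hp _ (h'.I_sub_mem a σ)) (h.I_sub_mem a (L' σ))
  simpa using this

/-- `Ξ̇`-free trees are built from `X_j` and `Ξ`. -/
theorem dotless_induction {P : TSpace d → Prop} (zero : P 0)
    (add : ∀ σ τ, P σ → P τ → P (σ + τ)) (smul : ∀ (r : ℝ) σ, P σ → P (r • σ)) (one : P 1)
    (hX : ∀ j, P (X (Pi.single j 1))) (hXi : P Xi)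
    (mul : ∀ σ τ, σ ∈ treeSpan (dotless d) → τ ∈ treeSpan (dotless d) → P σ → P τ → P (σ * τ))
    (hI : ∀ a σ, σ ∈ treeSpan (dotless d) → P σ → P (I a σ)) {σ : TSpace d}
    (hσ : σ ∈ treeSpan (dotless d)) : P σ := by
  have key : ∀ t : DTree d, t.dots = 0 → P (ofTree t) := by
    intro t
    induction t using DTree.generate with
    | one => intro _; rw [ofTree_one]; exact one
    | hX j => intro _; exact hX j
    | hXi => intro _; exact hXi
    | hdXi => intro h; simp [DTree.dots_root] at h
    | mul s t hs ht =>
      intro h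
      rw [DTree.dots_mul] at h
      rw [ofTree_mul]
      exact mul _ _ (ofTree_mem_treeSpan fun _ => by change s.dots = 0; omega)
        (ofTree_mem_treeSpan fun _ => by change t.dots = 0; omega) (hs (by omega)) (ht (by omega))
    | planted a s hs =>
      intro h
      rw [DTree.dots_planted] at h
      rw [← I_ofTree]
      exact hI _ _ (ofTree_mem_treeSpan fun _ => h) (hs h)
  let M : Submodule ℝ (TSpace d) :=
    ⟨⟨⟨{σ | P σ}, fun {a b} => add a b⟩, zero⟩, fun r {a} => smul r a⟩
  exact treeSpan_induction (M := M) hσ fun u hu => key u hu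

theorem Xi_mem_dotless : (Xi : TSpace d) ∈ treeSpan (dotless d) :=
  ofTree_mem_treeSpan fun _ => DTree.dots_root 0 1 0

theorem one_mem_dotless : (1 : TSpace d) ∈ treeSpan (dotless d) := by
  rw [← X_zero]; exact X_mem_dotless 0

theorem IsTranslation.mem_dotless {L : TSpace d →ₐ[ℝ] TSpace d} (h : IsTranslation L)
    {σ : TSpace d} (hσ : σ ∈ treeSpan (dotless d)) : L σ ∈ treeSpan (dotless d) := by
  refine dotless_induction (P := fun σ => L σ ∈ treeSpan (dotless d)) ?zero
    ?add ?smul ?one ?hX ?hXi ?mul ?hI hσ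
  case zero =>
    rw [map_zero]; exact zero_mem _
  case add =>
    intro σ τ hσ hτ
    rw [map_add]; exact add_mem hσ hτ
  case smul =>
    intro r σ hσ
    rw [map_smul]; exact Submodule.smul_mem _ _ hσ
  case one =>
    rw [map_one]; exact one_mem_dotless
  case hX =>
    intro j
    exact polys_dotless (h.X_mem j)
  case hXi =>
    rw [h.Xi_eq]; exact Xi_mem_dotless
  case mul =>
    intro σ τ _ _ hσ hτ
    rw [map_mul]; exact dotless_mul hσ hτ
  case hI =>
    intro a σ _ hσ
    rw [← sub_add_cancel (L (I a σ)) (I a (L σ))]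
    exact add_mem (polys_dotless (h.I_sub_mem a σ)) (dotless_I a hσ)

/-- The part of `L D_Ξ τ` with `Ξ̇` is `D_Ξ L τ`. -/
theorem IsTranslation.malliavinD_apply {L : TSpace d →ₐ[ℝ] TSpace d} (h : IsTranslation L)
    {σ : TSpace d} (hσ : σ ∈ treeSpan (dotless d)) :
    L (malliavinD σ) - Q0 (L (malliavinD σ)) = malliavinD (L σ) := by
  refine dotless_induction (P := fun σ => L (malliavinD σ) - Q0 (L (malliavinD σ)) = malliavinD (L σ)) ?zero
    ?add ?smul ?one ?hX ?hXi ?mul ?hI hσ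
  case zero =>
    simp
  case add =>
    intro σ τ hσ hτ
    simp only [map_add, ← hσ, ← hτ]; abel
  case smul =>
    intro r σ hσ
    simp only [map_smul, ← hσ, smul_sub]
  case one =>
    simp [malliavinD_one]
  case hX =>
    intro j
    rw [malliavinD_X, malliavinD_of_mem_polys (h.X_mem j)]; simp
  case hXi =>
    rw [malliavinD_Xi, h.dXi_eq, h.Xi_eq, malliavinD_Xi, Q0_dXi, sub_zero]
  case mul =>
    intro σ τ h1 h2 hσ hτ
    -- `𝒬₀` is multiplicative and fixes `L σ` and `L τ`, so `𝒬₀` acts only on the differentiated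
    -- factor and the Leibniz rule passes through.
    have e1 := Q0_of_dotless (h.mem_dotless h1)
    have e2 := Q0_of_dotless (h.mem_dotless h2)
    rw [malliavinD_mul, map_add, map_mul, map_mul, map_mul, malliavinD_mul, ← hσ, ← hτ, map_add,
      Q0_mul, Q0_mul, e1, e2]
    ring
  case hI =>
    intro a σ h1 hσ
    -- Two polynomial corrections occur: the one for `𝓘_a(D_Ξ σ)` is fixed by `𝒬₀` and drops out of
    -- the left side, the one for `𝓘_a(σ)` is killed by `D_Ξ`.
    have e1 := h.I_sub_mem a (malliavinD σ)
    have e2 := Q0_of_dotless (polys_dotless e1)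
    have e3 := malliavinD_of_mem_polys (h.I_sub_mem a σ)
    rw [map_sub, sub_eq_zero] at e3
    rw [map_sub, Q0_I] at e2
    rw [malliavinD_I, e3, malliavinD_I, ← hσ, map_sub (I a)]
    linear_combination -e2

/-- The operator `τ ↦ Ξ̇ τ°` commutes with translations. -/
theorem IsTranslation.QRoot_malliavinD {L : TSpace d →ₐ[ℝ] TSpace d} (h : IsTranslation L)
    {σ : TSpace d} (hσ : σ ∈ treeSpan (dotless d)) :
    QRoot (malliavinD (L σ)) = L (QRoot (malliavinD σ)) := by
  refine dotless_induction (P := fun σ => QRoot (malliavinD (L σ)) = L (QRoot (malliavinD σ))) ?zero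
    ?add ?smul ?one ?hX ?hXi ?mul ?hI hσ
  case zero =>
    simp
  case add =>
    intro σ τ hσ hτ
    simp only [map_add, hσ, hτ]
  case smul =>
    intro r σ hσ
    simp only [map_smul, hσ]
  case one =>
    simp [malliavinD_one]
  case hX =>
    intro j
    rw [malliavinD_X, malliavinD_of_mem_polys (h.X_mem j)]; simp
  case hXi =>
    rw [h.Xi_eq, malliavinD_Xi, QRoot_dXi, h.dXi_eq]
  case mul =>
    intro σ τ h1 h2 hσ hτ
    rw [map_mul, malliavinD_mul, malliavinD_mul, map_add, map_add, map_add,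
      QRoot_mul_of_dotless _ h2, QRoot_mul_of_dotless _ (h.mem_dotless h2), mul_comm σ,
      mul_comm (L σ), QRoot_mul_of_dotless _ h1, QRoot_mul_of_dotless _ (h.mem_dotless h1), hσ, hτ,
      map_mul, map_mul]
  case hI =>
    intro a σ h1 hσ
    have e3 := malliavinD_of_mem_polys (h.I_sub_mem a σ)
    rw [map_sub, sub_eq_zero] at e3
    rw [e3, malliavinD_I, malliavinD_I, QRoot_I, QRoot_I, map_zero]

/-! ## The trees of `D_Ξ τ` -/

/-- `Ξ` and `Ξ̇` have the same `deg_0`. The extra `Ξ̇` also guarantees that no tree of `D_Ξ t` is a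
monomial, hence that planting it gives a nonzero tree. -/
theorem malliavinD_mem_treeSpan {t : DTree d} (ht : t ∈ admissible d) :
    malliavinD (ofTree t) ∈ treeSpan {u : T d | (u : DTree d).deg α 0 = t.deg α 0 ∧
      (u : DTree d).dots = t.dots + 1} := by
  induction t using DTree.generate with
  | one => rw [ofTree_one, malliavinD_one]; exact zero_mem _
  | hX j => have := malliavinD_X (Pi.single j 1 : MIdx d); rw [X] at this; rw [this]; exact zero_mem _
  | hXi =>
    have := malliavinD_Xi (d := d)
    rw [Xi] at this
    rw [this]
    exact ofTree_mem_treeSpan fun _ => by simp [DTree.deg_root, DTree.dots_root]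
  | hdXi => have := malliavinD_dXi (d := d); rw [dXi] at this; rw [this]; exact zero_mem _
  | mul s t hs ht' =>
    rw [mul_mem_admissible] at ht
    rw [ofTree_mul, malliavinD_mul]
    refine add_mem (treeSpan_mul (fun u hu v hv => ?_) (hs ht.1)
      (ofTree_mem_treeSpan (S := {v : T d | (v : DTree d) = t}) fun _ => rfl))
      (treeSpan_mul (fun u hu v hv => ?_)
      (ofTree_mem_treeSpan (S := {v : T d | (v : DTree d) = s}) fun _ => rfl) (ht' ht.2)) <;>
    · simp only [Set.mem_ofPred_eq, Submonoid.coe_mul, DTree.deg_mul, DTree.dots_mul] at hu hv ⊢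
      simp only [hu, hv, true_and]
      omega
  | planted a s hs =>
    rw [← I_ofTree, malliavinD_I]
    refine treeSpan_I a (fun u hu _ => ?_) (hs (planted_mem_admissible.1 ht).1)
    simp only [Set.mem_ofPred_eq, DTree.deg_planted, DTree.dots_planted] at hu ⊢
    simp [hu]

end

section

variable {d : ℕ}

/-! ## Partial derivatives of smooth functions -/

theorem pderiv_eq_fderiv (j : Fin (d + 1)) {f : Pt d → ℝ} (hf : ContDiff ℝ ∞ f) :
    pderiv j f = fun y => fderiv ℝ f y (Pi.single j 1) :=
  funext fun _ => (hf.differentiable (by simp) _).lineDeriv_eq_fderiv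

theorem contDiff_pderiv (j : Fin (d + 1)) {f : Pt d → ℝ} (hf : ContDiff ℝ ∞ f) :
    ContDiff ℝ ∞ (pderiv j f) := by
  rw [pderiv_eq_fderiv j hf]
  exact (hf.fderiv_right (m := ∞) (by simp)).clm_apply contDiff_const

theorem pderiv_comm (j k : Fin (d + 1)) {f : Pt d → ℝ} (hf : ContDiff ℝ ∞ f) :
    pderiv j (pderiv k f) = pderiv k (pderiv j f) := by
  have h1 : ContDiff ℝ ∞ (fderiv ℝ f) := hf.fderiv_right (m := ∞) (by simp)
  have key : ∀ j k : Fin (d + 1), pderiv j (pderiv k f) =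
      fun y => fderiv ℝ (fderiv ℝ f) y (Pi.single j 1) (Pi.single k 1) := by
    intro j k
    rw [pderiv_eq_fderiv j (contDiff_pderiv k hf), pderiv_eq_fderiv k hf]
    funext y
    have h2 : DifferentiableAt ℝ (fderiv ℝ f) y := h1.differentiable (by simp) y
    rw [fderiv_clm_apply h2 (differentiableAt_const _)]
    simp
  rw [key, key]
  funext y
  exact (hf.contDiffAt.isSymmSndFDerivAt (by
    rw [minSmoothness_of_isRCLikeNormedField]
    exact WithTop.coe_le_coe.2 le_top)).eq _ _

/-- The algebra of smooth functions. -/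
def smooth (d : ℕ) : Subalgebra ℝ (Pt d → ℝ) where
  carrier := {f | ContDiff ℝ ∞ f}
  mul_mem' := by
    intro f g h h'
    rw [Set.mem_ofPred_eq] at h h' ⊢
    exact h.mul h'
  add_mem' := by
    intro f g h h'
    rw [Set.mem_ofPred_eq] at h h' ⊢
    exact h.add h'
  algebraMap_mem' r := by
    rw [Set.mem_ofPred_eq]
    exact contDiff_const

theorem mem_smooth {f : Pt d → ℝ} : f ∈ smooth d ↔ ContDiff ℝ ∞ f := Iff.rfl

/-- `∂_j` on smooth functions. -/
def pderivL (j : Fin (d + 1)) : Module.End ℝ (smooth d) where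
  toFun f := ⟨pderiv j f, contDiff_pderiv j f.2⟩
  map_add' f g := by
    refine Subtype.ext ?_
    change pderiv j ((f : Pt d → ℝ) + g) = pderiv j f + pderiv j g
    rw [pderiv_eq_fderiv j f.2, pderiv_eq_fderiv j g.2, pderiv_eq_fderiv j (add_mem f.2 g.2)]
    funext y
    rw [fderiv_add (ContDiff.differentiable (mem_smooth.1 f.2) (by simp) y)
      (ContDiff.differentiable (mem_smooth.1 g.2) (by simp) y)]
    rfl
  map_smul' r f := by
    refine Subtype.ext ?_
    change pderiv j (r • (f : Pt d → ℝ)) = r • pderiv j f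
    rw [pderiv_eq_fderiv j f.2, pderiv_eq_fderiv j (Subalgebra.smul_mem _ f.2 r)]
    funext y
    rw [fderiv_const_smul (ContDiff.differentiable (mem_smooth.1 f.2) (by simp) y)]
    rfl

/-- `∂^n` on smooth functions. -/
def mderivL (n : MIdx d) : Module.End ℝ (smooth d) :=
  ((List.finRange (d + 1)).map fun j => pderivL j ^ n j).prod

/-- On smooth functions iterated derivatives are products of commuting endomorphisms, so linearity
and additivity in `n` become statements in a ring. -/
theorem coe_mderivL (n : MIdx d) (f : smooth d) : (mderivL n f : Pt d → ℝ) = mderiv n f := by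
  have hp : ∀ (j : Fin (d + 1)) (m : ℕ) (g : smooth d),
      ((pderivL j ^ m) g : Pt d → ℝ) = (pderiv j)^[m] g := by
    intro j m
    induction m with
    | zero => intro g; rfl
    | succ m ih => intro g; rw [pow_succ, Module.End.mul_apply, ih, Function.iterate_succ_apply]; rfl
  rw [mderivL, mderiv]
  generalize List.finRange (d + 1) = l
  induction l with
  | nil => rfl
  | cons j l ih =>
    rw [List.map_cons, List.prod_cons, Module.End.mul_apply, hp, ih, List.foldr_cons]

theorem commute_pderivL (j k : Fin (d + 1)) : Commute (pderivL j) (pderivL k) :=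
  LinearMap.ext fun f => Subtype.ext (pderiv_comm j k f.2)

theorem mderivL_add (n m : MIdx d) : mderivL (n + m) = mderivL n * mderivL m := by
  simp only [mderivL]
  generalize List.finRange (d + 1) = l
  induction l with
  | nil => simp
  | cons j l ih =>
    rw [List.map_cons, List.prod_cons, ih]
    simp only [List.map_cons, List.prod_cons, Pi.add_apply, pow_add]
    have : Commute (pderivL j ^ m j) (l.map fun j => pderivL j ^ n j).prod := by
      refine Commute.list_prod_right _ _ fun x hx => ?_
      obtain ⟨k, -, rfl⟩ := List.mem_map.1 hx
      exact (commute_pderivL j k).pow_pow _ _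
    rw [mul_assoc, mul_assoc, ← mul_assoc (pderivL j ^ m j), this.eq, mul_assoc]

theorem mderivL_single (j : Fin (d + 1)) : mderivL (Pi.single j 1) = pderivL j := by
  rw [mderivL, List.prod_map_eq_pow_single j]
  · simp [List.count_eq_one_of_mem (List.nodup_finRange _) (List.mem_finRange j)]
  · intro k hk _
    simp [hk]

theorem contDiff_mderiv (n : MIdx d) {f : Pt d → ℝ} (hf : ContDiff ℝ ∞ f) :
    ContDiff ℝ ∞ (mderiv n f) := by
  rw [← coe_mderivL n ⟨f, hf⟩]; exact (mderivL n _).2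

theorem mderiv_add (n m : MIdx d) {f : Pt d → ℝ} (hf : ContDiff ℝ ∞ f) :
    mderiv (n + m) f = mderiv n (mderiv m f) := by
  rw [← coe_mderivL (n + m) ⟨f, hf⟩, mderivL_add, Module.End.mul_apply, coe_mderivL, coe_mderivL]

theorem mderiv_add_single (n : MIdx d) (j : Fin (d + 1)) {f : Pt d → ℝ} (hf : ContDiff ℝ ∞ f) :
    mderiv (n + Pi.single j 1) f = mderiv n (pderiv j f) := by
  rw [mderiv_add n _ hf, ← coe_mderivL (Pi.single j 1) ⟨f, hf⟩, mderivL_single]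
  rfl

theorem mderiv_zero (f : Pt d → ℝ) : mderiv 0 f = f := by
  rw [mderiv]
  generalize List.finRange (d + 1) = l
  induction l with
  | nil => rfl
  | cons j l ih => rw [List.foldr_cons, ih]; rfl

theorem mderiv_map_add (n : MIdx d) {f g : Pt d → ℝ} (hf : ContDiff ℝ ∞ f) (hg : ContDiff ℝ ∞ g) :
    mderiv n (f + g) = mderiv n f + mderiv n g := by
  have := congrArg Subtype.val (map_add (mderivL n) ⟨f, hf⟩ ⟨g, hg⟩)
  rw [Subalgebra.coe_add, coe_mderivL, coe_mderivL, coe_mderivL] at this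
  exact this

theorem mderiv_smul (n : MIdx d) (r : ℝ) {f : Pt d → ℝ} (hf : ContDiff ℝ ∞ f) :
    mderiv n (r • f) = r • mderiv n f := by
  have := congrArg Subtype.val (map_smul (mderivL n) r ⟨f, hf⟩)
  rw [Subalgebra.coe_smul, coe_mderivL, coe_mderivL] at this
  exact this

theorem pderiv_mul (j : Fin (d + 1)) {f g : Pt d → ℝ} (hf : ContDiff ℝ ∞ f)
    (hg : ContDiff ℝ ∞ g) : pderiv j (f * g) = pderiv j f * g + f * pderiv j g := by
  rw [pderiv_eq_fderiv j hf, pderiv_eq_fderiv j hg, pderiv_eq_fderiv j (mul_mem (mem_smooth.2 hf) (mem_smooth.2 hg))]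
  funext y
  rw [fderiv_mul (hf.differentiable (by simp) y) (hg.differentiable (by simp) y)]
  simp
  ring

theorem MIdx.induction {P : MIdx d → Prop} (zero : P 0)
    (add : ∀ n j, P n → P (n + Pi.single j 1)) (n : MIdx d) : P n := by
  obtain ⟨m, hm⟩ : ∃ m, ∑ j, n j = m := ⟨_, rfl⟩
  induction m generalizing n with
  | zero =>
    have : n = 0 := funext fun j => by
      simpa using (Finset.sum_eq_zero_iff.1 hm) j (Finset.mem_univ j)
    rw [this]; exact zero
  | succ m ih =>
    obtain ⟨j, hj⟩ : ∃ j, n j ≠ 0 := by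
      by_contra! h
      simp [h] at hm
    have h1 : n = (n - Pi.single j 1) + Pi.single j 1 := by
      funext k
      by_cases hk : k = j
      · subst hk; simp; omega
      · simp [hk]
    rw [h1]
    refine add _ _ (ih _ ?_)
    have : ∑ j, n j = ∑ k, (n - Pi.single j 1 : MIdx d) k + ∑ k, (Pi.single j 1 : MIdx d) k := by
      rw [← Finset.sum_add_distrib]
      exact Finset.sum_congr rfl fun k _ => by conv_lhs => rw [h1]
                                               rfl
    rw [Finset.sum_pi_single'] at this
    simp at this ⊢
    omega

/-- Functions whose derivatives up to `∂^n` vanish at a point form an ideal. -/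
theorem mderiv_mul_eq_zero (y : Pt d) (n : MIdx d) : ∀ f g : Pt d → ℝ, ContDiff ℝ ∞ f →
    ContDiff ℝ ∞ g → (∀ m ≤ n, mderiv m f y = 0) → mderiv n (f * g) y = 0 := by
  induction n using MIdx.induction with
  | zero =>
    intro f g _ _ h
    have := h 0 le_rfl
    rw [mderiv_zero] at this ⊢
    simp [this]
  | add n j ih =>
    intro f g hf hg h
    rw [mderiv_add_single n j (mul_mem (mem_smooth.2 hf) (mem_smooth.2 hg)), pderiv_mul j hf hg,
      mderiv_map_add n (mul_mem (mem_smooth.2 (contDiff_pderiv j hf)) (mem_smooth.2 hg))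
        (mul_mem (mem_smooth.2 hf) (mem_smooth.2 (contDiff_pderiv j hg))), Pi.add_apply,
      ih _ _ (contDiff_pderiv j hf) hg, ih _ _ hf (contDiff_pderiv j hg), add_zero]
    · exact fun m hm => h m (hm.trans (le_self_add))
    · intro m hm
      rw [← mderiv_add_single m j hf]
      exact h _ (add_le_add hm le_rfl)

/-! ## Monomials -/

theorem contDiff_mpow (x : Pt d) (k : MIdx d) : ContDiff ℝ ∞ fun y => mpow (y - x) k := by
  unfold mpow
  refine contDiff_prod fun j _ => ContDiff.pow ?_ _
  simp only [Pi.sub_apply]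
  exact (contDiff_apply ℝ ℝ j).sub contDiff_const

theorem mpow_eq_mp (z : Pt d) (k : MIdx d) : mpow z k = mp z k := rfl

theorem pderiv_mpow (j : Fin (d + 1)) (x : Pt d) (k : MIdx d) :
    pderiv j (fun y => mpow (y - x) k) =
      (k j : ℝ) • fun y => mpow (y - x) (k - Pi.single j 1) := by
  funext y
  have h : ∀ t : ℝ, mpow (y + t • Pi.single j 1 - x) k =
      (y j + t - x j) ^ k j * ∏ i ∈ Finset.univ.erase j, (y i - x i) ^ k i := by
    intro t
    rw [mpow, ← Finset.mul_prod_erase _ _ (Finset.mem_univ j)]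
    congr 1
    · simp
    · refine Finset.prod_congr rfl fun i hi => ?_
      simp [Finset.ne_of_mem_erase hi]
  have h' : mpow (y - x) (k - Pi.single j 1) =
      (y j - x j) ^ (k j - 1) * ∏ i ∈ Finset.univ.erase j, (y i - x i) ^ k i := by
    rw [mpow, ← Finset.mul_prod_erase _ _ (Finset.mem_univ j)]
    congr 1
    · simp
    · refine Finset.prod_congr rfl fun i hi => ?_
      simp [Finset.ne_of_mem_erase hi]
  rw [Pi.smul_apply, h', pderiv, lineDeriv]
  simp only [h]
  have : HasDerivAt (fun t : ℝ => (y j + t - x j) ^ k j *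
      ∏ i ∈ Finset.univ.erase j, (y i - x i) ^ k i)
      ((k j * (y j + 0 - x j) ^ (k j - 1) * 1) *
        ∏ i ∈ Finset.univ.erase j, (y i - x i) ^ k i) 0 :=
    ((((hasDerivAt_id (0 : ℝ)).const_add (y j)).sub_const (x j)).fun_pow (k j)).mul_const _
  rw [this.deriv, add_zero, smul_eq_mul]
  ring

theorem mderiv_mpow (x : Pt d) (n : MIdx d) : ∀ k : MIdx d,
    mderiv n (fun y => mpow (y - x) k) x = if n = k then (mfact k : ℝ) else 0 := by
  induction n using MIdx.induction with
  | zero =>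
    intro k
    rw [mderiv_zero, sub_self]
    split_ifs with h
    · subst h; simp [mpow, mfact]
    · obtain ⟨j, hj⟩ := Function.ne_iff.1 h
      exact Finset.prod_eq_zero (Finset.mem_univ j) (by simpa using fun h => hj h.symm)
  | add n j ih =>
    intro k
    rw [mderiv_add_single n j (contDiff_mpow x k), pderiv_mpow, mderiv_smul _ _ (contDiff_mpow x _),
      Pi.smul_apply, ih, smul_eq_mul]
    by_cases hk : k j = 0
    · rw [hk, Nat.cast_zero, zero_mul, if_neg]
      rintro rfl
      simp at hk
    · have h1 : n = k - Pi.single j 1 ↔ n + Pi.single j 1 = k := by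
        constructor
        · rintro rfl
          funext i
          by_cases hi : i = j
          · subst hi; simp; omega
          · simp [hi]
        · rintro rfl
          simp
      rw [mul_ite, mul_zero]
      refine if_congr h1 ?_ rfl
      rw [mfact, mfact, ← Finset.mul_prod_erase _ _ (Finset.mem_univ j),
        ← Finset.mul_prod_erase (a := j) _ (fun i => (k i)!) (Finset.mem_univ j)]
      have h2 : ∏ i ∈ Finset.univ.erase j, ((k - Pi.single j 1 : MIdx d) i)! =
          ∏ i ∈ Finset.univ.erase j, (k i)! :=
        Finset.prod_congr rfl fun i hi => by simp [Finset.ne_of_mem_erase hi]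
      rw [h2, Pi.sub_apply, Pi.single_eq_same, ← Nat.mul_factorial_pred hk]
      push_cast
      ring

/-! ## Convolutions -/

section Conv

variable {K : Pt d → ℝ}

theorem integrable_mul_continuous (hK : MeasureTheory.Integrable K) (hc : HasCompactSupport K)
    {g : Pt d → ℝ} (hg : Continuous g) : MeasureTheory.Integrable fun z => K z * g z := by
  rw [← MeasureTheory.integrableOn_iff_integrable_of_support_subset (s := tsupport K)]
  · exact hK.integrableOn.mul_continuousOn hg.continuousOn hc
  · exact (Function.support_mul_subset_left _ _).trans (subset_tsupport K)

theorem integrable_conv (hK : MeasureTheory.Integrable K) (hc : HasCompactSupport K)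
    {g : Pt d → ℝ} (hg : Continuous g) (y : Pt d) :
    MeasureTheory.Integrable fun z => K z * g (y - z) :=
  integrable_mul_continuous hK hc (hg.comp (continuous_const.sub continuous_id))

theorem conv_add (hK : MeasureTheory.Integrable K) (hc : HasCompactSupport K) (a : MIdx d)
    {f g : Pt d → ℝ} (hf : ContDiff ℝ ∞ f) (hg : ContDiff ℝ ∞ g) :
    conv K a (f + g) = conv K a f + conv K a g := by
  funext y
  simp only [conv, Pi.add_apply, mderiv_map_add a hf hg, mul_add]
  exact MeasureTheory.integral_add (integrable_conv hK hc (contDiff_mderiv a hf).continuous y)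
    (integrable_conv hK hc (contDiff_mderiv a hg).continuous y)

theorem conv_smul (a : MIdx d) (r : ℝ) {f : Pt d → ℝ} (hf : ContDiff ℝ ∞ f) :
    conv K a (r • f) = r • conv K a f := by
  funext y
  simp only [conv, Pi.smul_apply, mderiv_smul a r hf, smul_eq_mul]
  rw [← MeasureTheory.integral_const_mul]
  congr 1
  funext z
  ring

/-- Only `K` has compact support, so `f` is first cut off: `K` is convolved with `w ↦ χ(-w) ∂^a f(p
+ w)`, where the bump `χ` is `1` on the support of `K`. Evaluating at `0` with parameter `p = y`
gives back the convolution at `y`, so smoothness in the parameter is what is needed. -/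
theorem contDiff_conv (hK : MeasureTheory.Integrable K) (hc : HasCompactSupport K) (a : MIdx d)
    {f : Pt d → ℝ} (hf : ContDiff ℝ ∞ f) : ContDiff ℝ ∞ (conv K a f) := by
  obtain ⟨r, hr⟩ := hc.isCompact.isBounded.subset_closedBall (0 : Pt d)
  -- The radius `r` from boundedness need not be positive, hence `max r 1`.
  let χ : ContDiffBump (0 : Pt d) := ⟨max r 1, max r 1 + 1, by positivity, by linarith⟩
  have h1 : ∀ z ∈ tsupport K, χ z = 1 := fun z hz =>
    χ.one_of_mem_closedBall (Metric.closedBall_subset_closedBall (le_max_left _ _) (hr hz))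
  let g : Pt d → Pt d → ℝ := fun p w => χ (-w) * mderiv a f (p + w)
  have hg : ContDiff ℝ ∞ (Function.uncurry g) := by
    refine ContDiff.mul (χ.contDiff.comp contDiff_snd.neg) ?_
    exact (contDiff_mderiv a hf).comp (contDiff_fst.add contDiff_snd)
  have h2 : ContDiffOn ℝ ∞ (fun q : Pt d × Pt d => MeasureTheory.convolution K (g q.1)
      (ContinuousLinearMap.mul ℝ ℝ) MeasureTheory.volume q.2) (Set.univ ×ˢ Set.univ) := by
    refine MeasureTheory.contDiffOn_convolution_right_with_param (n := ⊤)
      (k := Metric.closedBall 0 (max r 1 + 1)) _ isOpen_univ (isCompact_closedBall _ _) ?_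
      hK.locallyIntegrable hg.contDiffOn
    intro p w _ hw
    have : χ (-w) = 0 := by
      refine χ.zero_of_le_dist ?_
      rw [Metric.mem_closedBall, not_le, dist_zero_right] at hw
      rw [dist_zero_right, norm_neg]
      exact hw.le
    simp [g, this]
  rw [Set.univ_prod_univ, contDiffOn_univ] at h2
  have h3 := h2.comp (contDiff_id.prodMk (contDiff_const (c := (0 : Pt d))))
  convert h3 using 1
  funext y
  simp only [conv, Function.comp_apply, MeasureTheory.convolution, id, g,
    ContinuousLinearMap.mul_apply']
  congr 1
  funext z
  by_cases hz : z ∈ tsupport K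
  · simp [h1 z hz, sub_eq_add_neg]
  · simp [image_eq_zero_of_notMem_tsupport hz]

/-- Differentiation under the integral, dominated by `|K|` times the maximum of the derivative over
the compact set of parameters in `[-1, 1]` and points of the support of `K`. -/
theorem pderiv_conv_zero (hK : MeasureTheory.Integrable K) (hc : HasCompactSupport K)
    (j : Fin (d + 1)) {g : Pt d → ℝ} (hg : ContDiff ℝ ∞ g) :
    pderiv j (fun y => ∫ z, K z * g (y - z)) = fun y => ∫ z, K z * pderiv j g (y - z) := by
  funext y
  set v : Pt d := Pi.single j 1
  have hv : ContDiff ℝ ∞ (pderiv j g) := contDiff_pderiv j hg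
  have hcont : Continuous fun q : ℝ × Pt d => ‖pderiv j g (y + q.1 • v - q.2)‖ := by
    have := hv.continuous
    fun_prop
  obtain ⟨C, hC⟩ := ((isCompact_Icc (a := (-1 : ℝ)) (b := 1)).prod hc.isCompact).bddAbove_image
    hcont.continuousOn
  have hline : ∀ (z : Pt d) (t : ℝ), HasDerivAt (fun t : ℝ => K z * g (y + t • v - z))
      (K z * pderiv j g (y + t • v - z)) t := by
    intro z t
    refine HasDerivAt.const_mul _ ?_
    have h1 : HasDerivAt (fun t : ℝ => y + t • v - z) v t := by
      simpa using (((hasDerivAt_id t).smul_const v).const_add y).sub_const z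
    have h2 := (hg.differentiable (by simp) (y + t • v - z)).hasFDerivAt.comp_hasDerivAt t h1
    rw [pderiv_eq_fderiv j hg]
    exact h2
  have key := hasDerivAt_integral_of_dominated_loc_of_deriv_le (μ := MeasureTheory.volume)
    (F := fun (t : ℝ) z => K z * g (y + t • v - z)) (x₀ := (0 : ℝ)) (s := Set.Icc (-1) 1)
    (bound := fun z => |K z| * C) (Icc_mem_nhds (by norm_num) (by norm_num))
    (Filter.Eventually.of_forall fun t =>
      (integrable_conv hK hc hg.continuous (y + t • v)).aestronglyMeasurable)
    (integrable_conv hK hc hg.continuous (y + (0 : ℝ) • v))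
    (F' := fun t z => K z * pderiv j g (y + t • v - z))
    (integrable_conv hK hc hv.continuous (y + (0 : ℝ) • v)).aestronglyMeasurable
    (Filter.Eventually.of_forall fun z t ht => by
      by_cases hz : z ∈ tsupport K
      · rw [norm_mul, Real.norm_eq_abs]
        exact mul_le_mul_of_nonneg_left
          (hC (Set.mem_image_of_mem _ (Set.mk_mem_prod ht hz : (t, z) ∈ _))) (abs_nonneg _)
      · simp [image_eq_zero_of_notMem_tsupport hz])
    (hK.abs.mul_const C)
    (Filter.Eventually.of_forall fun z t _ => hline z t)
  have := key.2.deriv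
  rw [zero_smul, add_zero] at this
  exact this

theorem pderiv_conv (hK : MeasureTheory.Integrable K) (hc : HasCompactSupport K)
    (j : Fin (d + 1)) (a : MIdx d) {f : Pt d → ℝ} (hf : ContDiff ℝ ∞ f) :
    pderiv j (conv K a f) = conv K (a + Pi.single j 1) f := by
  have h1 : mderiv (a + Pi.single j 1) f = pderiv j (mderiv a f) := by
    rw [add_comm, mderiv_add _ a hf, ← coe_mderivL _ ⟨_, contDiff_mderiv a hf⟩, mderivL_single]
    rfl
  have := pderiv_conv_zero hK hc j (contDiff_mderiv a hf)
  rw [← h1] at this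
  exact this

theorem mderiv_conv (hK : MeasureTheory.Integrable K) (hc : HasCompactSupport K) (n : MIdx d) :
    ∀ (a : MIdx d) {f : Pt d → ℝ}, ContDiff ℝ ∞ f →
      mderiv n (conv K a f) = conv K (a + n) f := by
  induction n using MIdx.induction with
  | zero => intro a f _; rw [mderiv_zero, add_zero]
  | add n j ih =>
    intro a f hf
    rw [mderiv_add_single n j (contDiff_conv hK hc a hf), pderiv_conv hK hc j a hf, ih _ hf,
      add_right_comm, add_assoc]

/-- `K` annihilates the polynomials of degree at most `r`. -/
theorem conv_mpow (hK : MeasureTheory.Integrable K) (hc : HasCompactSupport K) {r : ℕ}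
    (hm : ∀ k : MIdx d, sdeg k ≤ r → ∫ z, K z * mpow z k = 0) (x : Pt d) (a : MIdx d) :
    ∀ k : MIdx d, sdeg k ≤ r → conv K a (fun y => mpow (y - x) k) = 0 := by
  induction a using MIdx.induction with
  | zero =>
    intro k hk
    funext y
    -- Expanding in powers of `z` leaves moments of `K` of order at most `|k|_𝔰`. For general `a` no
    -- further moments are needed, since derivatives only lower the exponent.
    have h1 : ∀ z : Pt d, mpow (y - z - x) k =
        ∑ l ∈ Fintype.piFinset fun j => Finset.range (k j + 1),
          ((mfact k : ℝ) * ((mfact l : ℝ)⁻¹ * (mfact (k - l) : ℝ)⁻¹) * (-1) ^ (∑ j, l j) *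
            mp (fun j => y j - x j) (k - l)) * mpow z l := by
      intro z
      have h2 := mp_add (fun j => -z j) (fun j => y j - x j) k
      rw [eq_inv_smul_iff₀ (mfact_ne_zero k), Finset.smul_sum] at h2
      have h3 : mpow (y - z - x) k = mp (fun j => -z j + (y j - x j)) k := by
        rw [mpow_eq_mp]
        congr 1
        funext j
        simp only [Pi.sub_apply]
        ring
      rw [h3, ← h2]
      refine Finset.sum_congr rfl fun l _ => ?_
      rw [mp_neg, mpow_eq_mp, smul_eq_mul, smul_eq_mul]
      change _ = _ * mp (fun j => z j) l
      ring
    simp only [conv, mderiv_zero, h1, Finset.mul_sum, Pi.zero_apply]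
    have hcont : ∀ l : MIdx d, Continuous fun z : Pt d => mpow z l := fun l => by
      have := (contDiff_mpow (0 : Pt d) l).continuous
      simpa using this
    have hi : ∀ (l : MIdx d) (c : ℝ),
        MeasureTheory.Integrable fun z : Pt d => K z * (c * mpow z l) := fun l c =>
      integrable_mul_continuous hK hc (continuous_const.mul (hcont l))
    rw [MeasureTheory.integral_finsetSum _ fun l _ => hi l _]
    refine Finset.sum_eq_zero fun l hl => ?_
    have hlk : sdeg l ≤ sdeg k := Finset.sum_le_sum fun j _ =>
      Nat.mul_le_mul_left _ (Nat.lt_succ_iff.1 (Finset.mem_range.1 (Fintype.mem_piFinset.1 hl j)))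
    simp only [mul_left_comm (K _)]
    rw [MeasureTheory.integral_const_mul, hm l (hlk.trans hk), mul_zero]
  | add a j ih =>
    intro k hk
    have h1 : conv K (a + Pi.single j 1) (fun y => mpow (y - x) k) =
        conv K a (pderiv j fun y => mpow (y - x) k) := by
      funext y
      simp only [conv, mderiv_add_single a j (contDiff_mpow x k)]
    have h2 : sdeg (k - Pi.single j 1) ≤ sdeg k := Finset.sum_le_sum fun i _ =>
      Nat.mul_le_mul_left _ (Nat.sub_le _ _)
    rw [h1, pderiv_mpow, conv_smul a _ (contDiff_mpow x _), ih _ (h2.trans hk), smul_zero]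

theorem contDiff_recenter (hK : MeasureTheory.Integrable K) (hc : HasCompactSupport K)
    (a : MIdx d) (c : ℝ) (x : Pt d) {f : Pt d → ℝ} (hf : ContDiff ℝ ∞ f) :
    ContDiff ℝ ∞ (recenter K a c x f) := by
  unfold recenter
  refine (contDiff_conv hK hc a hf).sub (ContDiff.sum fun k _ => ?_)
  exact ((contDiff_mpow x k).div_const _).mul contDiff_const

theorem recenter_add (hK : MeasureTheory.Integrable K) (hc : HasCompactSupport K)
    (a : MIdx d) (c : ℝ) (x : Pt d) {f g : Pt d → ℝ} (hf : ContDiff ℝ ∞ f) (hg : ContDiff ℝ ∞ g) :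
    recenter K a c x (f + g) = recenter K a c x f + recenter K a c x g := by
  funext y
  simp only [recenter, conv_add hK hc _ hf hg, Pi.add_apply, mul_add, Finset.sum_add_distrib]
  ring

theorem recenter_smul (a : MIdx d) (c : ℝ) (x : Pt d) (r : ℝ) {f : Pt d → ℝ}
    (hf : ContDiff ℝ ∞ f) : recenter K a c x (r • f) = r • recenter K a c x f := by
  funext y
  simp only [recenter, conv_smul _ r hf, Pi.smul_apply, smul_eq_mul, mul_sub, Finset.mul_sum]
  congr 1
  exact Finset.sum_congr rfl fun k _ => by ring

/-- The recentered convolution vanishes at the base point to the order of the recentering. -/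
theorem mderiv_recenter (hK : MeasureTheory.Integrable K) (hc : HasCompactSupport K)
    (a : MIdx d) (c : ℝ) (x : Pt d) {f : Pt d → ℝ} (hf : ContDiff ℝ ∞ f) {n : MIdx d}
    (hn : (sdeg n : ℝ) < c) : mderiv n (recenter K a c x f) x = 0 := by
  have hL : ∀ k : MIdx d, ((mfact k : ℝ)⁻¹ * conv K (a + k) f x) • (fun y => mpow (y - x) k) ∈
    smooth d := fun k => Subalgebra.smul_mem _ (contDiff_mpow x k) _
  have h1 : (⟨recenter K a c x f, contDiff_recenter hK hc a c x hf⟩ : smooth d) =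
      ⟨conv K a f, contDiff_conv hK hc a hf⟩ - ∑ k ∈ below c,
        ((mfact k : ℝ)⁻¹ * conv K (a + k) f x) •
          (⟨fun y => mpow (y - x) k, contDiff_mpow x k⟩ : smooth d) := by
    refine Subtype.ext ?_
    funext y
    simp only [recenter, Subalgebra.coe_sub, Pi.sub_apply, AddSubmonoidClass.coe_finsetSum,
      Finset.sum_apply, Subalgebra.coe_smul, Pi.smul_apply, smul_eq_mul]
    congr 1
    exact Finset.sum_congr rfl fun k _ => by ring
  have h2 := congrArg (fun f : smooth d => (mderivL n f : Pt d → ℝ) x) h1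
  simp only [map_sub, map_sum, map_smul, coe_mderivL, Subalgebra.coe_sub, Pi.sub_apply,
    AddSubmonoidClass.coe_finsetSum, Finset.sum_apply, Subalgebra.coe_smul, Pi.smul_apply,
    smul_eq_mul, mderiv_mpow, mderiv_conv hK hc n a hf] at h2
  rw [h2, Finset.sum_eq_single n (fun k _ hk => by rw [if_neg (Ne.symm hk), mul_zero])
    (fun h => absurd (mem_below.2 hn) h), if_pos rfl]
  have := mfact_ne_zero n
  field_simp
  ring

end Conv

end

section

variable {d : ℕ} {α : ℝ} {R : TSpace d →ₗ[ℝ] TSpace d}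

/-! ## Kernels and noises -/

/-- An integrable kernel with compact support, a smooth noise and a smooth direction. -/
structure Data (d : ℕ) where
  K : Pt d → ℝ
  ξ : Pt d → ℝ
  δξ : Pt d → ℝ
  integrable : MeasureTheory.Integrable K
  compact : HasCompactSupport K
  smooth_ξ : ContDiff ℝ ∞ ξ
  smooth_δξ : ContDiff ℝ ∞ δξ

/-- The moments of the kernel up to order `r` vanish. -/
def cancelUpTo (d r : ℕ) : Set (Data d) :=
  {p | ∀ k : MIdx d, sdeg k ≤ r → ∫ z, p.K z * mpow z k = 0}

/-- The filter of kernels with many vanishing moments. -/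
def cancel (d : ℕ) : Filter (Data d) := ⨅ r, Filter.principal (cancelUpTo d r)

theorem eventually_cancel {P : Data d → Prop} :
    (∀ᶠ p in cancel d, P p) ↔ ∃ r, ∀ p ∈ cancelUpTo d r, P p := by
  have h : (cancel d).HasBasis (fun _ => True) (cancelUpTo d) := by
    refine Filter.hasBasis_iInf_principal (directed_of_isDirected_le fun r s hrs p hp k hk => ?_)
    exact hp k (hk.trans hrs)
  simpa using h.eventually_iff

/-! ### Linear properties that hold for kernels with enough vanishing moments. -/

/-- The elements of `𝒯` which eventually belong to the submodule `M p`. -/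
def evSub (M : Data d → Submodule ℝ (TSpace d)) : Submodule ℝ (TSpace d) where
  carrier := {σ | ∀ᶠ p in cancel d, σ ∈ M p}
  zero_mem' := by
    rw [Set.mem_ofPred_eq]
    exact Filter.Eventually.of_forall fun p => zero_mem _
  add_mem' := by
    intro σ τ h h'
    rw [Set.mem_ofPred_eq] at h h' ⊢
    filter_upwards [h, h'] with p hp hp' using add_mem hp hp'
  smul_mem' := by
    intro r σ h
    rw [Set.mem_ofPred_eq] at h ⊢
    filter_upwards [h] with p hp using Submodule.smul_mem _ _ hp

theorem mem_evSub {M : Data d → Submodule ℝ (TSpace d)} {σ : TSpace d} :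
    σ ∈ evSub M ↔ ∀ᶠ p in cancel d, σ ∈ M p := Iff.rfl

open Classical in
/-- The projection of `𝒯` to the span of a set of trees. -/
def proj (S : Set (T d)) : TSpace d →ₗ[ℝ] TSpace d :=
  linExt fun t => if t ∈ S then ofTree (t : DTree d) else 0

theorem proj_of_mem {S : Set (T d)} {σ : TSpace d} (hσ : σ ∈ treeSpan S) : proj S σ = σ :=
  treeSpan_induction (M := LinearMap.eqLocus (proj S) LinearMap.id) hσ fun u hu => by
    change proj S (ofTree _) = _
    rw [proj, linExt_ofTree _ u.2]
    exact if_pos hu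

/-- A linear property that holds eventually for each tree in `S` holds eventually for the elements
`(id ⊗ f) z` of the span of `S`, uniformly in `f`. -/
theorem eventually_evalRight {i : Fin 2} {S : Set (T d)} {M : Data d → Submodule ℝ (TSpace d)}
    (h : ∀ u ∈ S, ∀ᶠ p in cancel d, ofTree (u : DTree d) ∈ M p)
    (z : TSpace d ⊗[ℝ] TPlus d α i) :
    ∀ᶠ p in cancel d, ∀ f : TPlus d α i →ₐ[ℝ] ℝ, evalRight f z ∈ treeSpan S →
      evalRight f z ∈ M p := by
  -- The left factors of `z` need not lie in the span of `S`, only `(id ⊗ f) z` does. Projecting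
  -- first makes the claim hold for every elementary tensor, and `z` is a finite sum of these,
  -- independent of `f`.
  have h1 : ∀ σ, ∀ᶠ p in cancel d, proj S σ ∈ M p := by
    refine mem_of_ofTree_mem (M := (evSub M).comap (proj S)) fun t ht => ?_
    rw [Submodule.mem_comap, proj, linExt_ofTree _ ht]
    split_ifs with hu
    · exact h _ hu
    · exact zero_mem _
  have h2 : ∀ᶠ p in cancel d, ∀ f : TPlus d α i →ₐ[ℝ] ℝ, proj S (evalRight f z) ∈ M p := by
    induction z with
    | zero => exact Filter.Eventually.of_forall fun p f => by simp
    | add x y hx hy =>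
      filter_upwards [hx, hy] with p hp hp' f
      rw [map_add, map_add]
      exact add_mem (hp f) (hp' f)
    | tmul σ q =>
      filter_upwards [h1 σ] with p hp f
      rw [evalRight_tmul, map_smul]
      exact Submodule.smul_mem _ _ hp
  filter_upwards [h2] with p hp f hf
  rw [← proj_of_mem hf]
  exact hp f

/-- The order of quantifiers matters: `f` is chosen after `p`, because the characters of the model
depend on the kernel and on the noise. -/
theorem eventually_act (i : Fin 2) {M : Data d → Submodule ℝ (TSpace d)}
    (h : ∀ σ, ∀ᶠ p in cancel d, σ ∈ M p) (σ : TSpace d) :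
    ∀ᶠ p in cancel d, ∀ f : TPlus d α i →ₐ[ℝ] ℝ, act f σ ∈ M p := by
  filter_upwards [eventually_evalRight (S := Set.univ) (fun u _ => h _) (coact α i σ)] with p hp f
  rw [act_apply]
  exact hp f (by rw [treeSpan_univ]; trivial)

theorem eventually_act_dotless (i : Fin 2) {M : Data d → Submodule ℝ (TSpace d)}
    (h : ∀ σ ∈ treeSpan (dotless d), ∀ᶠ p in cancel d, σ ∈ M p) {σ : TSpace d}
    (hσ : σ ∈ treeSpan (dotless d)) :
    ∀ᶠ p in cancel d, ∀ f : TPlus d α i →ₐ[ℝ] ℝ, act f σ ∈ M p := by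
  filter_upwards [eventually_evalRight (S := dotless d)
    (fun u hu => h _ (ofTree_mem_treeSpan fun _ => hu)) (coact α i σ)] with p hp f
  have := (isTranslation_act f).mem_dotless hσ
  rw [act_apply] at this ⊢
  exact hp f this

/-! ## Induction along preparation maps -/

/-- Induction on trees and the number of noises. -/
theorem noise_induction {P : DTree d → Prop} (one : P 1)
    (hX : ∀ j, P (.root (Pi.single j 1) 0 0)) (hXi : P (.root 0 1 0)) (hdXi : P (.root 0 0 1))
    (mul : ∀ s t, P s → P t → P (s * t))
    (planted : ∀ a s, DTree.planted a s ∈ admissible d → P s →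
      (∀ u, u ∈ admissible d → u.noise < s.noise → P u) → P (DTree.planted a s))
    (t : DTree d) (ht : t ∈ admissible d) : P t := by
  obtain ⟨n, hn⟩ : ∃ n, t.noise = n := ⟨_, rfl⟩
  induction n using Nat.strong_induction_on generalizing t with
  | _ n ih =>
    -- Structural induction inside a strong induction on the number of noises. The inner one allows
    -- `s.noise ≤ n` since planting does not change that number.
    have key : ∀ s : DTree d, s ∈ admissible d → s.noise ≤ n → P s := by
      intro s
      induction s using DTree.generate with
      | one => exact fun _ _ => one
      | hX j => exact fun _ _ => hX j
      | hXi => exact fun _ _ => hXi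
      | hdXi => exact fun _ _ => hdXi
      | mul s t hs ht =>
        intro h h'
        rw [DTree.noise_mul] at h'
        rw [mul_mem_admissible] at h
        exact mul s t (hs h.1 (by omega)) (ht h.2 (by omega))
      | planted a s hs =>
        intro h h'
        rw [DTree.noise_planted] at h'
        exact planted a s h (hs (planted_mem_admissible.1 h).1 h') fun u hu hu' =>
          ih _ (by omega) u hu rfl
    exact key t ht hn.le

theorem renorm_mem (hR : IsPreparationMap α R) {M : Submodule ℝ (TSpace d)} {s : DTree d}
    (hs : s ∈ admissible d) (h : ofTree s ∈ M)
    (h' : ∀ u, u ∈ admissible d → u.noise < s.noise → ofTree u ∈ M) : R (ofTree s) ∈ M := by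
  rw [← sub_add_cancel (R (ofTree s)) (ofTree s)]
  exact add_mem (treeSpan_induction (hR.triangular ⟨s, hs⟩) fun u hu => h' u u.2 hu.2) h

/-- This follows the recursion of the models, where the value at `𝓘_a(s)` depends on the value at `R
s` rather than at `s`; triangularity of `R` makes it well founded. -/
theorem renorm_induction (hR : IsPreparationMap α R) (M : Submodule ℝ (TSpace d)) (one : 1 ∈ M)
    (hX : ∀ j, X (Pi.single j 1) ∈ M) (hXi : Xi ∈ M) (hdXi : dXi ∈ M)
    (mul : ∀ σ τ, σ ∈ M → τ ∈ M → σ * τ ∈ M)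
    (planted : ∀ a s, DTree.planted a s ∈ admissible d → R (ofTree s) ∈ M → I a (ofTree s) ∈ M)
    (σ : TSpace d) : σ ∈ M := by
  refine mem_of_ofTree_mem (fun t ht => ?_) σ
  refine noise_induction (P := fun t => ofTree t ∈ M) ?_ hX hXi hdXi ?_ ?_ t ht
  · rw [ofTree_one]; exact one
  · intro s t hs ht
    rw [ofTree_mul]; exact mul _ _ hs ht
  · intro a s h hs hu
    rw [← I_ofTree]
    exact planted a s h (renorm_mem hR (planted_mem_admissible.1 h).1 hs hu)

theorem renorm_mem_dotless (hRQ : R ∘ₗ Q0 = Q0 ∘ₗ R) {σ : TSpace d}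
    (hσ : σ ∈ treeSpan (dotless d)) : R σ ∈ treeSpan (dotless d) := by
  rw [← Q0_of_dotless hσ, ← LinearMap.comp_apply, hRQ]
  exact Q0_mem_dotless _

theorem renorm_act (hR : IsPreparationMap α R) {i : Fin 2} (f : TPlus d α i →ₐ[ℝ] ℝ)
    (σ : TSpace d) : R (act f σ) = act f (R σ) := by
  have := DFunLike.congr_fun (hR.coact_comm i) σ
  rw [LinearMap.comp_apply, LinearMap.comp_apply] at this
  rw [act_apply, act_apply, ← evalRight_map_id, this]

/-! ## Smoothness of the model -/

theorem modelTimes_one (i : Fin 2) (K ξ δξ : Pt d → ℝ) (x : Pt d) :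
    modelTimes α i R K ξ δξ x 1 = 1 := by
  rw [← X_zero, modelTimes_X]
  funext y
  simp [mpow]

/-- `Π_x^{i,×}` as an algebra morphism. -/
def modelAlg (hR : IsPreparationMap α R) (p : Data d) (i : Fin 2) (x : Pt d) :
    TSpace d →ₐ[ℝ] Pt d → ℝ :=
  AlgHom.ofLinearMap (modelTimes α i R p.K p.ξ p.δξ x) (modelTimes_one ..)
    (modelTimes_mul i p.K p.ξ p.δξ x hR)

theorem modelAlg_apply (hR : IsPreparationMap α R) (p : Data d) (i : Fin 2) (x : Pt d)
    (σ : TSpace d) : modelAlg hR p i x σ = modelTimes α i R p.K p.ξ p.δξ x σ := rfl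

theorem modelAlg_X_single (hR : IsPreparationMap α R) (p : Data d) (i : Fin 2) (x : Pt d)
    (j : Fin (d + 1)) : modelAlg hR p i x (X (Pi.single j 1)) = fun y => y j - x j := by
  rw [modelAlg_apply, modelTimes_X]
  funext y
  rw [mpow, Finset.prod_eq_single j (fun k _ hk => by simp [hk]) (by simp)]
  simp

theorem modelAlg_mem_smooth (hR : IsPreparationMap α R) (p : Data d) (i : Fin 2) (x : Pt d)
    (σ : TSpace d) : modelAlg hR p i x σ ∈ smooth d := by
  refine renorm_induction hR ((smooth d).toSubmodule.comap (modelAlg hR p i x).toLinearMap)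
    ?_ (fun j => ?_) ?_ ?_ (fun σ τ hσ hτ => ?_) (fun a s h hs => ?_) σ <;>
    rw [Submodule.mem_comap, AlgHom.toLinearMap_apply, Subalgebra.mem_toSubmodule] at *
  · rw [map_one]; exact one_mem _
  · rw [modelAlg_apply, modelTimes_X]; exact contDiff_mpow x _
  · rw [modelAlg_apply, modelTimes_Xi]; exact p.smooth_ξ
  · rw [modelAlg_apply, modelTimes_dXi]; exact p.smooth_δξ
  · rw [map_mul]
    exact mul_mem hσ hτ
  · rw [modelAlg_apply, modelTimes_planted i p.K p.ξ p.δξ x hR a s h]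
    exact contDiff_recenter p.integrable p.compact a _ x hs

/-- `τ ↦ ∂^a K * Π_x^i τ`. -/
def convModel (hR : IsPreparationMap α R) (p : Data d) (i : Fin 2) (x : Pt d) (a : MIdx d) :
    TSpace d →ₗ[ℝ] Pt d → ℝ where
  toFun σ := conv p.K a (modelAlg hR p i x (R σ))
  map_add' σ τ := by
    rw [map_add, map_add, conv_add p.integrable p.compact a (modelAlg_mem_smooth hR p i x _)
      (modelAlg_mem_smooth hR p i x _)]
  map_smul' r σ := by
    rw [map_smul, map_smul, conv_smul a r (modelAlg_mem_smooth hR p i x _)]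
    rfl

theorem convModel_apply (hR : IsPreparationMap α R) (p : Data d) (i : Fin 2) (x : Pt d)
    (a : MIdx d) (σ : TSpace d) :
    convModel hR p i x a σ = conv p.K a (modelAlg hR p i x (R σ)) := rfl

/-! ## The characters of the model -/

variable (α R) in
/-- The character `f_x^i`. -/
def fc (p : Data d) (i : Fin 2) (x : Pt d) : TPlus d α i →ₐ[ℝ] ℝ := fChar α i R p.K p.ξ p.δξ x

variable (α R) in
/-- The character `f_x^i 𝒜_i^+`. -/
def gc (p : Data d) (i : Fin 2) (x : Pt d) : TPlus d α i →ₐ[ℝ] ℝ :=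
  (fc α R p i x).comp (antipodePlus α i)

theorem fc_plusX (p : Data d) (i : Fin 2) (x : Pt d) (j : Fin (d + 1)) :
    fc α R p i x (plusX α i j) = -x j := by
  rw [fc, fChar, plusX, MvPolynomial.aeval_X, Sum.elim_inl]

theorem gc_plusX (p : Data d) (i : Fin 2) (x : Pt d) (j : Fin (d + 1)) :
    gc α R p i x (plusX α i j) = x j := by
  rw [gc, antipode_plusX, fc_plusX, neg_neg]

theorem fc_plusITree (hR : IsPreparationMap α R) (p : Data d) (i : Fin 2) (x : Pt d) {a : MIdx d}
    {s : DTree d} (h : DTree.planted a s ∈ admissible d) (h' : 0 < (DTree.planted a s).deg α i) :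
    fc α R p i x (plusITree α i a s) = -convModel hR p i x a (ofTree s) x := by
  rw [plusITree, dif_pos ⟨h, h'⟩, fc, fChar, MvPolynomial.aeval_X]
  rfl

/-- This is where the moment condition is used: it makes convolution with `∂^a K` compatible with
`𝓘_a(X^k) = 0`. -/
theorem convModel_X (hR : IsPreparationMap α R) (i : Fin 2) (a k : MIdx d) :
    ∀ᶠ p in cancel d, ∀ x, convModel hR p i x a (X k) = 0 := by
  rw [eventually_cancel]
  refine ⟨sdeg k, fun p hp x => ?_⟩
  rw [convModel_apply, hR.fixes_monomial, modelAlg_apply, modelTimes_X]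
  exact conv_mpow p.integrable p.compact hp x a k le_rfl

/-- The defining property of the model on planted trees, as a property of linear maps. -/
theorem modelAlg_I (hR : IsPreparationMap α R) (i : Fin 2) (a : MIdx d) {c : ℝ} {u : DTree d}
    (hu : u ∈ admissible d) (hc : u.deg α i + 2 - sdeg a ≤ c) :
    ∀ᶠ p in cancel d, ∀ x, modelAlg hR p i x (I a (ofTree u)) = convModel hR p i x a (ofTree u) +
      tay (A := Pt d → ℝ) (fc α R p i x) (fun j y => y j - x j) a c (ofTree u) := by
  by_cases h : DTree.planted a u ∈ admissible d
  · refine Filter.Eventually.of_forall fun p x => ?_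
    rw [modelAlg_apply, modelTimes_planted i p.K p.ξ p.δξ x hR a u h,
      tay_congr _ _ a (c' := (DTree.planted a u).deg α i) (ofTree_mem_degLE α i le_rfl) hc
        (by rw [DTree.deg_planted])]
    funext y
    rw [recenter, Pi.add_apply, tay_apply, sub_eq_add_neg, ← Finset.sum_neg_distrib,
      Finset.sum_apply]
    congr 1
    refine Finset.sum_congr rfl fun k hk => ?_
    rw [mem_below] at hk
    have h1 : DTree.planted (a + k) u ∈ admissible d :=
      planted_mem_admissible.2 (planted_mem_admissible.1 h)
    have h2 : 0 < (DTree.planted (a + k) u).deg α i := by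
      rw [DTree.deg_planted] at hk ⊢
      rw [sdeg_add, Nat.cast_add]
      linarith
    rw [plusI_ofTree, fc_plusITree hR p i x h1 h2, Pi.smul_apply, smul_eq_mul,
      show mp (fun j (y : Pt d) => y j - x j) k y = mpow (y - x) k by simp [mp, mpow]]
    change -(_ / _ * convModel hR p i x (a + k) (ofTree u) x) = _
    ring
  · rw [planted_mem_admissible] at h
    push Not at h
    obtain ⟨k, rfl⟩ := h hu
    filter_upwards [convModel_X hR i a k] with p hp x
    have h1 := hp x
    have h2 := I_X a k
    have h3 := fun b => plusI_X α i b k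
    rw [X] at h1 h2
    simp only [X] at h3
    rw [h1, h2, map_zero, zero_add, tay_apply]
    simp [h3]

/-! ## The model without recentering -/

/-- The model `Π_x^{i,×}(id ⊗ f_x^i 𝒜_i^+)Δ_i`, which does not depend on `i` and `x`. -/
def bold (hR : IsPreparationMap α R) (p : Data d) (i : Fin 2) (x : Pt d) :
    TSpace d →ₐ[ℝ] Pt d → ℝ := (modelAlg hR p i x).comp (act (gc α R p i x))

theorem bold_apply (hR : IsPreparationMap α R) (p : Data d) (i : Fin 2) (x : Pt d) (σ : TSpace d) :
    bold hR p i x σ = modelAlg hR p i x (act (gc α R p i x) σ) := rfl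

theorem bold_act (hR : IsPreparationMap α R) (p : Data d) (i : Fin 2) (x : Pt d) (σ : TSpace d) :
    bold hR p i x (act (fc α R p i x) σ) = modelAlg hR p i x σ := by
  rw [bold_apply, gc, act_antipode_act]

/-- The action of `f_x^i 𝒜_i^+` adds a jet to `𝓘_a`, and `Π_x^{i,×}` subtracts its own Taylor
polynomial. By `tay_antipode` the two cancel, and only the plain convolution remains; `R` passes
through the action by `renorm_act`. -/
theorem bold_I (hR : IsPreparationMap α R) (i : Fin 2) (a : MIdx d) (s : DTree d) :
    ∀ᶠ p in cancel d, ∀ x, bold hR p i x (I a (ofTree s)) =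
      conv p.K a (bold hR p i x (R (ofTree s))) := by
  set c := s.deg α i + 2 - sdeg a
  have hd : ofTree s ∈ degLE d α i (s.deg α i) := ofTree_mem_degLE α i le_rfl
  have h1 := eventually_evalRight (α := α) (i := i) (S := {u : T d | (u : DTree d).deg α i ≤ s.deg α i})
    (M := fun p => ⨅ x, LinearMap.eqLocus ((modelAlg hR p i x).toLinearMap ∘ₗ I a)
      (convModel hR p i x a +
        tay (A := Pt d → ℝ) (fc α R p i x) (fun j y => y j - x j) a c)) (fun u hu => by
      filter_upwards [modelAlg_I hR i a (c := c) u.2 (by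
        simp only [Set.mem_ofPred_eq] at hu; simp only [c]; linarith)] with p hp
      rw [Submodule.mem_iInf]
      exact hp) (coact α i (ofTree s))
  filter_upwards [h1] with p hp x
  have h2 : act (gc α R p i x) (ofTree s) ∈ degLE d α i (s.deg α i) := act_mem_degLE _ hd
  have h3 : modelAlg hR p i x (I a (act (gc α R p i x) (ofTree s))) =
      convModel hR p i x a (act (gc α R p i x) (ofTree s)) +
        tay (A := Pt d → ℝ) (fc α R p i x) (fun j y => y j - x j) a c
          (act (gc α R p i x) (ofTree s)) := by
    rw [act_apply] at h2 ⊢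
    exact (Submodule.mem_iInf _).1 (hp _ h2) x
  have h4 := fun v : Fin (d + 1) → Pt d → ℝ => tay_antipode (fc α R p i x) v a hd le_rfl
  change ∀ v, tay (gc α R p i x) v a c (ofTree s) = -tay _ _ a c (act (gc α R p i x) (ofTree s))
    at h4
  rw [bold_apply, act_I _ a hd le_rfl, map_add, h3, map_tay, h4, convModel_apply, renorm_act hR,
    bold_apply, add_assoc, add_eq_left, add_neg_eq_zero]
  congr 2
  -- The variables of both jets agree: `y_j - x_j = ((y_j - x_j) + x_j) - x_j`.
  funext j y
  rw [shiftX, map_add, modelAlg_X_single, AlgHom.commutes, gc_plusX, fc_plusX]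
  simp [Pi.algebraMap_apply, sub_eq_add_neg]

/-- The values on `X_j`, `Ξ`, `Ξ̇` and the recursion `bold_I` mention neither the degree nor the
base point. -/
theorem bold_eq (hR : IsPreparationMap α R) (σ : TSpace d) :
    ∀ᶠ p in cancel d, ∀ i x, bold hR p i x σ = bold hR p 0 0 σ := by
  let M : Data d → Submodule ℝ (TSpace d) := fun p => ⨅ (i) (x), LinearMap.eqLocus
    (bold hR p i x).toLinearMap (bold hR p 0 0).toLinearMap
  have hM : ∀ p σ, σ ∈ M p ↔ ∀ i x, bold hR p i x σ = bold hR p 0 0 σ := by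
    intro p σ
    simp [M, Submodule.mem_iInf]
  suffices σ ∈ evSub M by
    rw [mem_evSub] at this
    filter_upwards [this] with p hp using (hM p σ).1 hp
  refine renorm_induction hR _ ?_ (fun j => ?_) ?_ ?_ (fun σ τ hσ hτ => ?_) (fun a s h hs => ?_) σ
  · exact Filter.Eventually.of_forall fun p => (hM p _).2 fun i x => by rw [map_one, map_one]
  · refine Filter.Eventually.of_forall fun p => (hM p _).2 ?_
    have : ∀ i x, bold hR p i x (X (Pi.single j 1)) = fun y => y j := by
      intro i x
      rw [bold_apply, act_mem_polys_X, shiftX, map_add, modelAlg_X_single, AlgHom.commutes, gc_plusX]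
      funext y
      simp [Pi.algebraMap_apply]
    exact fun i x => by rw [this, this]
  · refine Filter.Eventually.of_forall fun p => (hM p _).2 fun i x => ?_
    rw [bold_apply, bold_apply, act_Xi, act_Xi, modelAlg_apply, modelAlg_apply, modelTimes_Xi,
      modelTimes_Xi]
  · refine Filter.Eventually.of_forall fun p => (hM p _).2 fun i x => ?_
    rw [bold_apply, bold_apply, act_dXi, act_dXi, modelAlg_apply, modelAlg_apply, modelTimes_dXi,
      modelTimes_dXi]
  · rw [mem_evSub] at hσ hτ ⊢
    filter_upwards [hσ, hτ] with p hp hp'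
    refine (hM p _).2 fun i x => ?_
    rw [map_mul, map_mul, (hM p _).1 hp, (hM p _).1 hp']
  · rw [mem_evSub] at hs ⊢
    have hs' := (planted_mem_admissible.1 h).1
    filter_upwards [hs, Filter.eventually_all.2 fun i => bold_I hR i a s] with p hp hp'
    refine (hM p _).2 fun i x => ?_
    rw [hp', hp', (hM p _).1 hp]

/-- `Π_x^{i,×}` through `Δ_i` and the model without recentering. -/
theorem bold_act_eq (hR : IsPreparationMap α R) (i : Fin 2) (σ : TSpace d) :
    ∀ᶠ p in cancel d, ∀ (f : TPlus d α i →ₐ[ℝ] ℝ) j x,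
      bold hR p j x (act f σ) = bold hR p 0 0 (act f σ) := by
  have := eventually_act (α := α) i (M := fun p => ⨅ (j) (x), LinearMap.eqLocus
    (bold hR p j x).toLinearMap (bold hR p 0 0).toLinearMap) (fun σ => by
      filter_upwards [bold_eq hR σ] with p hp
      simpa [Submodule.mem_iInf] using hp) σ
  filter_upwards [this] with p hp f
  simpa [Submodule.mem_iInf] using hp f

/-! ## Change of the recentering from `deg_1` to `deg_0` -/

theorem fc_plusI (hR : IsPreparationMap α R) (i : Fin 2) (b : MIdx d) {u : DTree d}
    (hu : u ∈ admissible d) (h : 0 < u.deg α i + 2 - sdeg b) :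
    ∀ᶠ p in cancel d, ∀ x, fc α R p i x (plusI α i b (ofTree u)) =
      -convModel hR p i x b (ofTree u) x := by
  by_cases h' : DTree.planted b u ∈ admissible d
  · refine Filter.Eventually.of_forall fun p x => ?_
    rw [plusI_ofTree, fc_plusITree hR p i x h' (by rwa [DTree.deg_planted])]
  · rw [planted_mem_admissible] at h'
    push Not at h'
    obtain ⟨k, rfl⟩ := h' hu
    filter_upwards [convModel_X hR i b k] with p hp x
    have h1 := hp x
    have h3 := plusI_X α i b k
    rw [X] at h1 h3
    rw [h1, h3]
    simp

/-- The action of `f_x^1` adds the jet up to `deg_1`, while the image of the polynomial part of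
`Δ̂₁` removes its terms from `deg_0` on. What is left has the cutoff of `Δ_0`, so only the
coefficients have to be compared. -/
theorem act_hatAct_planted (hR : IsPreparationMap α R) (a : MIdx d) {s : DTree d}
    (h : DTree.planted a s ∈ admissible d)
    (ih : ∀ᶠ p in cancel d, ∀ x, act (fc α R p 1 x) (hatAct (fc α R p 1 x) (ofTree s)) =
      act (fc α R p 0 x) (ofTree s)) :
    ∀ᶠ p in cancel d, ∀ x, act (fc α R p 1 x) (hatAct (fc α R p 1 x) (I a (ofTree s))) =
      act (fc α R p 0 x) (I a (ofTree s)) := by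
  have hs := (planted_mem_admissible.1 h).1
  set c₀ := (DTree.planted a s).deg α 0 with hc₀
  set c₁ := (DTree.planted a s).deg α 1 with hc₁
  have hc : c₀ ≤ c₁ := DTree.deg_zero_le_deg_one _
  have h1 : ∀ k ∈ below (d := d) c₀, ∀ᶠ p in cancel d, ∀ x,
      fc α R p 1 x (plusI α 1 (a + k) (hatAct (fc α R p 1 x) (ofTree s))) =
        -convModel hR p 1 x (a + k) (hatAct (fc α R p 1 x) (ofTree s)) x := by
    intro k hk
    rw [mem_below, hc₀, DTree.deg_planted] at hk
    have := eventually_evalRight (α := α) (i := 1)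
      (S := {u : T d | s.deg α 0 ≤ (u : DTree d).deg α 1 ∧ (u : DTree d).deg α 1 ≤ s.deg α 1})
      (M := fun p => ⨅ x, LinearMap.eqLocus ((fc α R p 1 x).toLinearMap ∘ₗ plusI α 1 (a + k))
        (-(LinearMap.proj x ∘ₗ convModel hR p 1 x (a + k)))) (fun u hu => by
        filter_upwards [fc_plusI hR 1 (a + k) u.2 (by
          have := hu.1
          rw [sdeg_add, Nat.cast_add]
          linarith)] with p hp
        rw [Submodule.mem_iInf]
        exact hp) (hat α (ofTree s))
    filter_upwards [this] with p hp x
    have h2 := hatAct_mem_degBetween (fc α R p 1 x) s hs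
    rw [hatAct_apply] at h2 ⊢
    exact (Submodule.mem_iInf _).1 (hp _ h2) x
  filter_upwards [ih, (Finset.eventually_all _).2 h1, bold_act_eq hR 0 (R (ofTree s))]
    with p hp hk hb x
  set f₁ := fc α R p 1 x
  set f₀ := fc α R p 0 x
  -- Both functions are the uncentered model evaluated at the same element, by the induction
  -- hypothesis for `s` and since `R` commutes with the actions.
  have hmodel : ∀ b, convModel hR p 1 x b (hatAct f₁ (ofTree s)) =
      convModel hR p 0 x b (ofTree s) := by
    intro b
    rw [convModel_apply, convModel_apply, ← bold_act, ← bold_act, ← renorm_act hR, hp x,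
      renorm_act hR, hb, hb _ 0 x]
  have hcoef : ∀ k ∈ below (d := d) c₀, f₁ (plusI α 1 (a + k) (hatAct f₁ (ofTree s))) =
      f₀ (plusI α 0 (a + k) (ofTree s)) := by
    intro k hk'
    rw [hk k hk' x, hmodel, plusI_ofTree, fc_plusITree hR p 0 x
      (planted_mem_admissible.2 (planted_mem_admissible.1 h))]
    rw [mem_below, hc₀, DTree.deg_planted] at hk'
    rw [DTree.deg_planted, sdeg_add, Nat.cast_add]
    linarith
  have hd : hatAct f₁ (ofTree s) ∈ degLE d α 1 (s.deg α 1) :=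
    degBetween_le_degLE (hatAct_mem_degBetween f₁ s hs)
  rw [hatAct_planted f₁ a h, map_sub, act_I f₁ a (c := c₁) hd (by rw [hc₁, DTree.deg_planted]),
    hp x, act_I f₀ a (c := c₀) (ofTree_mem_degLE α 0 le_rfl) (by rw [hc₀, DTree.deg_planted]),
    add_sub_assoc]
  congr 1
  have hX : (shiftX fun j => f₁ (plusX α 1 j)) = shiftX (d := d) fun j => f₀ (plusX α 0 j) := by
    simp only [f₁, f₀, fc_plusX]
  rw [hatPoly, map_sum, ← hc₀, ← hc₁, tay_apply, tay_apply, ← Finset.sum_filter_add_sum_filter_not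
    (below c₁) (fun l => c₀ ≤ sdeg l)]
  simp only [map_smul, act_X]
  rw [add_sub_cancel_left, hX]
  refine Finset.sum_congr ?_ fun k hk => ?_
  · ext k
    rw [Finset.mem_filter, mem_below, mem_below, not_le]
    exact ⟨fun h => h.2, fun h => ⟨h.trans_le hc, h⟩⟩
  · rw [hcoef k hk]

theorem act_hatAct (hR : IsPreparationMap α R) (σ : TSpace d) :
    ∀ᶠ p in cancel d, ∀ x, act (fc α R p 1 x) (hatAct (fc α R p 1 x) σ) =
      act (fc α R p 0 x) σ := by
  let M : Data d → Submodule ℝ (TSpace d) := fun p => ⨅ x, LinearMap.eqLocus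
    ((act (fc α R p 1 x)).comp (hatAct (fc α R p 1 x))).toLinearMap (act (fc α R p 0 x)).toLinearMap
  have hM : ∀ p σ, σ ∈ M p ↔ ∀ x, act (fc α R p 1 x) (hatAct (fc α R p 1 x) σ) =
      act (fc α R p 0 x) σ := by
    intro p σ
    simp [M, Submodule.mem_iInf]
  have hev : ∀ σ, σ ∈ evSub M ↔ ∀ᶠ p in cancel d, ∀ x,
      act (fc α R p 1 x) (hatAct (fc α R p 1 x) σ) = act (fc α R p 0 x) σ := fun σ => by
    rw [mem_evSub]; simp only [hM]
  rw [← hev]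
  refine mem_of_ofTree_mem (fun t => ?_) σ
  induction t using DTree.generate with
  | one =>
    intro _
    rw [hev, ofTree_one]
    exact Filter.Eventually.of_forall fun p x => by simp
  | hX j =>
    intro _
    refine (hev (X (Pi.single j 1))).2 (Filter.Eventually.of_forall fun p x => ?_)
    rw [hatAct_X, act_X, act_X]
    simp only [fc_plusX]
  | hXi =>
    intro _
    refine (hev Xi).2 (Filter.Eventually.of_forall fun p x => ?_)
    rw [hatAct_Xi, act_Xi, act_Xi]
  | hdXi =>
    intro _
    refine (hev dXi).2 (Filter.Eventually.of_forall fun p x => ?_)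
    rw [hatAct_dXi, act_dXi, act_dXi]
  | mul s t hs ht =>
    intro h
    rw [mul_mem_admissible] at h
    have h1 := (hev _).1 (hs h.1)
    have h2 := (hev _).1 (ht h.2)
    rw [hev, ofTree_mul]
    filter_upwards [h1, h2] with p hp hp' x
    rw [map_mul, map_mul, map_mul, hp, hp']
  | planted a s hs =>
    intro h
    rw [hev, ← I_ofTree]
    exact act_hatAct_planted hR a h ((hev _).1 (hs (planted_mem_admissible.1 h).1))

/-! ### Trees without `Ξ̇` -/

/-- Since `Δ̂₁` is trivial without `Ξ̇`, the identity `act_hatAct` compares `Δ_1` with `Δ_0`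
directly. -/
theorem act_fc_of_dotless (hR : IsPreparationMap α R) {σ : TSpace d}
    (hσ : σ ∈ treeSpan (dotless d)) :
    ∀ᶠ p in cancel d, ∀ x, act (fc α R p 1 x) σ = act (fc α R p 0 x) σ := by
  filter_upwards [act_hatAct hR σ] with p hp x
  rw [← hp x, hatAct_of_dotless _ hσ]

/-- Inverses of equal maps are equal. The equality is applied at an element that itself depends on
the data, hence the uniform version over characters. -/
theorem act_gc_of_dotless (hR : IsPreparationMap α R) {σ : TSpace d}
    (hσ : σ ∈ treeSpan (dotless d)) :
    ∀ᶠ p in cancel d, ∀ x, act (gc α R p 1 x) σ = act (gc α R p 0 x) σ := by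
  have := eventually_act_dotless (α := α) 0 (M := fun p => ⨅ x, LinearMap.eqLocus
    (act (fc α R p 1 x)).toLinearMap (act (fc α R p 0 x)).toLinearMap) (fun σ hσ => by
      filter_upwards [act_fc_of_dotless hR hσ] with p hp
      rw [Submodule.mem_iInf]
      exact hp) hσ
  filter_upwards [this] with p hp x
  have h1 : act (fc α R p 1 x) (act (gc α R p 0 x) σ) = act (fc α R p 0 x) (act (gc α R p 0 x) σ) :=
    (Submodule.mem_iInf _).1 (hp (gc α R p 0 x)) x
  have h2 : act (fc α R p 0 x) (act (gc α R p 0 x) σ) = σ := act_act_antipode _ σ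
  rw [h2] at h1
  conv_lhs => rw [← h1]
  exact act_antipode_act _ _

theorem modelAlg_of_dotless (hR : IsPreparationMap α R) {σ : TSpace d}
    (hσ : σ ∈ treeSpan (dotless d)) :
    ∀ᶠ p in cancel d, ∀ x, modelAlg hR p 1 x σ = modelAlg hR p 0 x σ := by
  filter_upwards [act_fc_of_dotless hR hσ, bold_act_eq hR 0 σ] with p hp hb x
  rw [← bold_act, ← bold_act, hp, hb, hb _ 0 x]

end

section

variable {d : ℕ} {α : ℝ} {R : TSpace d →ₗ[ℝ] TSpace d}

/-! ## The Malliavin derivative of the model -/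

/-- `F` is a polynomial with smooth coefficients, whose coefficient of first order is `F₁`. -/
def IsPolyDer (F : ℝ → Pt d → ℝ) (F₁ : Pt d → ℝ) : Prop :=
  ∃ q : Polynomial (smooth d), (∀ ε, F ε = (q.eval (algebraMap ℝ (smooth d) ε) : smooth d)) ∧
    (q.coeff 1 : Pt d → ℝ) = F₁

theorem isPolyDer_const {f : Pt d → ℝ} (hf : f ∈ smooth d) : IsPolyDer (fun _ => f) 0 :=
  ⟨Polynomial.C ⟨f, hf⟩, fun ε => by simp, by simp⟩

theorem IsPolyDer.add {F G : ℝ → Pt d → ℝ} {F₁ G₁ : Pt d → ℝ} (hF : IsPolyDer F F₁)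
    (hG : IsPolyDer G G₁) : IsPolyDer (fun ε => F ε + G ε) (F₁ + G₁) := by
  obtain ⟨q, h1, h2⟩ := hF
  obtain ⟨r, h3, h4⟩ := hG
  exact ⟨q + r, fun ε => by beta_reduce; rw [Polynomial.eval_add, h1, h3]; rfl,
    by rw [Polynomial.coeff_add, ← h2, ← h4]; rfl⟩

theorem IsPolyDer.smul {F : ℝ → Pt d → ℝ} {F₁ : Pt d → ℝ} (hF : IsPolyDer F F₁) (r : ℝ) :
    IsPolyDer (fun ε => r • F ε) (r • F₁) := by
  obtain ⟨q, h1, h2⟩ := hF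
  exact ⟨r • q, fun ε => by beta_reduce; rw [Polynomial.eval_smul, h1]; rfl,
    by rw [Polynomial.coeff_smul, ← h2]; rfl⟩

theorem IsPolyDer.mul {F G : ℝ → Pt d → ℝ} {F₁ G₁ : Pt d → ℝ} (hF : IsPolyDer F F₁)
    (hG : IsPolyDer G G₁) : IsPolyDer (fun ε => F ε * G ε) (F₁ * G 0 + F 0 * G₁) := by
  obtain ⟨q, h1, h2⟩ := hF
  obtain ⟨r, h3, h4⟩ := hG
  refine ⟨q * r, fun ε => by beta_reduce; rw [Polynomial.eval_mul, h1, h3]; rfl, ?_⟩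
  rw [Polynomial.mul_coeff_one, ← h2, ← h4, h1, h3, map_zero, ← Polynomial.coeff_zero_eq_eval_zero,
    ← Polynomial.coeff_zero_eq_eval_zero, add_comm]
  rfl

/-- A linear operator acts on a polynomial in `ε` coefficient by coefficient. Thus the derivative in
`ε` commutes with the recentered convolution without any exchange of limits. -/
theorem IsPolyDer.map (Φ : smooth d →ₗ[ℝ] smooth d) {F : ℝ → Pt d → ℝ} {F₁ : Pt d → ℝ}
    (hF : IsPolyDer F F₁) (hs : ∀ ε, F ε ∈ smooth d) (hs₁ : F₁ ∈ smooth d) :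
    IsPolyDer (d := d) (fun ε => Φ ⟨F ε, hs ε⟩) (Φ ⟨F₁, hs₁⟩) := by
  obtain ⟨q, h1, h2⟩ := hF
  have key : ∀ q : Polynomial (smooth d), ∃ r : Polynomial (smooth d),
      (∀ ε : ℝ, Φ (q.eval (algebraMap ℝ _ ε)) = r.eval (algebraMap ℝ _ ε)) ∧
        r.coeff 1 = Φ (q.coeff 1) := by
    intro q
    induction q using Polynomial.induction_on' with
    | add q q' h h' =>
      obtain ⟨r, h3, h4⟩ := h
      obtain ⟨r', h5, h6⟩ := h'
      exact ⟨r + r', fun ε => by rw [Polynomial.eval_add, Polynomial.eval_add, map_add, h3, h5],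
        by rw [Polynomial.coeff_add, Polynomial.coeff_add, map_add, h4, h6]⟩
    | monomial n f =>
      refine ⟨Polynomial.monomial n (Φ f), fun ε => ?_, ?_⟩
      · rw [Polynomial.eval_monomial, Polynomial.eval_monomial, ← map_pow, mul_comm,
          ← Algebra.smul_def, map_smul, mul_comm, ← Algebra.smul_def]
      · rw [Polynomial.coeff_monomial, Polynomial.coeff_monomial, apply_ite Φ, map_zero]
  obtain ⟨r, h3, h4⟩ := key q
  refine ⟨r, fun ε => ?_, ?_⟩
  · rw [← h3, ← show (⟨F ε, hs ε⟩ : smooth d) = _ from Subtype.ext (h1 ε)]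
  · rw [h4, show q.coeff 1 = ⟨F₁, hs₁⟩ from Subtype.ext h2]

theorem IsPolyDer.hasDerivAt {F : ℝ → Pt d → ℝ} {F₁ : Pt d → ℝ} (hF : IsPolyDer F F₁) (z : Pt d) :
    HasDerivAt (fun ε => F ε z) (F₁ z) 0 := by
  obtain ⟨q, h1, h2⟩ := hF
  let e : smooth d →+* ℝ := (Pi.evalRingHom (fun _ : Pt d => ℝ) z).comp (smooth d).val.toRingHom
  have h3 : ∀ ε, F ε z = (q.map e).eval ε := by
    intro ε
    rw [h1, Polynomial.eval_map]
    exact (Polynomial.eval₂_at_apply e (algebraMap ℝ (smooth d) ε)).symm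
  have h4 := (q.map e).hasDerivAt 0
  rw [← Polynomial.coeff_zero_eq_eval_zero, Polynomial.coeff_derivative, Polynomial.coeff_map] at h4
  have h5 : e (q.coeff (0 + 1)) * ((0 : ℕ) + 1) = F₁ z := by
    rw [← h2]; simp; rfl
  rw [h5] at h4
  simpa only [h3] using h4

/-- Recentered convolution as an operator on smooth functions. -/
def recenterL (p : Data d) (a : MIdx d) (c : ℝ) (x : Pt d) : smooth d →ₗ[ℝ] smooth d where
  toFun f := ⟨recenter p.K a c x f, contDiff_recenter p.integrable p.compact a c x f.2⟩
  map_add' f g := Subtype.ext (recenter_add p.integrable p.compact a c x f.2 g.2)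
  map_smul' r f := Subtype.ext (recenter_smul a c x r f.2)

/-- The data with noise `ξ + ε δξ`. -/
def Data.shift (p : Data d) (ε : ℝ) : Data d where
  K := p.K
  ξ := p.ξ + ε • p.δξ
  δξ := p.δξ
  integrable := p.integrable
  compact := p.compact
  smooth_ξ := p.smooth_ξ.add (contDiff_const.smul p.smooth_δξ)
  smooth_δξ := p.smooth_δξ

theorem modelAlg_shift_zero (hR : IsPreparationMap α R) (p : Data d) (i : Fin 2) (x : Pt d)
    (σ : TSpace d) : modelAlg hR (p.shift 0) i x σ = modelAlg hR p i x σ := by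
  rw [modelAlg_apply, modelAlg_apply]
  simp [Data.shift]

/-- All trees of `D_Ξ s` have the `deg_0` of `s`, so a single recentering operator, the one
belonging to `𝓘_a(s)`, serves all of them. -/
theorem modelAlg_I_malliavinD (hR : IsPreparationMap α R) (p : Data d) (x : Pt d) (a : MIdx d)
    {s : DTree d} (hs : s ∈ admissible d) :
    modelAlg hR p 0 x (I a (malliavinD (ofTree s))) =
      recenterL p a ((DTree.planted a s).deg α 0) x
        ⟨modelAlg hR p 0 x (R (malliavinD (ofTree s))), modelAlg_mem_smooth hR p 0 x _⟩ := by
  let m : TSpace d →ₗ[ℝ] smooth d :=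
    ((modelAlg hR p 0 x).toLinearMap ∘ₗ R).codRestrict (smooth d).toSubmodule
      fun σ => modelAlg_mem_smooth hR p 0 x _
  refine treeSpan_induction (M := LinearMap.eqLocus ((modelAlg hR p 0 x).toLinearMap ∘ₗ I a)
    ((smooth d).val.toLinearMap ∘ₗ recenterL p a ((DTree.planted a s).deg α 0) x ∘ₗ m))
    (malliavinD_mem_treeSpan (α := α) hs) fun u hu => ?_
  have h : DTree.planted a (u : DTree d) ∈ admissible d := by
    refine planted_mem_admissible.2 ⟨u.2, fun k hk => ?_⟩
    have := hu.2
    rw [hk, DTree.dots_root] at this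
    omega
  change modelTimes α 0 R p.K p.ξ p.δξ x (I a (ofTree (u : DTree d))) = _
  rw [modelTimes_planted 0 p.K p.ξ p.δξ x hR a u h, DTree.deg_planted, hu.1, ← DTree.deg_planted]
  rfl

theorem treeSpan_inter {S S' : Set (T d)} {σ : TSpace d} (h : σ ∈ treeSpan S)
    (h' : σ ∈ treeSpan S') : σ ∈ treeSpan (S ∩ S') := Set.subset_inter h h'

/-- Multiplicativity matches the Leibniz rule. On `𝓘_a(s)` the recentering operator does not depend
on the noise, and `R D_Ξ = D_Ξ R` identifies the first-order coefficient at `R s`. -/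
theorem isPolyDer_model (hR : IsPreparationMap α R) (hRQ : R ∘ₗ Q0 = Q0 ∘ₗ R) (p : Data d)
    (x : Pt d) {σ : TSpace d} (hσ : σ ∈ treeSpan (dotless d)) :
    IsPolyDer (fun ε => modelAlg hR (p.shift ε) 0 x σ) (modelAlg hR p 0 x (malliavinD σ)) := by
  let M : Submodule ℝ (TSpace d) :=
    { carrier := {σ | IsPolyDer (fun ε => modelAlg hR (p.shift ε) 0 x σ)
        (modelAlg hR p 0 x (malliavinD σ))}
      zero_mem' := by
        rw [Set.mem_ofPred_eq]
        simpa using isPolyDer_const (zero_mem (smooth d))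
      add_mem' := by
        intro σ τ h h'
        rw [Set.mem_ofPred_eq] at h h' ⊢
        simpa using h.add h'
      smul_mem' := by
        intro r σ h
        rw [Set.mem_ofPred_eq] at h ⊢
        simpa using h.smul r }
  have hM : ∀ σ, σ ∈ M ↔ IsPolyDer (fun ε => modelAlg hR (p.shift ε) 0 x σ)
      (modelAlg hR p 0 x (malliavinD σ)) := fun σ => Iff.rfl
  have hconst : ∀ σ f, f ∈ smooth d → (∀ ε, modelAlg hR (p.shift ε) 0 x σ = f) →
      malliavinD σ = 0 → σ ∈ M := by
    intro σ f hf h h'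
    rw [hM, h', map_zero]
    simp only [h]
    exact isPolyDer_const hf
  suffices ∀ t : DTree d, t ∈ admissible d → t.dots = 0 → ofTree t ∈ M from
    treeSpan_induction hσ fun u hu => this u u.2 hu
  refine noise_induction (P := fun t => t.dots = 0 → ofTree t ∈ M) (fun _ => ?_) (fun j _ => ?_)
    (fun _ => ?_) (fun h => ?_) (fun s t hs ht h => ?_) (fun a s h hs hu h0 => ?_)
  · exact hconst _ 1 (one_mem _) (fun ε => by rw [ofTree_one, map_one])
      (by rw [ofTree_one, malliavinD_one])
  · exact hconst (X (Pi.single j 1)) _ (contDiff_mpow x _)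
      (fun ε => by rw [modelAlg_apply, modelTimes_X]) (malliavinD_X _)
  · change Xi ∈ M
    refine (hM _).2 ⟨Polynomial.C ⟨p.ξ, mem_smooth.2 p.smooth_ξ⟩ +
      Polynomial.X * Polynomial.C ⟨p.δξ, mem_smooth.2 p.smooth_δξ⟩, fun ε => ?_, ?_⟩
    · beta_reduce
      rw [modelAlg_apply, modelTimes_Xi]
      simp only [Polynomial.eval_add, Polynomial.eval_mul, Polynomial.eval_C, Polynomial.eval_X]
      rw [← Algebra.smul_def]
      rfl
    · rw [malliavinD_Xi, modelAlg_apply, modelTimes_dXi]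
      simp [Polynomial.coeff_C]
  · simp [DTree.dots_root] at h
  · rw [DTree.dots_mul] at h
    have h1 := (hM _).1 (hs (by omega))
    have h2 := (hM _).1 (ht (by omega))
    rw [ofTree_mul, hM]
    have := h1.mul h2
    simp only [modelAlg_shift_zero] at this
    simpa [malliavinD_mul] using this
  · rw [DTree.dots_planted] at h0
    have hs' := (planted_mem_admissible.1 h).1
    have hsd : ofTree s ∈ treeSpan (dotless d) := ofTree_mem_treeSpan fun _ => h0
    -- The trees of `R s - s` have fewer noises by triangularity and contain no `Ξ̇` because `R`
    -- commutes with `𝒬₀`; the induction hypothesis needs both.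
    have h1 : R (ofTree s) ∈ M := by
      rw [← sub_add_cancel (R (ofTree s)) (ofTree s)]
      refine add_mem ?_ (hs h0)
      exact treeSpan_induction (treeSpan_inter (hR.triangular ⟨s, hs'⟩)
        (sub_mem (renorm_mem_dotless hRQ hsd) hsd)) fun u hu' => hu u u.2 hu'.1.2 hu'.2
    have h2 := IsPolyDer.map (recenterL p a ((DTree.planted a s).deg α 0) x) ((hM _).1 h1)
      (fun ε => modelAlg_mem_smooth hR _ 0 x _) (modelAlg_mem_smooth hR _ 0 x _)
    rw [← I_ofTree, hM, malliavinD_I, modelAlg_I_malliavinD hR p x a hs']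
    simp only [hR.malliavinD_comm _ hsd]
    convert h2 using 1
    funext ε
    rw [modelAlg_apply, modelTimes_planted 0 _ _ _ x hR a s h]
    rfl

theorem malliavin_model (hR : IsPreparationMap α R) (hRQ : R ∘ₗ Q0 = Q0 ∘ₗ R) (p : Data d)
    (x : Pt d) {σ : TSpace d} (hσ : σ ∈ treeSpan (dotless d)) :
    HasMalliavin (fun η => modelTimes α 0 R p.K η p.δξ x σ) p.ξ p.δξ ∧
      malliavin (fun η => modelTimes α 0 R p.K η p.δξ x σ) p.ξ p.δξ =
        modelAlg hR p 0 x (malliavinD σ) := by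
  have h := (isPolyDer_model hR hRQ p x hσ).hasDerivAt
  exact ⟨fun z => (h z).differentiableAt, funext fun z => (h z).deriv⟩

/-! ## Vanishing at the base point -/

/-- The functions vanishing to order `N` at `y`. -/
def vanishing (d : ℕ) (N : ℤ) (y : Pt d) : Submodule ℝ (Pt d → ℝ) where
  carrier := {F | VanishesToOrder N F y}
  zero_mem' := by
    rw [Set.mem_ofPred_eq]
    refine ⟨contDiff_const, fun n _ => ?_⟩
    have := mderiv_smul n 0 (f := (0 : Pt d → ℝ)) contDiff_const
    rw [zero_smul, zero_smul] at this
    rw [this]; rfl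
  add_mem' := by
    intro F G h h'
    rw [Set.mem_ofPred_eq] at h h' ⊢
    refine ⟨h.1.add h'.1, fun n hn => ?_⟩
    rw [mderiv_map_add n h.1 h'.1, Pi.add_apply, h.2 n hn, h'.2 n hn, add_zero]
  smul_mem' := by
    intro r F h
    rw [Set.mem_ofPred_eq] at h ⊢
    refine ⟨contDiff_const.smul h.1, fun n hn => ?_⟩
    rw [mderiv_smul n r h.1, Pi.smul_apply, h.2 n hn, smul_zero]

theorem mem_vanishing {N : ℤ} {y : Pt d} {F : Pt d → ℝ} :
    F ∈ vanishing d N y ↔ VanishesToOrder N F y := Iff.rfl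

theorem sdeg_mono {m n : MIdx d} (h : m ≤ n) : sdeg m ≤ sdeg n :=
  Finset.sum_le_sum fun j _ => Nat.mul_le_mul_left _ (h j)

theorem vanishing_mul {N : ℤ} {y : Pt d} {F g : Pt d → ℝ} (hF : F ∈ vanishing d N y)
    (hg : g ∈ smooth d) : F * g ∈ vanishing d N y :=
  mem_vanishing.2 ⟨mem_smooth.1 (mul_mem (mem_smooth.2 hF.1) hg), fun n hn =>
    mderiv_mul_eq_zero y n F g hF.1 hg fun m hm => hF.2 m (le_trans (by
      exact_mod_cast sdeg_mono hm) hn)⟩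

/-- Positivity of `deg_i(𝓘_{a+n}(u))` says that `|n|_𝔰` lies below the order of recentering of
`𝓘_a(u)`, which is the condition of `mderiv_recenter`. -/
theorem modelAlg_I_vanishing (hR : IsPreparationMap α R) (p : Data d) (i : Fin 2) (y : Pt d)
    (N : ℤ) (a : MIdx d) {σ : TSpace d}
    (h : ∀ n : MIdx d, (sdeg n : ℤ) ≤ N → ∀ u ∈ σ.coeff.support,
      0 < (DTree.planted (a + n) (u : DTree d)).deg α i) :
    modelAlg hR p i y (I a σ) ∈ vanishing d N y := by
  have hσ : σ ∈ treeSpan {u : T d | ∀ n : MIdx d, (sdeg n : ℤ) ≤ N →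
      0 < (DTree.planted (a + n) (u : DTree d)).deg α i} := fun u hu n hn => h n hn u hu
  refine treeSpan_induction (M := (vanishing d N y).comap ((modelAlg hR p i y).toLinearMap ∘ₗ I a))
    hσ fun u hu => ?_
  change modelAlg hR p i y (I a (ofTree (u : DTree d))) ∈ vanishing d N y
  by_cases h : DTree.planted a (u : DTree d) ∈ admissible d
  · refine mem_vanishing.2 ⟨modelAlg_mem_smooth hR p i y _, fun n hn => ?_⟩
    rw [modelAlg_apply, modelTimes_planted i p.K p.ξ p.δξ y hR a u h]
    refine mderiv_recenter p.integrable p.compact a _ y (modelAlg_mem_smooth hR p i y _) ?_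
    have := hu n hn
    rw [DTree.deg_planted, sdeg_add, Nat.cast_add] at this
    rw [DTree.deg_planted]
    linarith
  · rw [I_ofTree, ofTree_of_not_mem h, map_zero]
    exact zero_mem _

/-! ### The terms of `D_Ξ τ` in which a branch is differentiated. -/

/-- The part of `D_Ξ τ` without `Ξ̇` at the root. -/
def branchD : TSpace d →ₗ[ℝ] TSpace d := malliavinD - QRoot ∘ₗ malliavinD

theorem branchD_apply (σ : TSpace d) : branchD σ = malliavinD σ - QRoot (malliavinD σ) := rfl

theorem branchD_mul {σ τ : TSpace d} (hσ : σ ∈ treeSpan (dotless d))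
    (hτ : τ ∈ treeSpan (dotless d)) : branchD (σ * τ) = branchD σ * τ + σ * branchD τ := by
  rw [branchD_apply, branchD_apply, branchD_apply, malliavinD_mul, map_add,
    QRoot_mul_of_dotless _ hτ, mul_comm σ (malliavinD τ), QRoot_mul_of_dotless _ hσ]
  ring

theorem branchD_I (a : MIdx d) (σ : TSpace d) : branchD (I a σ) = I a (malliavinD σ) := by
  rw [branchD_apply, malliavinD_I, QRoot_I, sub_zero]

theorem branchD_root (k : MIdx d) (l : ℕ) : branchD (ofTree (DTree.root k l 0)) = 0 := by
  induction l with
  | zero =>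
    have := malliavinD_X k
    rw [X] at this
    rw [branchD_apply, this, map_zero, sub_zero]
  | succ l ih =>
    have h : DTree.root k (l + 1) 0 = DTree.root k l 0 * DTree.root 0 1 0 := by
      rw [DTree.root_mul_root]; simp
    have h' : branchD (ofTree (DTree.root (0 : MIdx d) 1 0)) = 0 := by
      have := malliavinD_Xi (d := d)
      rw [Xi] at this
      rw [branchD_apply, this, QRoot_dXi, sub_self]
    have e1 : ofTree (DTree.root k l 0) ∈ treeSpan (dotless d) :=
      ofTree_mem_treeSpan fun _ => DTree.dots_root _ _ _
    have e2 : ofTree (DTree.root (0 : MIdx d) 1 0) ∈ treeSpan (dotless d) :=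
      ofTree_mem_treeSpan fun _ => DTree.dots_root _ _ _
    rw [h, ofTree_mul, branchD_mul e1 e2, ih, h', zero_mul, mul_zero, add_zero]

/-- Branches at the root are peeled off one by one. By the Leibniz rule each term has one factor
`𝓘_a(D_Ξ σ)`, which vanishes to order `N`, and smooth remaining factors, which preserve this. -/
theorem modelAlg_branchD_tree (hR : IsPreparationMap α R) (p : Data d) (i : Fin 2) (y : Pt d)
    (N : ℤ) (t : DTree d) (ht : t.dots = 0)
    (h : ∀ (a : MIdx d) (σ ρ : DTree d), t = DTree.graft a σ ρ →
      ∀ n : MIdx d, (sdeg n : ℤ) ≤ N → ∀ u ∈ (malliavinD (ofTree σ)).coeff.support,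
        0 < (DTree.planted (a + n) (u : DTree d)).deg α i) :
    modelAlg hR p i y (branchD (ofTree t)) ∈ vanishing d N y := by
  induction t using DTree.induct with
  | h0 k l m =>
    rw [DTree.dots_root] at ht
    rw [ht, branchD_root, map_zero]
    exact zero_mem _
  | h1 a s t _ iht =>
    have h1 : DTree.graft a s t = DTree.planted a s * t := (DTree.planted_mul a s t).symm
    rw [h1, DTree.dots_mul, DTree.dots_planted] at ht
    rw [h1, ofTree_mul, branchD_mul
      (ofTree_mem_treeSpan fun _ => by
        change (DTree.planted a s).dots = 0
        rw [DTree.dots_planted]; omega)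
      (ofTree_mem_treeSpan fun _ => by change t.dots = 0; omega), ← I_ofTree, branchD_I, map_add,
      map_mul, map_mul, mul_comm (modelAlg hR p i y (I a (ofTree s)))]
    refine add_mem (vanishing_mul (modelAlg_I_vanishing hR p i y N a (h a s t rfl))
      (modelAlg_mem_smooth hR p i y _)) (vanishing_mul (iht (by omega) ?_)
      (modelAlg_mem_smooth hR p i y _))
    -- A branch of the remaining tree `t` is also a branch of the full tree; `DTree.graft_swap`
    -- brings it to the front, so the hypothesis is inherited.
    intro b σ ρ hρ
    refine h b σ (DTree.graft a s ρ) ?_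
    rw [hρ, DTree.graft_swap]

theorem modelAlg_branchD (hR : IsPreparationMap α R) {T₀ : Set (T d)}
    (hT₀ : SatisfiesAssumption α T₀) (p : Data d) (y : Pt d) {σ : TSpace d}
    (hσ : σ ∈ treeSpan T₀) :
    modelAlg hR p 1 y (branchD σ) ∈ vanishing d (orderN d α) y :=
  treeSpan_induction (M := (vanishing d (orderN d α) y).comap
    ((modelAlg hR p 1 y).toLinearMap ∘ₗ branchD)) hσ fun u hu =>
    modelAlg_branchD_tree hR p 1 y _ u (hT₀.no_dot u hu) (hT₀.deg_pos u hu)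

/-! ## The main identity -/

theorem act_mem_treeSpan {T₀ : Set (T d)} (hT₀ : SatisfiesAssumption α T₀)
    (f : TPlus d α 0 →ₐ[ℝ] ℝ) {σ : TSpace d} (hσ : σ ∈ treeSpan T₀) :
    act f σ ∈ treeSpan T₀ := by
  refine treeSpan_induction (M := (treeSpan T₀).comap (act f).toLinearMap) hσ fun u hu => ?_
  rw [Submodule.mem_comap, AlgHom.toLinearMap_apply, act_apply]
  obtain ⟨z, hz⟩ := hT₀.coact_mem u hu
  rw [← hz]
  clear hz
  induction z with
  | zero => rw [map_zero, map_zero]; exact zero_mem _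
  | add x y hx hy => rw [map_add, map_add]; exact add_mem hx hy
  | tmul s q =>
    rw [TensorProduct.map_tmul, evalRight_tmul]
    exact Submodule.smul_mem _ _ s.2

variable (α R) in
/-- The translation `(id ⊗ f_y^1 𝒜_1^+)Δ_1 (id ⊗ f_x^0)Δ_0`. -/
def transl (p : Data d) (y x : Pt d) : TSpace d →ₐ[ℝ] TSpace d :=
  (act (gc α R p 1 y)).comp (act (fc α R p 0 x))

theorem transl_apply (p : Data d) (y x : Pt d) (σ : TSpace d) :
    transl α R p y x σ = act (gc α R p 1 y) (act (fc α R p 0 x) σ) := rfl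

theorem isTranslation_transl (p : Data d) (y x : Pt d) : IsTranslation (transl α R p y x) :=
  (isTranslation_act _).comp (isTranslation_act _)

/-- `Γ_{yx}^1` is the action of a convolution of characters, hence `act (f_y^1 𝒜_1^+) ∘ act f_x^1`.
The second factor merges with `Δ̂₁` into `act f_x^0`. -/
theorem dGamma_eq (hR : IsPreparationMap α R) (σ : TSpace d) :
    ∀ᶠ p in cancel d, ∀ y x, dGamma α R p.K p.ξ p.δξ y x σ =
      Q0 (transl α R p y x (malliavinD σ)) := by
  filter_upwards [act_hatAct hR (malliavinD σ)] with p hp y x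
  rw [transl_apply, ← hp x, gc, ← act_charConv, act_apply, hatAct_apply]
  rfl

/-- Both sides are the uncentered model at `act f_x^0 σ`, read once from `i = 1` at `y` and once
from `i = 0` at `x`. -/
theorem modelAlg_transl (hR : IsPreparationMap α R) (σ : TSpace d) :
    ∀ᶠ p in cancel d, ∀ y x, modelAlg hR p 1 y (transl α R p y x σ) = modelAlg hR p 0 x σ := by
  filter_upwards [bold_act_eq hR 0 σ] with p hb y x
  rw [transl_apply, ← bold_apply, hb, ← bold_act, hb _ 0 x]

theorem modelAlg_Q0_transl (hR : IsPreparationMap α R) (σ : TSpace d) :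
    ∀ᶠ p in cancel d, ∀ y x, modelAlg hR p 0 y (Q0 (transl α R p y x σ)) =
      modelAlg hR p 1 y (Q0 (transl α R p y x σ)) := by
  have h1 : ∀ σ, ∀ᶠ p in cancel d, σ ∈ (⨅ y, LinearMap.eqLocus
      ((modelAlg hR p 0 y).toLinearMap ∘ₗ Q0) ((modelAlg hR p 1 y).toLinearMap ∘ₗ Q0) :
        Submodule ℝ (TSpace d)) := fun σ => by
    filter_upwards [modelAlg_of_dotless hR (Q0_mem_dotless σ)] with p hp
    rw [Submodule.mem_iInf]
    exact fun y => (hp y).symm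
  -- Two characters depending on the data act in succession, so uniformity over characters is
  -- invoked twice: for `Δ_1` inside and for `Δ_0` outside.
  have h2 := eventually_act (α := α) 0 (M := fun p => ⨅ f : TPlus d α 1 →ₐ[ℝ] ℝ,
    (⨅ y, LinearMap.eqLocus ((modelAlg hR p 0 y).toLinearMap ∘ₗ Q0)
      ((modelAlg hR p 1 y).toLinearMap ∘ₗ Q0)).comap (act f).toLinearMap) (fun σ => by
      filter_upwards [eventually_act (α := α) 1 h1 σ] with p hp
      rw [Submodule.mem_iInf]
      exact hp) σ
  filter_upwards [h2] with p hp y x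
  have h3 := (Submodule.mem_iInf _).1 (hp (fc α R p 0 x)) (gc α R p 1 y)
  rw [Submodule.mem_comap] at h3
  exact (Submodule.mem_iInf _).1 h3 y

/-- The assumption gives stability of `𝒯₀` under `Δ_0` only. Its trees contain no `Ξ̇`, so the
action of `f_y^1 𝒜_1^+` may be replaced by that of `f_y^0 𝒜_0^+`. -/
theorem transl_mem_treeSpan (hR : IsPreparationMap α R) {T₀ : Set (T d)}
    (hT₀ : SatisfiesAssumption α T₀) {σ : TSpace d} (hσ : σ ∈ treeSpan T₀) :
    ∀ᶠ p in cancel d, ∀ y x, transl α R p y x σ ∈ treeSpan T₀ := by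
  have hd : σ ∈ treeSpan (dotless d) := treeSpan_mono (fun u hu => hT₀.no_dot u hu) hσ
  have := eventually_act_dotless (α := α) 0 (M := fun p => ⨅ y, LinearMap.eqLocus
    (act (gc α R p 1 y)).toLinearMap (act (gc α R p 0 y)).toLinearMap) (fun σ hσ => by
      filter_upwards [act_gc_of_dotless hR hσ] with p hp
      rw [Submodule.mem_iInf]
      exact hp) hd
  filter_upwards [this] with p hp y x
  have h1 : act (gc α R p 1 y) (act (fc α R p 0 x) σ) = act (gc α R p 0 y) (act (fc α R p 0 x) σ) :=
    (Submodule.mem_iInf _).1 (hp (fc α R p 0 x)) y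
  rw [transl_apply, h1]
  exact act_mem_treeSpan hT₀ _ (act_mem_treeSpan hT₀ _ hσ)

/-- Write `𝒬₀ L D_Ξ σ = L D_Ξ σ - D_Ξ L σ` and pull everything back to `Π_y^{1,×}`: the terms with
`L D_Ξ σ` cancel against `Π_x^{0,×} D_Ξ σ`, and what remains is `-Π_y^{1,×}` of the differentiated
branches of `L σ ∈ 𝒯₀`. -/
theorem modelAlg_dGamma (hR : IsPreparationMap α R) {T₀ : Set (T d)}
    (hT₀ : SatisfiesAssumption α T₀) {σ : TSpace d} (hσ : σ ∈ treeSpan T₀) :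
    ∀ᶠ p in cancel d, ∀ y x,
      modelAlg hR p 0 y (Q0 (transl α R p y x (malliavinD σ))) - modelAlg hR p 0 x (malliavinD σ) +
        modelAlg hR p 0 x (QRoot (malliavinD σ)) ∈ vanishing d (orderN d α) y := by
  have hd : σ ∈ treeSpan (dotless d) := treeSpan_mono (fun u hu => hT₀.no_dot u hu) hσ
  filter_upwards [modelAlg_Q0_transl hR (malliavinD σ), modelAlg_transl hR (malliavinD σ),
    modelAlg_transl hR (QRoot (malliavinD σ)), transl_mem_treeSpan hR hT₀ hσ]
    with p h1 h2 h3 h4 y x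
  have hL := isTranslation_transl (α := α) (R := R) p y x
  have h5 := hL.malliavinD_apply hd
  have h6 : Q0 (transl α R p y x (malliavinD σ)) = transl α R p y x (malliavinD σ) -
      malliavinD (transl α R p y x σ) := by rw [← h5]; abel
  rw [h1, h6, map_sub, h2, ← h3 y x, ← hL.QRoot_malliavinD hd]
  have h7 := neg_mem (modelAlg_branchD hR hT₀ p y (h4 y x))
  rw [branchD_apply, map_sub] at h7
  convert h7 using 1
  abel

end

end

end MalliavinTree

/-! ### Conclusion: the identities for `Π^{0,×}` and for `Π^0`. -/

theorem mainTheorem1 (d : ℕ) (α : ℝ) (T₀ : Set (T d)) (hT₀ : SatisfiesAssumption α T₀)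
    (R : TSpace d →ₗ[ℝ] TSpace d) (hR : IsPreparationMap α R)
    (hRQ : R ∘ₗ Q0 = Q0 ∘ₗ R) (hRT₀ : ∀ τ ∈ treeSpan T₀, R τ ∈ treeSpan T₀)
    (τ : TSpace d) (hτ : τ ∈ treeSpan T₀) :
    ∃ r : ℕ, ∀ K : Pt d → ℝ, MeasureTheory.Integrable K → HasCompactSupport K →
      (∀ k : MIdx d, sdeg k ≤ r → ∫ z, K z * mpow z k = 0) →
      ∀ ξ δξ : Pt d → ℝ, ContDiff ℝ ∞ ξ → ContDiff ℝ ∞ δξ → ∀ x y : Pt d,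
        (HasMalliavin (fun η => modelTimes α 0 R K η δξ x τ) ξ δξ ∧
          VanishesToOrder (orderN d α)
            (modelTimes α 0 R K ξ δξ y (dGamma α R K ξ δξ y x τ)
              - malliavin (fun η => modelTimes α 0 R K η δξ x τ) ξ δξ
              + modelTimes α 0 R K ξ δξ x (QRoot (malliavinD τ))) y) ∧
        (HasMalliavin (fun η => model α 0 R K η δξ x τ) ξ δξ ∧
          VanishesToOrder (orderN d α)
            (model α 0 R K ξ δξ y (dGamma α R K ξ δξ y x τ)
              - malliavin (fun η => model α 0 R K η δξ x τ) ξ δξ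
              + modelTimes α 0 R K ξ δξ x (QRoot (malliavinD (R τ)))) y) := by
  have hd : ∀ σ ∈ treeSpan T₀, σ ∈ treeSpan (dotless d) := fun σ hσ =>
    treeSpan_mono (fun u hu => hT₀.no_dot u hu) hσ
  -- One `r` is chosen for both identities; the second uses the vanishing statement at `R τ`, but
  -- `dΓ_{yx}^1` still at `τ`.
  obtain ⟨r, hr⟩ := eventually_cancel.1 ((dGamma_eq hR τ).and
    ((modelAlg_dGamma hR hT₀ hτ).and (modelAlg_dGamma hR hT₀ (hRT₀ τ hτ))))
  refine ⟨r, fun K hK hc hm ξ δξ hξ hδξ x y => ?_⟩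
  obtain ⟨h1, h2, h3⟩ := hr ⟨K, ξ, δξ, hK, hc, hξ, hδξ⟩ hm
  obtain ⟨m1, m2⟩ := malliavin_model hR hRQ ⟨K, ξ, δξ, hK, hc, hξ, hδξ⟩ x (hd τ hτ)
  obtain ⟨m3, m4⟩ := malliavin_model hR hRQ ⟨K, ξ, δξ, hK, hc, hξ, hδξ⟩ x (hd _ (hRT₀ τ hτ))
  refine ⟨⟨m1, ?_⟩, ⟨m3, ?_⟩⟩
  · have e := h1 y x
    simp only at e m2
    rw [e, m2]
    exact h2 y x
  · have e := h1 y x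
    simp only at e m4
    have h4 := h3 y x
    -- In the statement for `R τ`, the map `R` is moved to the left through `D_Ξ`, both actions and
    -- `𝒬₀`, which turns `Π_y^{0,×} 𝒬₀ L D_Ξ R τ` into `Π_y^0 dΓ_{yx}^1 τ`. The last rewriting
    -- restores `D_Ξ R τ` in the two other terms.
    rw [← hR.malliavinD_comm τ (hd τ hτ), transl_apply, ← renorm_act hR, ← renorm_act hR,
      ← transl_apply, ← LinearMap.comp_apply Q0 R, ← hRQ, hR.malliavinD_comm τ (hd τ hτ)] at h4
    simp only [model, LinearMap.comp_apply]
    rw [e, m4]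
    exact h4
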